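/- **Setting.** Let $\mathcal X$ be a finite set, $I=(\alpha,\beta)\subset\mathbb R$ an open interval (for instance the interval between two consecutive singular times of a singular time-dependent Markov triple), and for each $t\in I$ let $(\mathcal X,Q_t,\pi_t)$ be a Markov triple: $Q_t(x,y)\ge 0$ for $x\ne y$, $Q_t(x,x)=-\sum_{y\neq x}Q_t(x,y)$, $Q_t$ is irreducible, and $\pi_t$ is a strictly positive probability measure with $Q_t(x,y)\pi_t(x)=Q_t(y,x)\pi_t(y)$. Assume that $t\mapsto\pi_t(x)$ is locally Lipschitz on $I$ and that for $x\neq y$ either $Q_t(x,y)=0$ for all $t\in I$, or $Q_t(x,y)>0$ for all $t\in I$ and $t\mapsto\log Q_t(x,y)$ is locally Lipschitz on $I$. **Notation.** Write $\langle\psi,\sigma\rangle=\sum_x\psi(x)\sigma(x)$, $\Lambda(a,b)=\int_0^1a^{r}b^{1-r}\,dr$, $\Lambda_t(\mu)(x,y)=\Lambda\big(\mu(x)Q_t(x,y),\mu(y)Q_t(y,x)\big)$ and $$\Gamma_t(\mu,\psi)=\tfrac12\sum_{x,y}(\psi(y)-\psi(x))^2\Lambda_t(\mu)(x,y).$$ Let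 $\mathcal H_t(\mu)=\sum_x\mu(x)\log\frac{\mu(x)}{\pi_t(x)}$ and $p_t=\log\pi_t$. The discrete transport distance on the probability measures $\mathcal P(\mathcal X)$ is given by $$\mathcal W_t(\mu^0,\mu^1)^2=\inf\int_0^1\tfrac12\sum_{x\ne y}\frac{V^a(x,y)^2}{\Lambda_t(\mu^a)(x,y)}\,da$$ (with $0/0=0$ and $c/0=+\infty$ for $c>0$), the infimum being over continuous curves $(\mu^a)_{a\in[0,1]}$ in $\mathcal P(\mathcal X)$ from $\mu^0$ to $\mu^1$ and integrable $V$ with $\dot\mu^a(x)+\frac12\sum_y\big(V^a(x,y)-V^a(y,x)\big)=0$ in the sense of distributions. For $s,t\in I$ put $\theta(a)=s+a(t-s)$ and $$\tfrac12\mathcal W_{s,t}(\mu^0,\mu^1)^2=\sup\big\{\langle\phi^1,\mu^1\rangle-\langle\phi^0,\mu^0\rangle\big\},$$ the supremum being over $C^1$ functions $\phi:[0,1]\to\mathbb R^{\mathcal X}$ with $\langle\dot\phi^a,\nu\rangle+\frac12\Gamma_{\theta(a)}(\nu,\phi^a)\le 0$ for all $\nu\in\mathcal P(\mathcal X)$ and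 $a\in(0,1)$. For $s\le t$ in $I$, $P_{t,s}\psi$ is the value at time $t$ of the solution of $\partial_r\psi_r(x)=\sum_yQ_r(x,y)(\psi_r(y)-\psi_r(x))$ with $\psi_s=\psi$, and $\hat P_{t,s}\sigma$ is the value at time $s$ of the solution of $\partial_r\sigma_r(x)=-\sum_yQ_r(y,x)\sigma_r(y)$ on $(\alpha,t]$ with $\sigma_t=\sigma$. **Proposition.** Assume that the gradient estimate $\Gamma_t(\mu,P_{t,s}\psi)\le\Gamma_s(\hat P_{t,s}\mu,\psi)$ holds for all $s\le t$ in $I$, $\mu\in\mathcal P(\mathcal X)$, $\psi\in\mathbb R^{\mathcal X}$. Let $\tau\in I$, $\mu\in\mathcal P(\mathcal X)$ and $\mu_t=\hat P_{\tau,t}\mu$ for $t\in I$, $t\le\tau$. (a) For all $s,t\in I$ with $s<t\le\tau$ and all $\sigma\in\mathcal P(\mathcal X)$, the quantities $\mathcal W_t(\mu_t,\sigma)$ and $\mathcal W_{s,t}(\mu_s,\sigma)$ are finite and, for every constant speed $\mathcal W_t$-geodesic $(\mu^a)_{a\in[0,1]}$ from $\mu^0=\mu_t$ to $\mu^1=\sigma$,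 with $\mu^a_\theta:=\hat P_{t,\theta(a)}\mu^a$, the function $a\mapsto\langle\dot p_{\theta(a)},\mu^a_\theta\rangle$ is integrable on $[0,1]$ and $$\mathcal H_s(\mu_s)-\mathcal H_t(\sigma)\le\frac1{2(t-s)}\Big[\mathcal W_t(\mu_t,\sigma)^2-\mathcal W_{s,t}(\mu_s,\sigma)^2\Big]+(t-s)\int_0^1\langle\dot p_{\theta(a)},\mu^a_\theta\rangle\,da .$$ (b) $(\mu_t)_{t\in I,\,t\le\tau}$ is a dynamic upward EVI$^-$-gradient flow of the entropy: it is a curve in $\mathcal P(\mathcal X)$ which, for each $r\in I$, is locally absolutely continuous on $(\alpha,\tau)$ and continuous at $\tau$ with respect to $\mathcal W_r$; $\mathcal W_{s,t}(\mu_s,\sigma)<\infty$ for all $s\le t\le\tau$ in $I$ and $\sigma\in\mathcal P(\mathcal X)$; and for all $t\in I$ with $t\le\tau$ and all $\sigma\in\mathcal P(\mathcal X)$ $$\liminf_{s\nearrow t}\frac{\tfrac12\mathcal W_{s,t}(\mu_s,\sigma)^2-\tfrac12\mathcal W_{t,t}(\mu_t,\sigma)^2}{s-t}\ \ge\ \mathcal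 H_t(\mu_t)-\mathcal H_t(\sigma).$$ -/

import Mathlib

open Set Filter Topology MeasureTheory
open scoped ENNReal

noncomputable section

namespace SRF

variable {X : Type*} [Fintype X]

/-! ### Markov triples -/

/-- `(X, Q, π)` is a Markov triple: nonnegative off-diagonal rates, rows summing to zero
(that is, `Q x x = - ∑_{y ≠ x} Q x y`), irreducibility, and detailed balance with respect to
the strictly positive probability measure `π`. -/
structure IsMarkovTriple (Q : X → X → ℝ) (π : X → ℝ) : Prop where
  rate_nonneg : ∀ x y, x ≠ y → 0 ≤ Q x y
  row_sum : ∀ x, ∑ y, Q x y = 0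
  irreducible : ∀ x y, Relation.ReflTransGen (fun u v => 0 < Q u v) x y
  pos : ∀ x, 0 < π x
  sum_eq_one : ∑ x, π x = 1
  reversible : ∀ x y, Q x y * π x = Q y x * π y

/-- A time-dependent Markov triple on the fixed finite set `X` during the open time interval
`(α, β)`: `π` is locally Lipschitz in time and each off-diagonal rate is either identically zero
or positive with locally Lipschitz logarithm. -/
structure IsTimeDependentTriple (α β : ℝ) (Q : ℝ → X → X → ℝ) (π : ℝ → X → ℝ) : Prop where
  triple : ∀ t ∈ Ioo α β, IsMarkovTriple (Q t) (π t)
  measure_lipschitz : ∀ x, LocallyLipschitzOn (Ioo α β) (fun t => π t x)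
  rate_logLipschitz : ∀ x y, x ≠ y →
    (∀ t ∈ Ioo α β, Q t x y = 0) ∨
    ((∀ t ∈ Ioo α β, 0 < Q t x y) ∧
      LocallyLipschitzOn (Ioo α β) (fun t => Real.log (Q t x y)))

/-! ### Pairing, mobility, carré du champ, entropy -/

/-- The pairing `⟨ψ, σ⟩ = ∑ x, ψ x σ x`. -/
def pairing (ψ σ : X → ℝ) : ℝ := ∑ x, ψ x * σ x

/-- The logarithmic mean `Λ(s, t) = ∫₀¹ s^a t^(1-a) da`, for `s, t ≥ 0`. -/
def logMean (s t : ℝ) : ℝ := ∫ a in (0 : ℝ)..1, s ^ a * t ^ (1 - a)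

/-- `Λ(μ)(x, y) = Λ(μ(x) Q(x, y), μ(y) Q(y, x))`; it is only meaningful, and only matters,
for `x ≠ y`. -/
def mobility (Q : X → X → ℝ) (μ : X → ℝ) (x y : X) : ℝ :=
  logMean (μ x * Q x y) (μ y * Q y x)

/-- `Γ(μ, ψ) = ‖∇ψ‖²_μ = ½ ∑_{x,y} (ψ y - ψ x)² Λ(μ)(x, y)`. -/
def gam (Q : X → X → ℝ) (μ ψ : X → ℝ) : ℝ :=
  1 / 2 * ∑ x, ∑ y, (ψ y - ψ x) ^ 2 * mobility Q μ x y

/-- The relative entropy `∑ x, μ x log (μ x / π x)` (with `0 log 0 = 0`). -/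
def entropy (π μ : X → ℝ) : ℝ := ∑ x, μ x * Real.log (μ x / π x)

/-! ### The discrete transport distance -/

/-- The function `v² / Λ(s, t)`, with value `0` if `v = 0 = Λ(s, t)` and `+∞` if
`v ≠ 0 = Λ(s, t)`. -/
def edgeCost (v s t : ℝ) : ℝ≥0∞ :=
  if logMean s t = 0 then (if v = 0 then 0 else ⊤) else ENNReal.ofReal (v ^ 2 / logMean s t)

open Classical in
/-- The action `𝒜(μ, V)`. The diagonal, which does not enter the continuity equation, is
left out. -/
def action (Q : X → X → ℝ) (μ : X → ℝ) (V : X → X → ℝ) : ℝ≥0∞ :=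
  1 / 2 * ∑ x, ∑ y with y ≠ x, edgeCost (V x y) (μ x * Q x y) (μ y * Q y x)

/-- Solutions `(μ, V)` on `[0, 1]` of the continuity equation
`μ̇(x) + ½ ∑ y, (V(x, y) - V(y, x)) = 0` from `μ₀` to `μ₁`. As `μ` is continuous and `V` is
integrable, the distributional equation is the integrated one. -/
structure ContinuityEq (μ₀ μ₁ : X → ℝ) (μ : ℝ → X → ℝ) (V : ℝ → X → X → ℝ) : Prop where
  continuousOn : ContinuousOn μ (Icc 0 1)
  left : μ 0 = μ₀
  right : μ 1 = μ₁
  mem : ∀ a ∈ Icc (0 : ℝ) 1, μ a ∈ stdSimplex ℝ X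
  integrable : ∀ x y, IntervalIntegrable (fun a => V a x y) volume 0 1
  eqn : ∀ a ∈ Icc (0 : ℝ) 1, ∀ x,
    μ a x = μ₀ x - ∫ r in (0 : ℝ)..a, 1 / 2 * ∑ y, (V r x y - V r y x)

/-- The discrete transport distance `𝒲(μ₀, μ₁)`: the square root of the infimum of
`∫₀¹ 𝒜(μ_a, V_a) da` over all solutions of the continuity equation. -/
def transportDist (Q : X → X → ℝ) (μ₀ μ₁ : X → ℝ) : ℝ≥0∞ :=
  (⨅ (μ : ℝ → X → ℝ) (V : ℝ → X → X → ℝ) (_ : ContinuityEq μ₀ μ₁ μ V),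
    ∫⁻ a in Icc (0 : ℝ) 1, action Q (μ a) (V a)) ^ (1 / 2 : ℝ)

/-- Constant speed `𝒲`-geodesics `[0, 1] → 𝒫(X)` from `μ₀` to `μ₁`. -/
structure IsGeodesic (Q : X → X → ℝ) (μ₀ μ₁ : X → ℝ) (γ : ℝ → X → ℝ) : Prop where
  mem : ∀ a ∈ Icc (0 : ℝ) 1, γ a ∈ stdSimplex ℝ X
  left : γ 0 = μ₀
  right : γ 1 = μ₁
  speed : ∀ a ∈ Icc (0 : ℝ) 1, ∀ b ∈ Icc (0 : ℝ) 1,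
    transportDist Q (γ a) (γ b) = ENNReal.ofReal |a - b| * transportDist Q μ₀ μ₁

/-! ### The two-time transport cost -/

/-- `θ(a) = s + a (t - s)`. -/
def interp (s t a : ℝ) : ℝ := s + a * (t - s)

/-- `HJ_{s,t}`: the `C¹` functions `φ : [0, 1] → ℝ^X` with
`⟨φ̇^a, μ⟩ + ½ ‖∇φ^a‖²_{μ, θ(a)} ≤ 0` for all `μ ∈ 𝒫(X)` and `a ∈ (0, 1)`. -/
structure IsHJSubsolution (Q : ℝ → X → X → ℝ) (s t : ℝ) (φ : ℝ → X → ℝ) : Prop where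
  contDiffOn : ContDiffOn ℝ 1 φ (Icc 0 1)
  subsolution : ∀ a ∈ Ioo (0 : ℝ) 1, ∀ μ ∈ stdSimplex ℝ X,
    pairing (deriv φ a) μ + 1 / 2 * gam (Q (interp s t a)) μ (φ a) ≤ 0

/-- The two-time cost `𝒲_{s,t}(μ₀, μ₁)`, given by
`½ 𝒲_{s,t}(μ₀, μ₁)² = sup {⟨φ¹, μ₁⟩ - ⟨φ⁰, μ₀⟩ : φ ∈ HJ_{s,t}}`. The supremum is nonnegative
because `φ = 0` is admissible. -/
def twoTimeCost (Q : ℝ → X → X → ℝ) (s t : ℝ) (μ₀ μ₁ : X → ℝ) : ℝ≥0∞ :=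
  (2 * ⨆ (φ : ℝ → X → ℝ) (_ : IsHJSubsolution Q s t φ),
    ENNReal.ofReal (pairing (φ 1) μ₁ - pairing (φ 0) μ₀)) ^ (1 / 2 : ℝ)

/-! ### Heat propagators -/

/-- The generator `Δψ(x) = ∑ y, Q(x, y) (ψ y - ψ x)`. -/
def laplacian (Q : X → X → ℝ) (ψ : X → ℝ) (x : X) : ℝ := ∑ y, Q x y * (ψ y - ψ x)

/-- The adjoint generator `Δ̂σ(x) = ∑ y, Q(y, x) σ y`. -/
def dualLaplacian (Q : X → X → ℝ) (σ : X → ℝ) (x : X) : ℝ := ∑ y, Q y x * σ y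

/-- `ψ` solves `∂_t ψ = Δ_t ψ` on `(s, β)`, is continuous at `s`, and `ψ s = ψ₀`. -/
structure IsHeatSolution (β : ℝ) (Q : ℝ → X → X → ℝ) (s : ℝ) (ψ₀ : X → ℝ)
    (ψ : ℝ → X → ℝ) : Prop where
  initial : ψ s = ψ₀
  continuous : ContinuousWithinAt ψ (Ici s) s
  eqn : ∀ t ∈ Ioo s β, HasDerivAt ψ (laplacian (Q t) (ψ t)) t

/-- `σ` solves `∂_s σ = - Δ̂_s σ` on `(α, t)`, is continuous at `t`, and `σ t = σ₀`. -/
structure IsDualHeatSolution (α : ℝ) (Q : ℝ → X → X → ℝ) (t : ℝ) (σ₀ : X → ℝ)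
    (σ : ℝ → X → ℝ) : Prop where
  terminal : σ t = σ₀
  continuous : ContinuousWithinAt σ (Iic t) t
  eqn : ∀ s ∈ Ioo α t, HasDerivAt σ (-dualLaplacian (Q s) (σ s)) s

/-- The heat propagator `P_{t,s} ψ₀ = ψ(t)`, `α < s ≤ t < β`, where `ψ` is the (unique) solution
of the heat equation on `[s, β)` with `ψ(s) = ψ₀`. -/
def heatProp (β : ℝ) (Q : ℝ → X → X → ℝ) (t s : ℝ) (ψ₀ : X → ℝ) : X → ℝ :=
  Classical.epsilon (fun ψ : ℝ → X → ℝ => IsHeatSolution β Q s ψ₀ ψ) t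

/-- The dual heat propagator `P̂_{t,s} σ₀ = σ(s)`, `α < s ≤ t < β`, where `σ` is the (unique)
solution of the dual heat equation on `(α, t]` with `σ(t) = σ₀`. -/
def dualHeatProp (α : ℝ) (Q : ℝ → X → X → ℝ) (t s : ℝ) (σ₀ : X → ℝ) : X → ℝ :=
  Classical.epsilon (fun σ : ℝ → X → ℝ => IsDualHeatSolution α Q t σ₀ σ) s

/-- The gradient estimate `Γ_t(μ, P_{t,s} ψ) ≤ Γ_s(P̂_{t,s} μ, ψ)` on the interval `(α, β)`. -/
def GradientEstimate (α β : ℝ) (Q : ℝ → X → X → ℝ) : Prop :=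
  ∀ s ∈ Ioo α β, ∀ t ∈ Ioo α β, s ≤ t → ∀ μ ∈ stdSimplex ℝ X, ∀ ψ : X → ℝ,
    gam (Q t) μ (heatProp β Q t s ψ) ≤ gam (Q s) (dualHeatProp α Q t s μ) ψ

/-! ### Dynamic upward EVI⁻ gradient flows -/

/-- The lower left derivative `liminf_{s ↗ t} (f s - f t) / (s - t)`. -/
def lowerLeftDeriv (f : ℝ → ℝ) (t : ℝ) : EReal :=
  liminf (fun s => (((f s - f t) / (s - t) : ℝ) : EReal)) (𝓝[<] t)

/-- The curve `(μ_t)`, `t ∈ (α, β)`, `t ≤ τ`, running backwards from time `τ`, is a dynamic upward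
EVI⁻-gradient flow for the entropy: it is a curve of probability measures, locally absolutely
continuous on `(α, τ)` and continuous at its starting time `τ` (with respect to each of the
distances `𝒲_r`), and
`½ ∂⁻_s 𝒲_{s,t}(μ_s, σ)² |_{s = t-} ≥ ℋ_t(μ_t) - ℋ_t(σ)`. -/
structure IsDynamicUpwardEVI (α β τ : ℝ) (Q : ℝ → X → X → ℝ) (π : ℝ → X → ℝ)
    (μ : ℝ → X → ℝ) : Prop where
  mem : ∀ t ∈ Ioo α β, t ≤ τ → μ t ∈ stdSimplex ℝ X
  locally_ac : ∀ r ∈ Ioo α β, ∃ m : ℝ → ℝ, LocallyIntegrableOn m (Ioo α τ) volume ∧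
    ∀ s ∈ Ioo α τ, ∀ t ∈ Ioo α τ, s ≤ t →
      transportDist (Q r) (μ s) (μ t) ≤ ENNReal.ofReal (∫ u in s..t, m u)
  continuous_start : ∀ r ∈ Ioo α β,
    Tendsto (fun s => transportDist (Q r) (μ s) (μ τ)) (𝓝[<] τ) (𝓝 0)
  cost_finite : ∀ s ∈ Ioo α β, ∀ t ∈ Ioo α β, s ≤ t → t ≤ τ → ∀ σ ∈ stdSimplex ℝ X,
    twoTimeCost Q s t (μ s) σ ≠ ⊤
  evi : ∀ t ∈ Ioo α β, t ≤ τ → ∀ σ ∈ stdSimplex ℝ X,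
    ((entropy (π t) (μ t) - entropy (π t) σ : ℝ) : EReal) ≤
      lowerLeftDeriv (fun s => 1 / 2 * (twoTimeCost Q s t (μ s) σ).toReal ^ 2) t

end SRF

end

noncomputable section

set_option linter.unusedSectionVars false

namespace SRF

variable {X : Type*} [Fintype X]

/-! ### The logarithmic mean -/

lemma rpow_mul_rpow_le {s t a : ℝ} (hs : 0 ≤ s) (ht : 0 ≤ t) (ha : a ∈ Icc (0 : ℝ) 1) :
    s ^ a * t ^ (1 - a) ≤ a * s + (1 - a) * t :=
  Real.geom_mean_le_arith_mean2_weighted ha.1 (by linarith [ha.2]) hs ht (by ring)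

lemma rpow_mul_rpow_nonneg {s t a : ℝ} (hs : 0 ≤ s) (ht : 0 ≤ t) :
    0 ≤ s ^ a * t ^ (1 - a) := mul_nonneg (Real.rpow_nonneg hs _) (Real.rpow_nonneg ht _)

lemma rpow_mul_rpow_le_add {s t a : ℝ} (hs : 0 ≤ s) (ht : 0 ≤ t) (ha : a ∈ Icc (0 : ℝ) 1) :
    s ^ a * t ^ (1 - a) ≤ s + t := by
  refine (rpow_mul_rpow_le hs ht ha).trans ?_
  nlinarith [ha.1, ha.2, mul_nonneg hs (sub_nonneg.2 ha.2), mul_nonneg ht ha.1]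

lemma measurable_rpow_mul_rpow (s t : ℝ) : Measurable fun a : ℝ => s ^ a * t ^ (1 - a) :=
  (measurable_const.pow measurable_id).mul
    (measurable_const.pow (measurable_const.sub measurable_id))

lemma intervalIntegrable_rpow_mul_rpow {s t : ℝ} (hs : 0 ≤ s) (ht : 0 ≤ t) :
    IntervalIntegrable (fun a : ℝ => s ^ a * t ^ (1 - a)) volume 0 1 := by
  refine (intervalIntegrable_const (c := s + t)).mono_fun
    (measurable_rpow_mul_rpow s t).aestronglyMeasurable ?_
  refine (ae_restrict_iff' measurableSet_uIoc).2 (Eventually.of_forall fun a ha => ?_)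
  rw [uIoc_of_le zero_le_one] at ha
  beta_reduce
  rw [Real.norm_of_nonneg (rpow_mul_rpow_nonneg hs ht), Real.norm_of_nonneg (add_nonneg hs ht)]
  exact rpow_mul_rpow_le_add hs ht ⟨ha.1.le, ha.2⟩

lemma logMean_nonneg {s t : ℝ} (hs : 0 ≤ s) (ht : 0 ≤ t) : 0 ≤ logMean s t :=
  intervalIntegral.integral_nonneg zero_le_one fun _ _ => rpow_mul_rpow_nonneg hs ht

lemma logMean_smul {c s t : ℝ} (hc : 0 ≤ c) (hs : 0 ≤ s) (ht : 0 ≤ t) :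
    logMean (c * s) (c * t) = c * logMean s t := by
  unfold logMean
  rw [← intervalIntegral.integral_const_mul]
  refine intervalIntegral.integral_congr fun a _ => ?_
  rcases hc.eq_or_lt with rfl | hc'
  · by_cases h : a = 0
    · simp [h]
    · simp [Real.zero_rpow h]
  · rw [Real.mul_rpow hc hs, Real.mul_rpow hc ht,
      show c ^ a * s ^ a * (c ^ (1 - a) * t ^ (1 - a))
        = c ^ a * c ^ (1 - a) * (s ^ a * t ^ (1 - a)) by ring,
      ← Real.rpow_add hc']
    simp

lemma rpow_mul_rpow_superadd {s t s' t' a : ℝ} (hs : 0 ≤ s) (ht : 0 ≤ t) (hs' : 0 ≤ s')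
    (ht' : 0 ≤ t') (ha : a ∈ Ioo (0 : ℝ) 1) :
    s ^ a * t ^ (1 - a) + s' ^ a * t' ^ (1 - a) ≤ (s + s') ^ a * (t + t') ^ (1 - a) := by
  have h1a : 1 - a ≠ 0 := by linarith [ha.2]
  rcases (add_nonneg hs hs').eq_or_lt with h | h
  · have e : s = 0 := by linarith
    have e' : s' = 0 := by linarith
    simp [e, e', Real.zero_rpow ha.1.ne']
  rcases (add_nonneg ht ht').eq_or_lt with h2 | h2
  · have e : t = 0 := by linarith
    have e' : t' = 0 := by linarith
    simp [e, e', Real.zero_rpow h1a]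
  have key : ∀ u v, 0 ≤ u → 0 ≤ v → u ^ a * v ^ (1 - a) ≤
      (a * (u / (s + s')) + (1 - a) * (v / (t + t'))) *
        ((s + s') ^ a * (t + t') ^ (1 - a)) := by
    intro u v hu hv
    have := rpow_mul_rpow_le (div_nonneg hu h.le) (div_nonneg hv h2.le) ⟨ha.1.le, ha.2.le⟩
    rw [Real.div_rpow hu h.le, Real.div_rpow hv h2.le, div_mul_div_comm,
      div_le_iff₀ (mul_pos (Real.rpow_pos_of_pos h _) (Real.rpow_pos_of_pos h2 _))] at this
    exact this
  refine (add_le_add (key s t hs ht) (key s' t' hs' ht')).trans_eq ?_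
  rw [← add_mul]
  have : a * (s / (s + s')) + (1 - a) * (t / (t + t')) +
      (a * (s' / (s + s')) + (1 - a) * (t' / (t + t'))) = 1 := by
    field_simp; ring
  rw [this, one_mul]

lemma logMean_superadd {s t s' t' : ℝ} (hs : 0 ≤ s) (ht : 0 ≤ t) (hs' : 0 ≤ s') (ht' : 0 ≤ t') :
    logMean s t + logMean s' t' ≤ logMean (s + s') (t + t') := by
  unfold logMean
  rw [← intervalIntegral.integral_add (intervalIntegrable_rpow_mul_rpow hs ht)
    (intervalIntegrable_rpow_mul_rpow hs' ht')]
  exact intervalIntegral.integral_mono_on_of_le_Ioo zero_le_one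
    ((intervalIntegrable_rpow_mul_rpow hs ht).add (intervalIntegrable_rpow_mul_rpow hs' ht'))
    (intervalIntegrable_rpow_mul_rpow (add_nonneg hs hs') (add_nonneg ht ht'))
    fun a ha => rpow_mul_rpow_superadd hs ht hs' ht' ha

lemma logMean_mono {s t s' t' : ℝ} (hs : 0 ≤ s) (ht : 0 ≤ t) (hs' : s ≤ s') (ht' : t ≤ t') :
    logMean s t ≤ logMean s' t' := by
  have := logMean_superadd hs ht (sub_nonneg.2 hs') (sub_nonneg.2 ht')
  simp only [add_sub_cancel] at this
  linarith [logMean_nonneg (sub_nonneg.2 hs') (sub_nonneg.2 ht')]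

lemma logMean_self {s : ℝ} (hs : 0 ≤ s) : logMean s s = s := by
  have h1 : logMean 1 1 = 1 := by simp [logMean]
  simpa [h1] using logMean_smul hs zero_le_one zero_le_one

lemma le_logMean {m s t : ℝ} (hm : 0 ≤ m) (hs : m ≤ s) (ht : m ≤ t) : m ≤ logMean s t :=
  (logMean_self hm).symm.le.trans (logMean_mono hm hm hs ht)

lemma logMean_zero_zero : logMean 0 0 = 0 := logMean_self le_rfl

lemma continuous_logMean_max : Continuous fun p : ℝ × ℝ => logMean (max p.1 0) (max p.2 0) := by
  unfold logMean
  rw [continuous_iff_continuousAt]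
  intro p
  refine intervalIntegral.continuousAt_of_dominated_interval
    (bound := fun _ => (|p.1| + 1) + (|p.2| + 1))
    (Eventually.of_forall fun q => (measurable_rpow_mul_rpow _ _).aestronglyMeasurable)
    ?_ intervalIntegrable_const (Eventually.of_forall fun a ha => ?_)
  · have h1 : ∀ᶠ q : ℝ × ℝ in 𝓝 p, |q.1| < |p.1| + 1 :=
      (continuous_fst.abs.tendsto p).eventually_lt_const (lt_add_one _)
    have h2 : ∀ᶠ q : ℝ × ℝ in 𝓝 p, |q.2| < |p.2| + 1 :=
      (continuous_snd.abs.tendsto p).eventually_lt_const (lt_add_one _)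
    filter_upwards [h1, h2] with q hq1 hq2
    refine Eventually.of_forall fun a ha => ?_
    rw [uIoc_of_le zero_le_one] at ha
    rw [Real.norm_of_nonneg (rpow_mul_rpow_nonneg (le_max_right _ _) (le_max_right _ _))]
    refine (rpow_mul_rpow_le_add (le_max_right _ _) (le_max_right _ _) ⟨ha.1.le, ha.2⟩).trans ?_
    refine add_le_add (max_le ((le_abs_self _).trans hq1.le) (by positivity))
      (max_le ((le_abs_self _).trans hq2.le) (by positivity))
  · rw [uIoc_of_le zero_le_one] at ha
    refine Continuous.continuousAt ?_
    refine Continuous.mul ?_ ?_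
    · exact (continuous_fst.max continuous_const).rpow_const fun _ => Or.inr ha.1.le
    · exact (continuous_snd.max continuous_const).rpow_const fun _ => Or.inr (by linarith [ha.2])

lemma log_sub_log_mul_logMean {s t : ℝ} (hs : 0 < s) (ht : 0 < t) :
    (Real.log s - Real.log t) * logMean s t = s - t := by
  have hd : ∀ a : ℝ, HasDerivAt (fun a : ℝ => s ^ a * t ^ (1 - a))
      ((Real.log s - Real.log t) * (s ^ a * t ^ (1 - a))) a := by
    intro a
    have h1 := (hasDerivAt_id a).const_rpow hs
    have h2 := ((hasDerivAt_id a).const_sub 1).const_rpow ht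
    refine (h1.mul h2).congr_deriv ?_
    simp only [id]; ring
  have := intervalIntegral.integral_eq_sub_of_hasDerivAt (a := 0) (b := 1) (fun a _ => hd a)
    ((intervalIntegrable_rpow_mul_rpow hs.le ht.le).const_mul _)
  rw [intervalIntegral.integral_const_mul] at this
  simpa [logMean] using this

/-! ### Mobility and carré du champ -/

lemma IsMarkovTriple.rate_pos_symm {Q : X → X → ℝ} {π : X → ℝ} (h : IsMarkovTriple Q π) {x y : X}
    (hxy : 0 < Q x y) : 0 < Q y x := by
  have := h.reversible x y
  have h1 := mul_pos hxy (h.pos x)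
  rw [this] at h1
  exact pos_of_mul_pos_left h1 (h.pos y).le

lemma IsMarkovTriple.rate_zero_symm {Q : X → X → ℝ} {π : X → ℝ} (h : IsMarkovTriple Q π) {x y : X}
    (hxy : Q x y = 0) : Q y x = 0 := by
  have := h.reversible x y
  rw [hxy, zero_mul, eq_comm, mul_eq_zero] at this
  exact this.resolve_right (h.pos y).ne'

/-- Off-diagonal rates are nonnegative. -/
def NonnegRates (Q : X → X → ℝ) : Prop := ∀ x y, x ≠ y → 0 ≤ Q x y

lemma mobility_nonneg {Q : X → X → ℝ} (hQ : NonnegRates Q) {μ : X → ℝ} (hμ : ∀ x, 0 ≤ μ x)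
    {x y : X} (hxy : x ≠ y) : 0 ≤ mobility Q μ x y :=
  logMean_nonneg (mul_nonneg (hμ x) (hQ x y hxy)) (mul_nonneg (hμ y) (hQ y x hxy.symm))

lemma mobility_superadd {Q : X → X → ℝ} (hQ : NonnegRates Q) {μ ν : X → ℝ} (hμ : ∀ x, 0 ≤ μ x)
    (hν : ∀ x, 0 ≤ ν x) {x y : X} (hxy : x ≠ y) :
    mobility Q μ x y + mobility Q ν x y ≤ mobility Q (fun z => μ z + ν z) x y := by
  have hx := hQ x y hxy
  have hy := hQ y x hxy.symm
  simp only [mobility, add_mul]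
  exact logMean_superadd (mul_nonneg (hμ x) hx) (mul_nonneg (hμ y) hy)
    (mul_nonneg (hν x) hx) (mul_nonneg (hν y) hy)

lemma mobility_smul {Q : X → X → ℝ} (hQ : NonnegRates Q) {μ : X → ℝ} (hμ : ∀ x, 0 ≤ μ x)
    {c : ℝ} (hc : 0 ≤ c) {x y : X} (hxy : x ≠ y) :
    mobility Q (fun z => c * μ z) x y = c * mobility Q μ x y := by
  simp only [mobility, mul_assoc]
  exact logMean_smul hc (mul_nonneg (hμ x) (hQ x y hxy)) (mul_nonneg (hμ y) (hQ y x hxy.symm))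

lemma mobility_mono {Q : X → X → ℝ} (hQ : NonnegRates Q) {μ ν : X → ℝ} (hμ : ∀ x, 0 ≤ μ x)
    (hν : ∀ x, μ x ≤ ν x) {x y : X} (hxy : x ≠ y) :
    mobility Q μ x y ≤ mobility Q ν x y :=
  logMean_mono (mul_nonneg (hμ x) (hQ x y hxy)) (mul_nonneg (hμ y) (hQ y x hxy.symm))
    (mul_le_mul_of_nonneg_right (hν x) (hQ x y hxy))
    (mul_le_mul_of_nonneg_right (hν y) (hQ y x hxy.symm))

lemma mobility_sum {Q : X → X → ℝ} (hQ : NonnegRates Q) {ι : Type*} (s : Finset ι)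
    (p : ι → ℝ) (hp : ∀ i ∈ s, 0 ≤ p i) (μ : ι → X → ℝ) (hμ : ∀ i ∈ s, ∀ x, 0 ≤ μ i x)
    {x y : X} (hxy : x ≠ y) :
    ∑ i ∈ s, p i * mobility Q (μ i) x y ≤ mobility Q (fun z => ∑ i ∈ s, p i * μ i z) x y := by
  classical
  induction s using Finset.induction_on with
  | empty => simp [mobility, logMean_zero_zero]
  | insert i s hi ih =>
    simp only [Finset.sum_insert hi]
    have h1 := ih (fun j hj => hp j (Finset.mem_insert_of_mem hj))
      (fun j hj => hμ j (Finset.mem_insert_of_mem hj))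
    have hpi := hp i (Finset.mem_insert_self i s)
    have hμi := hμ i (Finset.mem_insert_self i s)
    rw [← mobility_smul hQ hμi hpi hxy]
    refine (add_le_add_right h1 _).trans ?_
    refine mobility_superadd hQ (fun z => mul_nonneg hpi (hμi z)) (fun z => ?_) hxy
    exact Finset.sum_nonneg fun j hj => mul_nonneg (hp j (Finset.mem_insert_of_mem hj))
      (hμ j (Finset.mem_insert_of_mem hj) z)

lemma gam_le_of_mobility_le {Q Q' : X → X → ℝ} {μ ν ψ : X → ℝ}
    (h : ∀ x y, x ≠ y → mobility Q μ x y ≤ mobility Q' ν x y) : gam Q μ ψ ≤ gam Q' ν ψ := by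
  unfold gam
  refine mul_le_mul_of_nonneg_left (Finset.sum_le_sum fun x _ => Finset.sum_le_sum fun y _ => ?_)
    (by norm_num)
  by_cases hxy : x = y
  · simp [hxy]
  · exact mul_le_mul_of_nonneg_left (h x y hxy) (sq_nonneg _)

lemma gam_smul_left {Q : X → X → ℝ} (hQ : NonnegRates Q) {μ : X → ℝ} (hμ : ∀ x, 0 ≤ μ x)
    {c : ℝ} (hc : 0 ≤ c) (ψ : X → ℝ) : gam Q (fun z => c * μ z) ψ = c * gam Q μ ψ := by
  simp only [gam]
  rw [mul_left_comm, Finset.mul_sum (a := c)]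
  congr 1
  refine Finset.sum_congr rfl fun x _ => ?_
  rw [Finset.mul_sum]
  refine Finset.sum_congr rfl fun y _ => ?_
  by_cases hxy : x = y
  · simp [hxy]
  · rw [mobility_smul hQ hμ hc hxy]; ring

lemma gam_superadd {Q : X → X → ℝ} (hQ : NonnegRates Q) {μ ν : X → ℝ} (hμ : ∀ x, 0 ≤ μ x)
    (hν : ∀ x, 0 ≤ ν x) (ψ : X → ℝ) :
    gam Q μ ψ + gam Q ν ψ ≤ gam Q (fun z => μ z + ν z) ψ := by
  unfold gam
  rw [← mul_add, ← Finset.sum_add_distrib]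
  refine mul_le_mul_of_nonneg_left (Finset.sum_le_sum fun x _ => ?_) (by norm_num)
  rw [← Finset.sum_add_distrib]
  refine Finset.sum_le_sum fun y _ => ?_
  by_cases hxy : x = y
  · simp [hxy]
  · rw [← mul_add]
    exact mul_le_mul_of_nonneg_left (mobility_superadd hQ hμ hν hxy) (sq_nonneg _)

lemma continuousOn_mobility {Q : X → X → ℝ} (hQ : NonnegRates Q) {x y : X} (hxy : x ≠ y) :
    ContinuousOn (fun μ : X → ℝ => mobility Q μ x y) {μ | ∀ x, 0 ≤ μ x} := by
  have : Continuous fun μ : X → ℝ => logMean (max (μ x * Q x y) 0) (max (μ y * Q y x) 0) :=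
    continuous_logMean_max.comp (Continuous.prodMk ((continuous_apply x).mul continuous_const)
      ((continuous_apply y).mul continuous_const))
  refine this.continuousOn.congr fun μ hμ => ?_
  simp only [mobility]
  rw [max_eq_left (mul_nonneg (hμ x) (hQ x y hxy)),
    max_eq_left (mul_nonneg (hμ y) (hQ y x hxy.symm))]

lemma continuousOn_gam {Q : X → X → ℝ} (hQ : NonnegRates Q) (ψ : X → ℝ) :
    ContinuousOn (fun μ : X → ℝ => gam Q μ ψ) {μ | ∀ x, 0 ≤ μ x} := by
  unfold gam
  refine continuousOn_const.mul (continuousOn_finsetSum _ fun x _ =>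
    continuousOn_finsetSum _ fun y _ => ?_)
  by_cases hxy : x = y
  · subst hxy
    simpa using continuousOn_const
  · exact continuousOn_const.mul (continuousOn_mobility hQ hxy)

/-! ### Linear differential equations with continuous coefficients -/

/-- The linear vector field with coefficient matrix `B`. -/
def linField (B : X → X → ℝ) (v : X → ℝ) : X → ℝ := fun x => ∑ y, B x y * v y

/-- The sum of the absolute values of the coefficients. -/
def coeffSum (B : X → X → ℝ) : ℝ := ∑ x, ∑ y, |B x y|

lemma coeffSum_nonneg (B : X → X → ℝ) : 0 ≤ coeffSum B :=
  Finset.sum_nonneg fun _ _ => Finset.sum_nonneg fun _ _ => abs_nonneg _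

lemma abs_le_coeffSum (B : X → X → ℝ) (x y : X) : |B x y| ≤ coeffSum B :=
  (Finset.single_le_sum (f := fun y => |B x y|) (fun _ _ => abs_nonneg _)
    (Finset.mem_univ y)).trans
  (Finset.single_le_sum (f := fun x => ∑ y, |B x y|)
    (fun _ _ => Finset.sum_nonneg fun _ _ => abs_nonneg _) (Finset.mem_univ x))

lemma norm_linField_le (B : X → X → ℝ) (v : X → ℝ) : ‖linField B v‖ ≤ coeffSum B * ‖v‖ := by
  refine (pi_norm_le_iff_of_nonneg (mul_nonneg (coeffSum_nonneg B) (norm_nonneg v))).2 fun x => ?_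
  calc ‖∑ y, B x y * v y‖ ≤ ∑ y, ‖B x y * v y‖ := norm_sum_le _ _
    _ ≤ ∑ y, |B x y| * ‖v‖ := Finset.sum_le_sum fun y _ => by
        rw [norm_mul, Real.norm_eq_abs]
        exact mul_le_mul_of_nonneg_left (norm_le_pi_norm v y) (abs_nonneg _)
    _ = (∑ y, |B x y|) * ‖v‖ := (Finset.sum_mul _ _ _).symm
    _ ≤ coeffSum B * ‖v‖ := mul_le_mul_of_nonneg_right
        (Finset.single_le_sum (f := fun x => ∑ y, |B x y|)
          (fun _ _ => Finset.sum_nonneg fun _ _ => abs_nonneg _) (Finset.mem_univ x))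
        (norm_nonneg v)

lemma linField_sub (B : X → X → ℝ) (v w : X → ℝ) :
    linField B (v - w) = linField B v - linField B w := by
  ext x
  simp [linField, mul_sub]

lemma continuousOn_coeffSum {B : ℝ → X → X → ℝ} {S : Set ℝ}
    (hB : ∀ x y, ContinuousOn (fun t => B t x y) S) : ContinuousOn (fun t => coeffSum (B t)) S :=
  continuousOn_finsetSum _ fun x _ => continuousOn_finsetSum _ fun y _ => (hB x y).abs

lemma exists_coeffSum_bound {B : ℝ → X → X → ℝ} {a b : ℝ}
    (hB : ∀ x y, ContinuousOn (fun t => B t x y) (Icc a b)) :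
    ∃ K, 0 ≤ K ∧ ∀ t ∈ Icc a b, coeffSum (B t) ≤ K := by
  obtain ⟨K, hK⟩ := isCompact_Icc.exists_bound_of_continuousOn (continuousOn_coeffSum hB)
  exact ⟨max K 0, le_max_right _ _, fun t ht =>
    (le_abs_self _).trans ((hK t ht).trans (le_max_left _ _))⟩

/-- Truncation of the coordinates to `[-R, R]`. -/
def clip (R : ℝ) (v : X → ℝ) : X → ℝ := fun x => max (-R) (min R (v x))

lemma norm_clip_le {R : ℝ} (hR : 0 ≤ R) (v : X → ℝ) : ‖clip R v‖ ≤ R := by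
  refine (pi_norm_le_iff_of_nonneg hR).2 fun x => ?_
  rw [Real.norm_eq_abs, abs_le]
  exact ⟨le_max_left _ _, max_le (by linarith) (min_le_left _ _)⟩

lemma clip_eq_self {R : ℝ} {v : X → ℝ} (h : ‖v‖ ≤ R) : clip R v = v := by
  ext x
  have := abs_le.1 ((Real.norm_eq_abs _ ▸ norm_le_pi_norm v x).trans h)
  simp [clip, min_eq_right this.2, max_eq_right this.1]

lemma norm_clip_le_norm {R : ℝ} (hR : 0 ≤ R) (v : X → ℝ) : ‖clip R v‖ ≤ ‖v‖ := by
  refine (pi_norm_le_iff_of_nonneg (norm_nonneg v)).2 fun x => ?_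
  have h := abs_le.1 (Real.norm_eq_abs _ ▸ norm_le_pi_norm v x)
  have hv := norm_nonneg v
  rw [Real.norm_eq_abs, abs_le]
  constructor
  · exact le_max_of_le_right (le_min (by linarith) h.1)
  · exact max_le (by linarith) ((min_le_right _ _).trans h.2)

lemma norm_clip_sub_le (R : ℝ) (v w : X → ℝ) : ‖clip R v - clip R w‖ ≤ ‖v - w‖ := by
  refine (pi_norm_le_iff_of_nonneg (norm_nonneg _)).2 fun x => ?_
  refine le_trans ?_ (norm_le_pi_norm (v - w) x)
  simp only [clip, Pi.sub_apply, Real.norm_eq_abs]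
  refine (abs_max_sub_max_le_max _ _ _ _).trans ?_
  simp only [sub_self, abs_zero]
  refine max_le (abs_nonneg _) ((abs_min_sub_min_le_max _ _ _ _).trans ?_)
  simp

lemma continuousOn_linField {B : ℝ → X → X → ℝ} {S : Set ℝ}
    (hB : ∀ x y, ContinuousOn (fun t => B t x y) S) {v : ℝ → X → ℝ} (hv : ContinuousOn v S) :
    ContinuousOn (fun t => linField (B t) (v t)) S :=
  continuousOn_pi.2 fun x => continuousOn_finsetSum _ fun y _ =>
    (hB x y).mul (continuousOn_pi.1 hv y)

lemma exists_linear_solution_Icc {B : ℝ → X → X → ℝ} {a b : ℝ} (hab : a ≤ b)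
    (hB : ∀ x y, ContinuousOn (fun t => B t x y) (Icc a b)) (v₀ : X → ℝ) :
    ∃ v : ℝ → X → ℝ, v a = v₀ ∧
      ∀ t ∈ Icc a b, HasDerivWithinAt v (linField (B t) (v t)) (Icc a b) t := by
  obtain ⟨K, hK0, hK⟩ := exists_coeffSum_bound hB
  set R : ℝ := ‖v₀‖ * Real.exp (K * (b - a)) with hR
  have hR0 : 0 ≤ R := by positivity
  have hPL : IsPicardLindelof (fun t v => linField (B t) (clip R v)) (tmin := a) (tmax := b)
      ⟨a, left_mem_Icc.2 hab⟩ v₀ (Real.toNNReal (K * R * (b - a))) 0 (Real.toNNReal (K * R))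
      (Real.toNNReal K) := by
    refine ⟨fun t ht => ?_, fun v _ => continuousOn_linField hB continuousOn_const,
      fun t ht v _ => ?_, ?_⟩
    · refine (LipschitzWith.of_dist_le_mul fun v w => ?_).lipschitzOnWith
      rw [dist_eq_norm, dist_eq_norm, ← linField_sub, Real.coe_toNNReal _ hK0]
      exact (norm_linField_le _ _).trans (mul_le_mul (hK t ht) (norm_clip_sub_le R v w)
        (norm_nonneg _) hK0)
    · rw [Real.coe_toNNReal _ (mul_nonneg hK0 hR0)]
      exact (norm_linField_le _ _).trans (mul_le_mul (hK t ht) (norm_clip_le hR0 v)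
        (norm_nonneg _) hK0)
    · have hba : 0 ≤ b - a := sub_nonneg.2 hab
      rw [Real.coe_toNNReal _ (mul_nonneg hK0 hR0),
        Real.coe_toNNReal _ (mul_nonneg (mul_nonneg hK0 hR0) hba)]
      simp [max_eq_left hba]
  obtain ⟨v, hva, hv⟩ := hPL.exists_eq_forall_mem_Icc_hasDerivWithinAt₀
  have hcont : ContinuousOn v (Icc a b) := fun t ht => (hv t ht).continuousWithinAt
  have hbound : ∀ t ∈ Icc a b, ‖v t‖ ≤ R := by
    intro t ht
    have hva' : v a = v₀ := hva
    have := norm_le_gronwallBound_of_norm_deriv_right_le (K := K) (ε := 0) (δ := ‖v₀‖) hcont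
      (fun t ht => (hv t ⟨ht.1, ht.2.le⟩).mono_of_mem_nhdsWithin
        (mem_of_superset (Icc_mem_nhdsGE ht.2) (Icc_subset_Icc_left ht.1)))
      (by rw [hva']) (fun t ht => by
        rw [add_zero]
        exact (norm_linField_le _ _).trans (mul_le_mul (hK t ⟨ht.1, ht.2.le⟩)
          (norm_clip_le_norm hR0 _) (norm_nonneg _) hK0)) t ht
    rw [gronwallBound_ε0] at this
    refine this.trans ?_
    rw [hR]
    have h2 := ht.2
    gcongr
  refine ⟨v, hva, fun t ht => ?_⟩
  have := hv t ht
  rwa [clip_eq_self (hbound t ht)] at this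

lemma nonpos_of_deriv_le_mul {g g' : ℝ → ℝ} {a b K : ℝ} (hg : ContinuousOn g (Icc a b))
    (hg' : ∀ t ∈ Ioo a b, HasDerivAt g (g' t) t) (hle : ∀ t ∈ Ioo a b, g' t ≤ K * g t)
    (ha : g a ≤ 0) : ∀ t ∈ Icc a b, g t ≤ 0 := by
  intro t ht
  have hE : ∀ u, HasDerivAt (fun u : ℝ => Real.exp (-K * u)) (Real.exp (-K * u) * -K) u := by
    intro u
    simpa using ((hasDerivAt_id u).const_mul (-K)).exp
  have hanti : AntitoneOn (fun u => Real.exp (-K * u) * g u) (Icc a b) := by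
    refine antitoneOn_of_deriv_nonpos (convex_Icc a b) ?_ ?_ ?_
    · exact (Continuous.continuousOn (by fun_prop)).mul hg
    · rw [interior_Icc]
      exact fun u hu => ((hE u).mul (hg' u hu)).differentiableAt.differentiableWithinAt
    · rw [interior_Icc]
      intro u hu
      rw [((hE u).fun_mul (hg' u hu)).deriv]
      nlinarith [Real.exp_pos (-K * u), hle u hu,
        mul_le_mul_of_nonneg_left (hle u hu) (Real.exp_pos (-K * u)).le]
  have h := hanti (left_mem_Icc.2 (ht.1.trans ht.2)) ht ht.1
  have h1 : Real.exp (-K * a) * g a ≤ 0 :=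
    mul_nonpos_of_nonneg_of_nonpos (Real.exp_pos _).le ha
  exact nonpos_of_mul_nonpos_right (h.trans h1) (Real.exp_pos _)

lemma eq_of_deriv_eq_zero {g : ℝ → ℝ} {a b : ℝ} (hg : ContinuousOn g (Icc a b))
    (hg' : ∀ t ∈ Ioo a b, HasDerivAt g 0 t) : ∀ t ∈ Icc a b, g t = g a := by
  intro t ht
  have h1 := nonpos_of_deriv_le_mul (K := 0) (g := fun u => g u - g a) (hg.sub continuousOn_const)
    (fun t ht => (hg' t ht).sub_const _) (fun t _ => by simp) (by simp) t ht
  have h2 := nonpos_of_deriv_le_mul (K := 0) (g := fun u => g a - g u) (continuousOn_const.sub hg)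
    (fun t ht => (hg' t ht).const_sub _) (fun t _ => by simp) (by simp) t ht
  simp only [sub_nonpos] at h1 h2
  exact le_antisymm h1 h2

lemma sum_sum_mul_le (B : X → X → ℝ) (m : X → ℝ) :
    ∑ x, ∑ y, m x * (B x y * m y) ≤ (Fintype.card X * coeffSum B) * ∑ x, m x ^ 2 := by
  have h : ∀ x y, m x * (B x y * m y) ≤ coeffSum B * (m x ^ 2 / 2 + m y ^ 2 / 2) := by
    intro x y
    have h1 : |m x * (B x y * m y)| ≤ coeffSum B * (|m x| * |m y|) := by
      rw [abs_mul, abs_mul, mul_left_comm]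
      exact mul_le_mul_of_nonneg_right (abs_le_coeffSum B x y) (by positivity)
    have h2 : |m x| * |m y| ≤ m x ^ 2 / 2 + m y ^ 2 / 2 := by
      nlinarith [sq_nonneg (|m x| - |m y|), sq_abs (m x), sq_abs (m y)]
    exact (le_abs_self _).trans (h1.trans (mul_le_mul_of_nonneg_left h2 (coeffSum_nonneg B)))
  refine (Finset.sum_le_sum fun x _ => Finset.sum_le_sum fun y _ => h x y).trans_eq ?_
  simp only [← Finset.mul_sum, Finset.sum_add_distrib, Finset.sum_const, Finset.card_univ,
    nsmul_eq_mul, ← Finset.sum_div]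
  ring

lemma linear_solution_eq_zero {B : ℝ → X → X → ℝ} {a b : ℝ}
    (hB : ∀ x y, ContinuousOn (fun t => B t x y) (Icc a b)) {v : ℝ → X → ℝ}
    (hv : ContinuousOn v (Icc a b))
    (hv' : ∀ t ∈ Ioo a b, HasDerivAt v (linField (B t) (v t)) t) (ha : v a = 0) :
    ∀ t ∈ Icc a b, v t = 0 := by
  obtain ⟨K, hK0, hK⟩ := exists_coeffSum_bound hB
  intro t ht
  have h := nonpos_of_deriv_le_mul (g := fun t => ∑ x, v t x ^ 2)
    (g' := fun t => ∑ x, 2 * v t x * linField (B t) (v t) x)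
    (K := 2 * (Fintype.card X * K)) (a := a) (b := b)
    (continuousOn_finsetSum _ fun x _ => (continuousOn_pi.1 hv x).pow 2)
    (fun t ht => HasDerivAt.fun_sum fun x _ => by
      simpa using (hasDerivAt_pi.1 (hv' t ht) x).fun_pow 2)
    (fun t ht => by
      have h1 := sum_sum_mul_le (B t) (v t)
      have h2 : ∑ x, 2 * v t x * linField (B t) (v t) x
          = 2 * ∑ x, ∑ y, v t x * (B t x y * v t y) := by
        rw [Finset.mul_sum]
        refine Finset.sum_congr rfl fun x _ => ?_
        rw [linField, ← Finset.mul_sum]; ring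
      rw [h2]
      have h3 : (Fintype.card X * coeffSum (B t)) * ∑ x, v t x ^ 2 ≤
          (Fintype.card X * K) * ∑ x, v t x ^ 2 := by
        refine mul_le_mul_of_nonneg_right (mul_le_mul_of_nonneg_left (hK t ⟨ht.1.le, ht.2.le⟩)
          (Nat.cast_nonneg _)) (Finset.sum_nonneg fun _ _ => sq_nonneg _)
      linarith)
    (by simp [ha]) t ht
  ext x
  have h0 : v t x ^ 2 ≤ 0 :=
    (Finset.single_le_sum (f := fun x => v t x ^ 2) (fun _ _ => sq_nonneg _)
      (Finset.mem_univ x)).trans h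
  simpa using le_antisymm h0 (sq_nonneg _)

lemma linear_solution_unique {B : ℝ → X → X → ℝ} {a b : ℝ}
    (hB : ∀ x y, ContinuousOn (fun t => B t x y) (Icc a b)) {v w : ℝ → X → ℝ}
    (hv : ContinuousOn v (Icc a b)) (hw : ContinuousOn w (Icc a b))
    (hv' : ∀ t ∈ Ioo a b, HasDerivAt v (linField (B t) (v t)) t)
    (hw' : ∀ t ∈ Ioo a b, HasDerivAt w (linField (B t) (w t)) t) (ha : v a = w a) :
    ∀ t ∈ Icc a b, v t = w t := by
  intro t ht
  refine sub_eq_zero.1 (linear_solution_eq_zero hB (v := v - w) (hv.sub hw) (fun t ht => ?_)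
    (by simp [ha]) t ht)
  simpa only [Pi.sub_apply, linField_sub] using (hv' t ht).sub (hw' t ht)

lemma exists_linear_solution {B : ℝ → X → X → ℝ} {a b : ℝ} (hab : a < b)
    (hB : ∀ x y, ContinuousOn (fun t => B t x y) (Ico a b)) (v₀ : X → ℝ) :
    ∃ v : ℝ → X → ℝ, v a = v₀ ∧ ContinuousWithinAt v (Ici a) a ∧
      ∀ t ∈ Ioo a b, HasDerivAt v (linField (B t) (v t)) t := by
  have hB' : ∀ d < b, ∀ x y, ContinuousOn (fun t => B t x y) (Icc a d) := fun d hd x y =>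
    (hB x y).mono fun t ht => ⟨ht.1, ht.2.trans_lt hd⟩
  have hex : ∀ d, ∃ v : ℝ → X → ℝ, a ≤ d → d < b → v a = v₀ ∧
      ∀ t ∈ Icc a d, HasDerivWithinAt v (linField (B t) (v t)) (Icc a d) t := by
    intro d
    by_cases had : a ≤ d
    · by_cases hd : d < b
      · obtain ⟨v, hv⟩ := exists_linear_solution_Icc had (hB' d hd) v₀
        exact ⟨v, fun _ _ => hv⟩
      · exact ⟨0, fun _ h => absurd h hd⟩
    · exact ⟨0, fun h => absurd h had⟩
  choose sol hsol using hex
  have hcont : ∀ d, a ≤ d → d < b → ContinuousOn (sol d) (Icc a d) := fun d h1 h2 t ht =>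
    ((hsol d h1 h2).2 t ht).continuousWithinAt
  have hder : ∀ d, a ≤ d → d < b → ∀ t ∈ Ioo a d,
      HasDerivAt (sol d) (linField (B t) (sol d t)) t := fun d h1 h2 t ht =>
    ((hsol d h1 h2).2 t ⟨ht.1.le, ht.2.le⟩).hasDerivAt (Icc_mem_nhds ht.1 ht.2)
  have heq : ∀ d e, a ≤ d → d ≤ e → e < b → ∀ t ∈ Icc a d, sol d t = sol e t := by
    intro d e had hde heb
    have hdb := hde.trans_lt heb
    exact linear_solution_unique (hB' d hdb) (hcont d had hdb)
      ((hcont e (had.trans hde) heb).mono (Icc_subset_Icc_right hde)) (hder d had hdb)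
      (fun t ht => hder e (had.trans hde) heb t ⟨ht.1, ht.2.trans_le hde⟩)
      ((hsol d had hdb).1.trans (hsol e (had.trans hde) heb).1.symm)
  let v : ℝ → X → ℝ := fun t => sol ((t + b) / 2) t
  have hv : ∀ d, a ≤ d → d < b → ∀ t ∈ Icc a d, v t = sol d t := by
    intro d had hdb t ht
    have h1 : a ≤ (t + b) / 2 := by linarith [ht.1]
    have h2 : (t + b) / 2 < b := by linarith [ht.2]
    have h3 : t ≤ (t + b) / 2 := by linarith [ht.2]
    rcases le_total d ((t + b) / 2) with h | h
    · exact (heq d _ had h h2 t ht).symm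
    · exact heq _ d h1 h hdb t ⟨ht.1, h3⟩
  refine ⟨v, ?_, ?_, fun t ht => ?_⟩
  · exact (hsol _ (by linarith) (by linarith)).1
  · have h1 : a < (a + b) / 2 := by linarith
    have h2 : (a + b) / 2 < b := by linarith
    have hc := hcont _ h1.le h2 a (left_mem_Icc.2 h1.le)
    refine (hc.congr (fun t ht => hv _ h1.le h2 t ht)
      (hv _ h1.le h2 a (left_mem_Icc.2 h1.le))).mono_of_mem_nhdsWithin (Icc_mem_nhdsGE h1)
  · have h1 : t < (t + b) / 2 := by linarith [ht.2]
    have h2 : (t + b) / 2 < b := by linarith [ht.2]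
    have h3 : a ≤ (t + b) / 2 := by linarith [ht.1]
    rw [hv _ h3 h2 t ⟨ht.1.le, h1.le⟩]
    refine (hder _ h3 h2 t ⟨ht.1, h1⟩).congr_of_eventuallyEq ?_
    filter_upwards [Icc_mem_nhds ht.1 h1] with u hu using hv _ h3 h2 u hu

lemma hasDerivAt_sq_min (y : ℝ) : HasDerivAt (fun y : ℝ => (min y 0) ^ 2) (2 * min y 0) y := by
  rcases lt_trichotomy y 0 with h | h | h
  · rw [min_eq_left h.le]
    refine HasDerivAt.congr_of_eventuallyEq (f := fun y : ℝ => y ^ 2) (by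
      simpa using hasDerivAt_pow 2 y) ?_
    filter_upwards [gt_mem_nhds h] with z hz
    rw [min_eq_left hz.le]
  · subst h
    rw [min_self, mul_zero, hasDerivAt_iff_isLittleO_nhds_zero]
    simp only [zero_add, min_self, smul_zero, sub_zero, ne_eq, OfNat.ofNat_ne_zero,
      not_false_eq_true, zero_pow]
    have h1 : (fun h : ℝ => (min h 0) ^ 2) =O[𝓝 0] fun h : ℝ => h ^ 2 := by
      refine Asymptotics.IsBigO.of_bound 1 (Eventually.of_forall fun h => ?_)
      rw [one_mul, norm_pow, norm_pow]
      refine pow_le_pow_left₀ (norm_nonneg _) ?_ 2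
      rw [Real.norm_eq_abs, Real.norm_eq_abs]
      rcases le_total h 0 with h0 | h0
      · rw [min_eq_left h0]
      · rw [min_eq_right h0, abs_zero]; exact abs_nonneg _
    exact h1.trans_isLittleO (Asymptotics.isLittleO_pow_id one_lt_two)
  · rw [min_eq_right h.le, mul_zero]
    refine HasDerivAt.congr_of_eventuallyEq (f := fun _ : ℝ => (0 : ℝ)) (hasDerivAt_const y 0) ?_
    filter_upwards [lt_mem_nhds h] with z hz
    rw [min_eq_right hz.le]
    simp

lemma linear_solution_nonneg {B : ℝ → X → X → ℝ} {a b : ℝ}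
    (hB : ∀ x y, ContinuousOn (fun t => B t x y) (Icc a b))
    (hpos : ∀ t ∈ Ioo a b, NonnegRates (B t)) {v : ℝ → X → ℝ}
    (hv : ContinuousOn v (Icc a b))
    (hv' : ∀ t ∈ Ioo a b, HasDerivAt v (linField (B t) (v t)) t) (ha : ∀ x, 0 ≤ v a x) :
    ∀ t ∈ Icc a b, ∀ x, 0 ≤ v t x := by
  obtain ⟨K, hK0, hK⟩ := exists_coeffSum_bound hB
  intro t ht
  have h := nonpos_of_deriv_le_mul (g := fun t => ∑ x, (min (v t x) 0) ^ 2)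
    (g' := fun t => ∑ x, 2 * min (v t x) 0 * linField (B t) (v t) x)
    (K := 2 * (Fintype.card X * K)) (a := a) (b := b)
    (continuousOn_finsetSum _ fun x _ =>
      (ContinuousOn.inf (continuousOn_pi.1 hv x) continuousOn_const).pow 2)
    (fun t ht => HasDerivAt.fun_sum fun x _ =>
      (hasDerivAt_sq_min (v t x)).comp t (hasDerivAt_pi.1 (hv' t ht) x))
    (fun t ht => by
      have h1 := sum_sum_mul_le (B t) (fun x => min (v t x) 0)
      have h2 : ∑ x, 2 * min (v t x) 0 * linField (B t) (v t) x
          ≤ 2 * ∑ x, ∑ y, min (v t x) 0 * (B t x y * min (v t y) 0) := by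
        rw [Finset.mul_sum]
        refine Finset.sum_le_sum fun x _ => ?_
        rw [mul_assoc, linField, Finset.mul_sum]
        refine mul_le_mul_of_nonneg_left (Finset.sum_le_sum fun y _ => ?_) zero_le_two
        by_cases hxy : x = y
        · subst hxy
          rcases le_total (v t x) 0 with h0 | h0
          · rw [min_eq_left h0]
          · rw [min_eq_right h0]; simp
        · refine mul_le_mul_of_nonpos_left ?_ (min_le_right _ _)
          exact mul_le_mul_of_nonneg_left (min_le_left _ _) (hpos t ht x y hxy)
      have h3 : (Fintype.card X * coeffSum (B t)) * ∑ x, (min (v t x) 0) ^ 2 ≤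
          (Fintype.card X * K) * ∑ x, (min (v t x) 0) ^ 2 := by
        refine mul_le_mul_of_nonneg_right (mul_le_mul_of_nonneg_left (hK t ⟨ht.1.le, ht.2.le⟩)
          (Nat.cast_nonneg _)) (Finset.sum_nonneg fun _ _ => sq_nonneg _)
      linarith)
    (by simp [min_eq_right (ha _)]) t ht
  intro x
  have h0 : (min (v t x) 0) ^ 2 ≤ 0 :=
    (Finset.single_le_sum (f := fun x => (min (v t x) 0) ^ 2) (fun _ _ => sq_nonneg _)
      (Finset.mem_univ x)).trans h
  have h1 : min (v t x) 0 = 0 := by simpa using le_antisymm h0 (sq_nonneg _)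
  exact min_eq_right_iff.1 h1

lemma linear_solution_pos_of_le {B : ℝ → X → X → ℝ} {a b : ℝ}
    (hB : ∀ x y, ContinuousOn (fun t => B t x y) (Icc a b))
    (hpos : ∀ t ∈ Ioo a b, NonnegRates (B t)) {v : ℝ → X → ℝ}
    (hv : ContinuousOn v (Icc a b))
    (hv' : ∀ t ∈ Ioo a b, HasDerivAt v (linField (B t) (v t)) t)
    (hnn : ∀ t ∈ Icc a b, ∀ x, 0 ≤ v t x) {x : X} {c : ℝ} (hc : c ∈ Icc a b) (hx : 0 < v c x) :
    ∀ t ∈ Icc c b, 0 < v t x := by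
  obtain ⟨K, hK0, hK⟩ := exists_coeffSum_bound hB
  intro t ht
  have hE : ∀ u, HasDerivAt (fun u : ℝ => Real.exp (K * u)) (Real.exp (K * u) * K) u := by
    intro u
    simpa using ((hasDerivAt_id u).const_mul K).exp
  have hmono : MonotoneOn (fun u => Real.exp (K * u) * v u x) (Icc a b) := by
    have hd : ∀ u ∈ Ioo a b, HasDerivAt (fun u => Real.exp (K * u) * v u x) _ u := fun u hu =>
      (hE u).mul (hasDerivAt_pi.1 (hv' u hu) x)
    refine monotoneOn_of_deriv_nonneg (convex_Icc a b) ?_ ?_ ?_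
    · exact (Continuous.continuousOn (by fun_prop)).mul (continuousOn_pi.1 hv x)
    · rw [interior_Icc]
      exact fun u hu => (hd u hu).differentiableAt.differentiableWithinAt
    · rw [interior_Icc]
      intro u hu
      have hu' : u ∈ Icc a b := ⟨hu.1.le, hu.2.le⟩
      rw [(hd u hu).deriv]
      have h1 : -K * v u x ≤ linField (B u) (v u) x := by
        classical
        rw [linField, ← Finset.add_sum_erase _ _ (Finset.mem_univ x)]
        have h2 : 0 ≤ ∑ y ∈ Finset.univ.erase x, B u x y * v u y :=
          Finset.sum_nonneg fun y hy => mul_nonneg (hpos u hu x y (Finset.ne_of_mem_erase hy).symm)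
            (hnn u hu' y)
        have h3 := (abs_le.1 ((abs_le_coeffSum (B u) x x).trans (hK u hu'))).1
        nlinarith [mul_le_mul_of_nonneg_right h3 (hnn u hu' x)]
      have h4 := mul_le_mul_of_nonneg_left h1 (Real.exp_pos (K * u)).le
      nlinarith
  have h := hmono hc ⟨hc.1.trans ht.1, ht.2⟩ ht.1
  have h1 : 0 < Real.exp (K * c) * v c x := mul_pos (Real.exp_pos _) hx
  exact pos_of_mul_pos_right (h1.trans_le h) (Real.exp_pos _).le

lemma linear_solution_pos_of_edge {B : ℝ → X → X → ℝ} {a b : ℝ}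
    (hB : ∀ x y, ContinuousOn (fun t => B t x y) (Icc a b))
    (hpos : ∀ t ∈ Ioo a b, NonnegRates (B t)) {v : ℝ → X → ℝ}
    (hv : ContinuousOn v (Icc a b))
    (hv' : ∀ t ∈ Ioo a b, HasDerivAt v (linField (B t) (v t)) t)
    (hnn : ∀ t ∈ Icc a b, ∀ x, 0 ≤ v t x) {x y : X} (hy : ∀ t ∈ Ioc a b, 0 < v t y)
    (hxy : ∀ t ∈ Ioo a b, 0 < B t x y) :
    ∀ t ∈ Ioc a b, 0 < v t x := by
  intro t ht
  by_contra hcon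
  have hzero : ∀ u ∈ Ioo a t, v u x = 0 := by
    intro u hu
    by_contra h0
    have hu' : u ∈ Icc a b := ⟨hu.1.le, hu.2.le.trans ht.2⟩
    exact hcon (linear_solution_pos_of_le hB hpos hv hv' hnn hu'
      (lt_of_le_of_ne (hnn u hu' x) (Ne.symm h0)) t ⟨hu.2.le, ht.2⟩)
  have hm : (a + t) / 2 ∈ Ioo a t := ⟨by linarith [ht.1], by linarith [ht.1]⟩
  set u := (a + t) / 2
  have hub : u ∈ Ioo a b := ⟨hm.1, hm.2.trans_le ht.2⟩
  have hd := hasDerivAt_pi.1 (hv' u hub) x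
  have hd0 : HasDerivAt (fun u => v u x) 0 u := by
    refine (hasDerivAt_const u (0 : ℝ)).congr_of_eventuallyEq ?_
    filter_upwards [Ioo_mem_nhds hm.1 hm.2] with w hw using hzero w hw
  have h0 := hd.unique hd0
  have hterm : ∀ z, 0 ≤ B u x z * v u z := by
    intro z
    by_cases hz : x = z
    · rw [← hz, hzero u hm, mul_zero]
    · exact mul_nonneg (hpos u hub x z hz) (hnn u ⟨hub.1.le, hub.2.le⟩ z)
  have h1 : B u x y * v u y ≤ linField (B u) (v u) x :=
    Finset.single_le_sum (f := fun z => B u x z * v u z) (fun z _ => hterm z) (Finset.mem_univ y)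
  have h2 := mul_pos (hxy u hub) (hy u ⟨hub.1, hub.2.le⟩)
  linarith

/-! ### Heat propagators -/

section Propagators

variable {α β : ℝ} {Q : ℝ → X → X → ℝ} {π : ℝ → X → ℝ}

lemma IsMarkovTriple.nonnegRates {Q : X → X → ℝ} {π : X → ℝ} (h : IsMarkovTriple Q π) :
    NonnegRates Q := h.rate_nonneg

lemma IsTimeDependentTriple.nonnegRates (hT : IsTimeDependentTriple α β Q π) {t : ℝ}
    (ht : t ∈ Ioo α β) : NonnegRates (Q t) := (hT.triple t ht).rate_nonneg

lemma IsTimeDependentTriple.continuousOn_rate (hT : IsTimeDependentTriple α β Q π) (x y : X) :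
    ContinuousOn (fun t => Q t x y) (Ioo α β) := by
  have hoff : ∀ x y, x ≠ y → ContinuousOn (fun t => Q t x y) (Ioo α β) := by
    intro x y hxy
    rcases hT.rate_logLipschitz x y hxy with h | ⟨hpos, hL⟩
    · exact (continuousOn_const (c := (0 : ℝ))).congr fun t ht => h t ht
    · exact hL.continuousOn.rexp.congr fun t ht => (Real.exp_log (hpos t ht)).symm
  by_cases hxy : x = y
  · subst hxy
    classical
    have : ContinuousOn (fun t => -∑ y ∈ Finset.univ.erase x, Q t x y) (Ioo α β) :=
      (continuousOn_finsetSum _ fun y hy => hoff x y (Finset.ne_of_mem_erase hy).symm).neg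
    refine this.congr fun t ht => ?_
    have h := (hT.triple t ht).row_sum x
    rw [← Finset.add_sum_erase _ _ (Finset.mem_univ x)] at h
    exact eq_neg_of_add_eq_zero_left h
  · exact hoff x y hxy

/-- The time-reversed transposed rates, which govern the dual heat equation run backwards. -/
def revRates (Q : ℝ → X → X → ℝ) : ℝ → X → X → ℝ := fun u x y => Q (-u) y x

lemma IsTimeDependentTriple.continuousOn_revRates (hT : IsTimeDependentTriple α β Q π) (x y : X) :
    ContinuousOn (fun u => revRates Q u x y) (Ioo (-β) (-α)) :=
  (hT.continuousOn_rate y x).comp continuousOn_neg fun u hu =>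
    ⟨by linarith [hu.2], by linarith [hu.1]⟩

lemma IsTimeDependentTriple.nonnegRates_rev (hT : IsTimeDependentTriple α β Q π) {u : ℝ}
    (hu : u ∈ Ioo (-β) (-α)) : NonnegRates (revRates Q u) := fun x y hxy =>
  hT.nonnegRates (t := -u) ⟨by linarith [hu.2], by linarith [hu.1]⟩ y x hxy.symm

lemma laplacian_eq_linField {Q : X → X → ℝ} {π : X → ℝ} (h : IsMarkovTriple Q π) (ψ : X → ℝ) :
    laplacian Q ψ = linField Q ψ := by
  ext x
  simp only [laplacian, linField, mul_sub, Finset.sum_sub_distrib, ← Finset.sum_mul, h.row_sum]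
  simp

lemma IsDualHeatSolution.hasDerivAt_neg {t : ℝ} {σ₀ : X → ℝ} {σ : ℝ → X → ℝ}
    (h : IsDualHeatSolution α Q t σ₀ σ) {u : ℝ} (hu : u ∈ Ioo (-t) (-α)) :
    HasDerivAt (fun u => σ (-u)) (linField (revRates Q u) (σ (-u))) u := by
  have h1 := h.eqn (-u) ⟨by linarith [hu.2], by linarith [hu.1]⟩
  have h2 := h1.scomp u (_root_.hasDerivAt_neg u)
  refine h2.congr_deriv ?_
  rw [neg_smul, one_smul, neg_neg]
  rfl

lemma IsDualHeatSolution.continuousOn {t : ℝ} {σ₀ : X → ℝ} {σ : ℝ → X → ℝ}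
    (h : IsDualHeatSolution α Q t σ₀ σ) : ContinuousOn σ (Ioc α t) := by
  intro s hs
  rcases hs.2.eq_or_lt with rfl | hlt
  · exact h.continuous.mono fun r hr => hr.2
  · exact (h.eqn s ⟨hs.1, hlt⟩).continuousAt.continuousWithinAt

lemma IsDualHeatSolution.continuousOn_neg {t : ℝ} {σ₀ : X → ℝ} {σ : ℝ → X → ℝ}
    (h : IsDualHeatSolution α Q t σ₀ σ) : ContinuousOn (fun u => σ (-u)) (Ico (-t) (-α)) :=
  h.continuousOn.comp _root_.continuousOn_neg fun u hu => ⟨by linarith [hu.2], by linarith [hu.1]⟩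

lemma IsTimeDependentTriple.exists_dual (hT : IsTimeDependentTriple α β Q π) {t : ℝ}
    (ht : t ∈ Ioo α β) (σ₀ : X → ℝ) : ∃ σ, IsDualHeatSolution α Q t σ₀ σ := by
  obtain ⟨v, hv0, hvc, hv⟩ := exists_linear_solution (B := revRates Q) (a := -t) (b := -α)
    (by linarith [ht.1]) (fun x y => (hT.continuousOn_revRates x y).mono fun u hu =>
      ⟨by linarith [hu.1, ht.2], hu.2⟩) σ₀
  refine ⟨fun s => v (-s), hv0, ?_, fun s hs => ?_⟩
  · exact ContinuousWithinAt.comp (t := Ici (-t)) hvc continuous_neg.continuousWithinAt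
      fun s hs => mem_Ici.2 (neg_le_neg (mem_Iic.1 hs))
  · have h1 := hv (-s) ⟨by linarith [hs.2], by linarith [hs.1]⟩
    have h2 := h1.scomp s (_root_.hasDerivAt_neg s)
    have e : linField (revRates Q (-s)) (v (-s)) = dualLaplacian (Q s) (v (-s)) := by
      unfold revRates
      rw [neg_neg]
      rfl
    refine h2.congr_deriv ?_
    rw [e, neg_smul, one_smul]

lemma IsTimeDependentTriple.dual_spec (hT : IsTimeDependentTriple α β Q π) {t : ℝ}
    (ht : t ∈ Ioo α β) (σ₀ : X → ℝ) :
    IsDualHeatSolution α Q t σ₀ (fun s => dualHeatProp α Q t s σ₀) :=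
  Classical.epsilon_spec (hT.exists_dual ht σ₀)

lemma IsTimeDependentTriple.dual_unique (hT : IsTimeDependentTriple α β Q π) {t : ℝ}
    (ht : t ∈ Ioo α β) {σ₀ : X → ℝ} {σ σ' : ℝ → X → ℝ} (h : IsDualHeatSolution α Q t σ₀ σ)
    (h' : IsDualHeatSolution α Q t σ₀ σ') {s : ℝ} (hs : s ∈ Ioc α t) : σ s = σ' s := by
  have hsub : Icc (-t) (-s) ⊆ Ico (-t) (-α) := fun u hu => ⟨hu.1, by linarith [hu.2, hs.1]⟩
  have := linear_solution_unique (B := revRates Q) (a := -t) (b := -s)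
    (fun x y => (hT.continuousOn_revRates x y).mono fun u hu =>
      ⟨by linarith [hu.1, ht.2], by linarith [hu.2, hs.1]⟩)
    (h.continuousOn_neg.mono hsub) (h'.continuousOn_neg.mono hsub)
    (fun u hu => h.hasDerivAt_neg ⟨hu.1, by linarith [hu.2, hs.1]⟩)
    (fun u hu => h'.hasDerivAt_neg ⟨hu.1, by linarith [hu.2, hs.1]⟩)
    (by simp [h.terminal, h'.terminal]) (-s) ⟨by linarith [hs.2], le_rfl⟩
  simpa using this

lemma IsTimeDependentTriple.dual_eq (hT : IsTimeDependentTriple α β Q π) {t : ℝ}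
    (ht : t ∈ Ioo α β) {σ₀ : X → ℝ} {σ : ℝ → X → ℝ} (h : IsDualHeatSolution α Q t σ₀ σ)
    {s : ℝ} (hs : s ∈ Ioc α t) : dualHeatProp α Q t s σ₀ = σ s :=
  hT.dual_unique ht (hT.dual_spec ht σ₀) h hs

lemma IsTimeDependentTriple.dual_self (hT : IsTimeDependentTriple α β Q π) {t : ℝ}
    (ht : t ∈ Ioo α β) (σ₀ : X → ℝ) : dualHeatProp α Q t t σ₀ = σ₀ :=
  (hT.dual_spec ht σ₀).terminal

lemma IsTimeDependentTriple.dual_comp (hT : IsTimeDependentTriple α β Q π) {τ t s : ℝ}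
    (hτ : τ ∈ Ioo α β) (ht : t ∈ Ioc α τ) (hs : s ∈ Ioc α t) (σ₀ : X → ℝ) :
    dualHeatProp α Q t s (dualHeatProp α Q τ t σ₀) = dualHeatProp α Q τ s σ₀ := by
  have h := hT.dual_spec hτ σ₀
  refine hT.dual_eq (σ := fun s => dualHeatProp α Q τ s σ₀) ⟨ht.1, ht.2.trans_lt hτ.2⟩
    ⟨rfl, ?_, fun r hr => h.eqn r ⟨hr.1, hr.2.trans_le ht.2⟩⟩ hs
  refine (h.continuousOn t ht).mono_of_mem_nhdsWithin ?_
  exact mem_of_superset (Ioc_mem_nhdsLE ht.1) (Ioc_subset_Ioc_right ht.2)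

lemma dualLaplacian_add_smul (Q : X → X → ℝ) (c d : ℝ) (σ σ' : X → ℝ) :
    dualLaplacian Q (c • σ + d • σ') = c • dualLaplacian Q σ + d • dualLaplacian Q σ' := by
  ext x
  simp only [dualLaplacian, Pi.add_apply, Pi.smul_apply, smul_eq_mul, mul_add,
    Finset.sum_add_distrib, Finset.mul_sum]
  congr 1 <;> exact Finset.sum_congr rfl fun y _ => by ring

lemma IsTimeDependentTriple.dual_add_smul (hT : IsTimeDependentTriple α β Q π) {t s : ℝ}
    (ht : t ∈ Ioo α β) (hs : s ∈ Ioc α t) (c d : ℝ) (σ σ' : X → ℝ) :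
    dualHeatProp α Q t s (c • σ + d • σ') =
      c • dualHeatProp α Q t s σ + d • dualHeatProp α Q t s σ' := by
  have h := hT.dual_spec ht σ
  have h' := hT.dual_spec ht σ'
  refine hT.dual_eq ht (σ := fun s => c • dualHeatProp α Q t s σ + d • dualHeatProp α Q t s σ')
    ⟨?_, ?_, fun r hr => ?_⟩ hs
  · simp only [hT.dual_self ht]
  · exact (h.continuous.const_smul c).add (h'.continuous.const_smul d)
  · refine (((h.eqn r hr).const_smul c).add ((h'.eqn r hr).const_smul d)).congr_deriv ?_
    rw [dualLaplacian_add_smul, smul_neg, smul_neg, neg_add]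

/-- The dual heat propagator as a linear map. -/
def IsTimeDependentTriple.dualLin (hT : IsTimeDependentTriple α β Q π) {t s : ℝ}
    (ht : t ∈ Ioo α β) (hs : s ∈ Ioc α t) : (X → ℝ) →ₗ[ℝ] (X → ℝ) where
  toFun := dualHeatProp α Q t s
  map_add' σ σ' := by simpa using hT.dual_add_smul ht hs 1 1 σ σ'
  map_smul' c σ := by simpa using hT.dual_add_smul ht hs c 0 σ 0

open Classical in
lemma IsTimeDependentTriple.dual_eq_sum (hT : IsTimeDependentTriple α β Q π) {t s : ℝ}
    (ht : t ∈ Ioo α β) (hs : s ∈ Ioc α t) (σ : X → ℝ) (x : X) :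
    dualHeatProp α Q t s σ x = ∑ y, σ y * dualHeatProp α Q t s (Pi.single y 1) x := by
  have h := (hT.dualLin ht hs).pi_apply_eq_sum_univ σ
  have h2 := congrFun h x
  simp only [Finset.sum_apply, Pi.smul_apply, smul_eq_mul] at h2
  refine Eq.trans h2 (Finset.sum_congr rfl fun y _ => ?_)
  congr 1
  have : (fun j => if y = j then (1 : ℝ) else 0) = Pi.single y 1 := by
    ext j
    simp [Pi.single_apply, eq_comm]
  rw [this]
  rfl

lemma IsTimeDependentTriple.dual_nonneg (hT : IsTimeDependentTriple α β Q π) {t s : ℝ}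
    (ht : t ∈ Ioo α β) (hs : s ∈ Ioc α t) {σ : X → ℝ} (hσ : ∀ x, 0 ≤ σ x) (x : X) :
    0 ≤ dualHeatProp α Q t s σ x := by
  have h := hT.dual_spec ht σ
  have := linear_solution_nonneg (B := revRates Q) (a := -t) (b := -s)
    (fun x y => (hT.continuousOn_revRates x y).mono fun u hu =>
      ⟨by linarith [hu.1, ht.2], by linarith [hu.2, hs.1]⟩)
    (fun u hu => hT.nonnegRates_rev ⟨by linarith [hu.1, ht.2], by linarith [hu.2, hs.1]⟩)
    (h.continuousOn_neg.mono fun u hu => ⟨hu.1, by linarith [hu.2, hs.1]⟩)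
    (fun u hu => h.hasDerivAt_neg ⟨hu.1, by linarith [hu.2, hs.1]⟩)
    (by simpa [hT.dual_self ht] using hσ) (-s) ⟨by linarith [hs.2], le_rfl⟩ x
  simpa using this

lemma IsTimeDependentTriple.dual_mem (hT : IsTimeDependentTriple α β Q π) {t s : ℝ}
    (ht : t ∈ Ioo α β) (hs : s ∈ Ioc α t) {σ : X → ℝ} (hσ : σ ∈ stdSimplex ℝ X) :
    dualHeatProp α Q t s σ ∈ stdSimplex ℝ X := by
  refine ⟨hT.dual_nonneg ht hs hσ.1, ?_⟩
  have h := hT.dual_spec ht σ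
  have := eq_of_deriv_eq_zero (g := fun r => ∑ x, dualHeatProp α Q t r σ x) (a := s) (b := t)
    (continuousOn_finsetSum _ fun x _ => (continuousOn_pi.1 h.continuousOn x).mono fun r hr =>
      ⟨hs.1.trans_le hr.1, hr.2⟩) (fun r hr => ?_) t ⟨hs.2, le_rfl⟩
  · rw [← this, hT.dual_self ht, hσ.2]
  · have hd := HasDerivAt.fun_sum fun x (_ : x ∈ Finset.univ) =>
      hasDerivAt_pi.1 (h.eqn r ⟨hs.1.trans hr.1, hr.2⟩) x
    refine hd.congr_deriv ?_
    simp only [Pi.neg_apply, dualLaplacian, Finset.sum_neg_distrib, neg_eq_zero]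
    rw [Finset.sum_comm]
    refine Finset.sum_eq_zero fun y _ => ?_
    rw [← Finset.sum_mul,
      (hT.triple r ⟨hs.1.trans hr.1, hr.2.trans ht.2⟩).row_sum y, zero_mul]

lemma IsTimeDependentTriple.rate_pos_iff (hT : IsTimeDependentTriple α β Q π) {x y : X}
    (hxy : x ≠ y) {r t : ℝ} (hr : r ∈ Ioo α β) (ht : t ∈ Ioo α β) (h : 0 < Q r x y) :
    0 < Q t x y := by
  rcases hT.rate_logLipschitz x y hxy with h0 | ⟨h0, _⟩
  · exact absurd (h0 r hr) h.ne'
  · exact h0 t ht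

lemma IsTimeDependentTriple.dual_pos (hT : IsTimeDependentTriple α β Q π) {t s : ℝ}
    (ht : t ∈ Ioo α β) (hs : s ∈ Ioo α t) {σ : X → ℝ} (hσ : σ ∈ stdSimplex ℝ X) (x : X) :
    0 < dualHeatProp α Q t s σ x := by
  have h := hT.dual_spec ht σ
  have hB : ∀ x y, ContinuousOn (fun u => revRates Q u x y) (Icc (-t) (-s)) := fun x y =>
    (hT.continuousOn_revRates x y).mono fun u hu =>
      ⟨by linarith [hu.1, ht.2], by linarith [hu.2, hs.1]⟩
  have hpos : ∀ u ∈ Ioo (-t) (-s), NonnegRates (revRates Q u) := fun u hu =>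
    hT.nonnegRates_rev ⟨by linarith [hu.1, ht.2], by linarith [hu.2, hs.1]⟩
  have hv : ContinuousOn (fun u => dualHeatProp α Q t (-u) σ) (Icc (-t) (-s)) :=
    h.continuousOn_neg.mono fun u hu => ⟨hu.1, by linarith [hu.2, hs.1]⟩
  have hv' : ∀ u ∈ Ioo (-t) (-s), HasDerivAt (fun u => dualHeatProp α Q t (-u) σ)
      (linField (revRates Q u) (dualHeatProp α Q t (-u) σ)) u := fun u hu =>
    h.hasDerivAt_neg ⟨hu.1, by linarith [hu.2, hs.1]⟩
  have hnn : ∀ u ∈ Icc (-t) (-s), ∀ x, 0 ≤ dualHeatProp α Q t (-u) σ x := fun u hu =>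
    hT.dual_nonneg ht ⟨by linarith [hu.2, hs.1], by linarith [hu.1]⟩ hσ.1
  obtain ⟨z, hz⟩ : ∃ z, 0 < σ z := by
    by_contra hcon
    push Not at hcon
    have : ∑ x, σ x ≤ 0 := Finset.sum_nonpos fun x _ => hcon x
    rw [hσ.2] at this
    linarith
  have hst : -t < -s := by linarith [hs.2]
  have hall : ∀ u ∈ Ioc (-t) (-s), 0 < dualHeatProp α Q t (-u) σ x := by
    have hirr := (hT.triple t ht).irreducible z x
    induction hirr with
    | refl =>
      intro u hu
      refine linear_solution_pos_of_le hB hpos hv hv' hnn (left_mem_Icc.2 hst.le) ?_ u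
        ⟨hu.1.le, hu.2⟩
      simpa [hT.dual_self ht] using hz
    | @tail b c _ hbc ih =>
      by_cases hne : b = c
      · subst hne; exact ih
      · exact linear_solution_pos_of_edge hB hpos hv hv' hnn ih fun u hu =>
          hT.rate_pos_iff hne ht ⟨by linarith [hu.2, hs.1], by linarith [hu.1, ht.2]⟩ hbc
  simpa using hall (-s) ⟨hst, le_rfl⟩

lemma IsTimeDependentTriple.heat_spec (hT : IsTimeDependentTriple α β Q π) {s : ℝ}
    (hs : s ∈ Ioo α β) (ψ₀ : X → ℝ) :
    IsHeatSolution β Q s ψ₀ (fun t => heatProp β Q t s ψ₀) := by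
  refine Classical.epsilon_spec (p := fun ψ => IsHeatSolution β Q s ψ₀ ψ) ?_
  obtain ⟨v, hv0, hvc, hv⟩ := exists_linear_solution (B := Q) (a := s) (b := β) hs.2
    (fun x y => (hT.continuousOn_rate x y).mono fun u hu => ⟨hs.1.trans_le hu.1, hu.2⟩) ψ₀
  refine ⟨v, hv0, hvc, fun t ht => ?_⟩
  rw [laplacian_eq_linField (hT.triple t ⟨hs.1.trans ht.1, ht.2⟩)]
  exact hv t ht

lemma pairing_heatProp (hT : IsTimeDependentTriple α β Q π) {s t : ℝ}
    (hs : s ∈ Ioo α β) (ht : t ∈ Ioo α β) (hst : s ≤ t) (ψ σ : X → ℝ) :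
    pairing (heatProp β Q t s ψ) σ = pairing ψ (dualHeatProp α Q t s σ) := by
  have h := hT.heat_spec hs ψ
  have h' := hT.dual_spec ht σ
  have hcont : ContinuousOn (fun r => heatProp β Q r s ψ) (Icc s t) := by
    intro r hr
    rcases hr.1.eq_or_lt with rfl | hlt
    · exact h.continuous.mono fun u hu => hu.1
    · exact (h.eqn r ⟨hlt, hr.2.trans_lt ht.2⟩).continuousAt.continuousWithinAt
  have hcont' : ContinuousOn (fun r => dualHeatProp α Q t r σ) (Icc s t) :=
    h'.continuousOn.mono fun r hr => ⟨hs.1.trans_le hr.1, hr.2⟩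
  have := eq_of_deriv_eq_zero
    (g := fun r => ∑ x, heatProp β Q r s ψ x * dualHeatProp α Q t r σ x) (a := s) (b := t)
    (continuousOn_finsetSum _ fun x _ =>
      (continuousOn_pi.1 hcont x).mul (continuousOn_pi.1 hcont' x))
    (fun r hr => ?_) t ⟨hst, le_rfl⟩
  · simp only [hT.dual_self ht] at this
    rw [show heatProp β Q s s ψ = ψ from h.initial] at this
    exact this
  · have hd := HasDerivAt.fun_sum fun x (_ : x ∈ Finset.univ) =>
      (hasDerivAt_pi.1 (h.eqn r ⟨hr.1, hr.2.trans ht.2⟩) x).fun_mul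
        (hasDerivAt_pi.1 (h'.eqn r ⟨hs.1.trans hr.1, hr.2⟩) x)
    refine hd.congr_deriv ?_
    rw [laplacian_eq_linField (hT.triple r ⟨hs.1.trans hr.1, hr.2.trans ht.2⟩)]
    simp only [Pi.neg_apply, dualLaplacian, linField, mul_neg, Finset.sum_add_distrib,
      Finset.sum_neg_distrib, Finset.sum_mul, Finset.mul_sum]
    rw [Finset.sum_comm]
    rw [add_neg_eq_zero]
    exact Finset.sum_congr rfl fun x _ => Finset.sum_congr rfl fun y _ => by ring

end Propagators

/-! ### The transport distance: curves and the triangle inequality -/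

/-- The divergence term of the continuity equation, `x ↦ ½ ∑ y, (V x y - V y x)`. -/
def divg (V : X → X → ℝ) (x : X) : ℝ := 1 / 2 * ∑ y, (V x y - V y x)

lemma divg_smul (c : ℝ) (V : X → X → ℝ) (x : X) :
    divg (fun x y => c * V x y) x = c * divg V x := by
  simp only [divg, ← mul_sub, ← Finset.mul_sum]
  ring

lemma edgeCost_le {v s t c : ℝ} (hs : 0 ≤ s) (ht : 0 ≤ t)
    (h : v ^ 2 ≤ c * logMean s t) : edgeCost v s t ≤ ENNReal.ofReal c := by
  unfold edgeCost
  split_ifs with h0 h1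
  · exact zero_le
  · rw [h0, mul_zero] at h
    exact absurd (pow_eq_zero_iff two_ne_zero |>.1 (le_antisymm h (sq_nonneg v))) h1
  · exact ENNReal.ofReal_le_ofReal ((div_le_iff₀ (lt_of_le_of_ne (logMean_nonneg hs ht)
      (Ne.symm h0))).2 h)

open Classical in
lemma action_le {Q : X → X → ℝ} (hQ : NonnegRates Q) {μ : X → ℝ} (hμ : ∀ x, 0 ≤ μ x)
    {V : X → X → ℝ} {c : X → X → ℝ} (hc : ∀ x y, 0 ≤ c x y)
    (h : ∀ x y, x ≠ y → V x y ^ 2 ≤ c x y * mobility Q μ x y) :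
    action Q μ V ≤ ENNReal.ofReal (1 / 2 * ∑ x, ∑ y, c x y) := by
  rw [ENNReal.ofReal_mul (by norm_num), action]
  refine mul_le_mul' ?_ ?_
  · rw [ENNReal.ofReal_div_of_pos two_pos]
    simp
  · rw [ENNReal.ofReal_sum_of_nonneg fun x _ => Finset.sum_nonneg fun y _ => hc x y]
    refine Finset.sum_le_sum fun x _ => ?_
    rw [ENNReal.ofReal_sum_of_nonneg fun y _ => hc x y]
    refine (Finset.sum_le_sum fun y hy => ?_).trans
      (Finset.sum_le_sum_of_subset (Finset.subset_univ _))
    have hxy : x ≠ y := (Finset.mem_filter.1 hy).2.symm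
    exact edgeCost_le (mul_nonneg (hμ x) (hQ x y hxy)) (mul_nonneg (hμ y) (hQ y x hxy.symm))
      (h x y hxy)

lemma edgeCost_smul {c v s t : ℝ} (hc : 0 < c) :
    edgeCost (c * v) s t = ENNReal.ofReal (c ^ 2) * edgeCost v s t := by
  unfold edgeCost
  by_cases h0 : logMean s t = 0
  · by_cases h1 : v = 0
    · simp [h0, h1]
    · have h2 : ENNReal.ofReal (c ^ 2) ≠ 0 := by
        rw [Ne, ENNReal.ofReal_eq_zero, not_le]; positivity
      simp [h0, h1, hc.ne', ENNReal.mul_top h2]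
  · simp only [h0, if_false]
    rw [← ENNReal.ofReal_mul (sq_nonneg c)]
    congr 1
    ring

lemma action_smul {Q : X → X → ℝ} {μ : X → ℝ} {V : X → X → ℝ} {c : ℝ} (hc : 0 < c) :
    action Q μ (fun x y => c * V x y) = ENNReal.ofReal (c ^ 2) * action Q μ V := by
  simp only [action, edgeCost_smul hc, ← Finset.mul_sum]
  rw [mul_left_comm]

/-- The total action of a curve. -/
def totalAction (Q : X → X → ℝ) (μ : ℝ → X → ℝ) (V : ℝ → X → X → ℝ) : ℝ≥0∞ :=
  ∫⁻ a in Icc (0 : ℝ) 1, action Q (μ a) (V a)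

lemma transportDist_sq (Q : X → X → ℝ) (μ₀ μ₁ : X → ℝ) :
    transportDist Q μ₀ μ₁ ^ 2 = ⨅ (μ : ℝ → X → ℝ) (V : ℝ → X → X → ℝ)
      (_ : ContinuityEq μ₀ μ₁ μ V), totalAction Q μ V := by
  rw [transportDist, ← ENNReal.rpow_natCast, ← ENNReal.rpow_mul]
  simp [totalAction]

lemma transportDist_sq_le {Q : X → X → ℝ} {μ₀ μ₁ : X → ℝ} {μ : ℝ → X → ℝ} {V : ℝ → X → X → ℝ}
    (h : ContinuityEq μ₀ μ₁ μ V) : transportDist Q μ₀ μ₁ ^ 2 ≤ totalAction Q μ V := by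
  rw [transportDist_sq]
  exact iInf_le_of_le μ (iInf_le_of_le V (iInf_le _ h))

lemma exists_curve_of_lt {Q : X → X → ℝ} {μ₀ μ₁ : X → ℝ} {c : ℝ≥0∞}
    (h : transportDist Q μ₀ μ₁ ^ 2 < c) : ∃ (μ : ℝ → X → ℝ) (V : ℝ → X → X → ℝ),
      ContinuityEq μ₀ μ₁ μ V ∧ totalAction Q μ V < c := by
  rw [transportDist_sq] at h
  simpa only [iInf_lt_iff, exists_prop] using h

lemma le_of_sq_le_sq_ennreal {a b : ℝ≥0∞} (h : a ^ 2 ≤ b ^ 2) : a ≤ b :=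
  (ENNReal.pow_le_pow_left_iff two_ne_zero).1 h

lemma transportDist_le_of_action_le {Q : X → X → ℝ} {μ₀ μ₁ : X → ℝ} {μ : ℝ → X → ℝ}
    {V : ℝ → X → X → ℝ} (h : ContinuityEq μ₀ μ₁ μ V) {A : ℝ} (hA : 0 ≤ A)
    (hle : ∀ a ∈ Icc (0 : ℝ) 1, action Q (μ a) (V a) ≤ ENNReal.ofReal (A ^ 2)) :
    transportDist Q μ₀ μ₁ ≤ ENNReal.ofReal A := by
  refine le_of_sq_le_sq_ennreal ((transportDist_sq_le h).trans ?_)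
  refine (setLIntegral_mono' measurableSet_Icc hle).trans ?_
  simp [ENNReal.ofReal_pow hA]

lemma ContinuityEq.of_hasDerivAt {μ : ℝ → X → ℝ} {V : ℝ → X → X → ℝ}
    (hmem : ∀ a ∈ Icc (0 : ℝ) 1, μ a ∈ stdSimplex ℝ X)
    (hV : ∀ x y, Continuous fun a => V a x y)
    (hder : ∀ a x, HasDerivAt (fun a => μ a x) (-divg (V a) x) a) :
    ContinuityEq (μ 0) (μ 1) μ V where
  continuousOn := (continuous_pi fun x => continuous_iff_continuousAt.2 fun a =>
    (hder a x).continuousAt).continuousOn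
  left := rfl
  right := rfl
  mem := hmem
  integrable x y := (hV x y).intervalIntegrable _ _
  eqn a _ x := by
    have hc : Continuous fun a => divg (V a) x :=
      continuous_const.mul (continuous_finsetSum _ fun y _ => (hV x y).sub (hV y x))
    have := intervalIntegral.integral_eq_sub_of_hasDerivAt (a := 0) (b := a)
      (fun r _ => hder r x) (hc.neg.intervalIntegrable _ _)
    rw [intervalIntegral.integral_neg] at this
    simp only [divg] at this ⊢
    linarith

lemma ContinuityEq.intervalIntegrable_divg {μ₀ μ₁ : X → ℝ} {μ : ℝ → X → ℝ} {V : ℝ → X → X → ℝ}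
    (h : ContinuityEq μ₀ μ₁ μ V) (x : X) :
    IntervalIntegrable (fun a => divg (V a) x) volume 0 1 := by
  unfold divg
  refine IntervalIntegrable.const_mul ?_ _
  have := IntervalIntegrable.sum (f := fun y a => V a x y - V a y x)
    Finset.univ fun y _ => (h.integrable x y).sub (h.integrable y x)
  have e : (fun a => ∑ y, (V a x y - V a y x)) = ∑ y, fun a => V a x y - V a y x := by
    ext a
    simp
  rw [e]
  exact this

lemma ContinuityEq.eqn' {μ₀ μ₁ : X → ℝ} {μ : ℝ → X → ℝ} {V : ℝ → X → X → ℝ}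
    (h : ContinuityEq μ₀ μ₁ μ V) {a : ℝ} (ha : a ∈ Icc (0 : ℝ) 1) (x : X) :
    μ a x = μ₀ x - ∫ r in (0 : ℝ)..a, divg (V r) x := h.eqn a ha x

lemma lintegral_Ioc_affine (f : ℝ → ℝ≥0∞) {c d : ℝ} (hc : 0 < c) :
    ∫⁻ x in Ioc d (d + c), f x = ENNReal.ofReal c * ∫⁻ a in Ioc (0 : ℝ) 1, f (d + c * a) := by
  have himg : (fun a : ℝ => d + c * a) '' Ioc 0 1 = Ioc d (d + c) := by
    ext x
    simp only [mem_image, mem_Ioc]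
    constructor
    · rintro ⟨a, ha, rfl⟩
      constructor <;> nlinarith [ha.1, ha.2]
    · intro hx
      refine ⟨(x - d) / c, ⟨div_pos (by linarith) hc, (div_le_one hc).2 (by linarith)⟩, ?_⟩
      field_simp
      ring
  have := lintegral_image_eq_lintegral_abs_deriv_mul (s := Ioc (0 : ℝ) 1)
    (f := fun a => d + c * a) (f' := fun _ => c) measurableSet_Ioc
    (fun a _ => (by simpa using ((hasDerivAt_id a).const_mul c).const_add d :
      HasDerivAt (fun a : ℝ => d + c * a) c a).hasDerivWithinAt)
    (fun a _ b _ hab => by simpa [hc.ne'] using hab) f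
  rw [himg] at this
  rw [this, abs_of_pos hc, lintegral_const_mul' _ _ ENNReal.ofReal_ne_top]

/-- Concatenation at time `l` of two functions on `[0, 1]`, reparametrized affinely. -/
def glue {F : Type*} (l : ℝ) (f g : ℝ → F) : ℝ → F :=
  fun a => if a ≤ l then f (a / l) else g ((a - l) / (1 - l))

/-- Concatenation of the momenta of two curves. -/
def glueMomentum (l : ℝ) (V W : ℝ → X → X → ℝ) : ℝ → X → X → ℝ :=
  glue l (fun a x y => l⁻¹ * V a x y) (fun a x y => (1 - l)⁻¹ * W a x y)

lemma intervalIntegrable_glue {l : ℝ} (hl : l ∈ Ioo (0 : ℝ) 1) {f g : ℝ → ℝ}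
    (hf : IntervalIntegrable f volume 0 1) (hg : IntervalIntegrable g volume 0 1) :
    IntervalIntegrable (glue l f g) volume 0 1 := by
  have h1l : 0 < 1 - l := by linarith [hl.2]
  have h1 : IntervalIntegrable (glue l f g) volume 0 l := by
    have := hf.comp_mul_right (c := l⁻¹)
    simp only [zero_div, one_div, inv_inv] at this
    refine this.congr ?_
    intro a ha
    rw [uIoc_of_le hl.1.le] at ha
    simp [glue, ha.2, div_eq_mul_inv]
  have h2 : IntervalIntegrable (glue l f g) volume l 1 := by
    have := (hg.comp_mul_right (c := (1 - l)⁻¹)).comp_sub_right l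
    simp only [zero_div, one_div, inv_inv, zero_add, sub_add_cancel] at this
    refine this.congr ?_
    intro a ha
    rw [uIoc_of_le hl.2.le] at ha
    simp [glue, not_le.2 ha.1, div_eq_mul_inv]
  exact h1.trans h2

lemma integral_glue_of_le {l : ℝ} (hl : l ∈ Ioo (0 : ℝ) 1) {f g : ℝ → ℝ} {a : ℝ}
    (ha : a ∈ Icc 0 l) :
    ∫ r in (0 : ℝ)..a, glue l f g r = l * ∫ r in (0 : ℝ)..a / l, f r := by
  have : ∫ r in (0 : ℝ)..a, glue l f g r = ∫ r in (0 : ℝ)..a, f (r / l) := by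
    refine intervalIntegral.integral_congr fun r hr => ?_
    rw [uIcc_of_le ha.1] at hr
    simp [glue, hr.2.trans ha.2]
  rw [this, intervalIntegral.integral_comp_div _ hl.1.ne']
  simp

lemma integral_glue_of_ge {l : ℝ} (hl : l ∈ Ioo (0 : ℝ) 1) {f g : ℝ → ℝ} {a : ℝ}
    (ha : a ∈ Icc l 1) :
    ∫ r in l..a, glue l f g r = (1 - l) * ∫ r in (0 : ℝ)..(a - l) / (1 - l), g r := by
  have h1l : (1 - l) ≠ 0 := by linarith [hl.2]
  have : ∫ r in l..a, glue l f g r = ∫ r in l..a, g (r / (1 - l) - l / (1 - l)) := by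
    refine intervalIntegral.integral_congr_ae (Eventually.of_forall fun r hr => ?_)
    rw [uIoc_of_le ha.1] at hr
    simp [glue, not_le.2 hr.1, sub_div]
  rw [this, intervalIntegral.integral_comp_div_sub _ h1l]
  simp [sub_div]

lemma divg_glueMomentum (l : ℝ) (V W : ℝ → X → X → ℝ) (r : ℝ) (x : X) :
    divg (glueMomentum l V W r) x =
      glue l (fun a => l⁻¹ * divg (V a) x) (fun a => (1 - l)⁻¹ * divg (W a) x) r := by
  unfold glueMomentum glue
  split_ifs
  · exact divg_smul _ _ _
  · exact divg_smul _ _ _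

lemma ContinuityEq.glue {μ₀ μ₁ μ₂ : X → ℝ} {μ ν : ℝ → X → ℝ} {V W : ℝ → X → X → ℝ}
    (h : ContinuityEq μ₀ μ₁ μ V) (h' : ContinuityEq μ₁ μ₂ ν W) {l : ℝ} (hl : l ∈ Ioo (0 : ℝ) 1) :
    ContinuityEq μ₀ μ₂ (glue l μ ν) (glueMomentum l V W) := by
  have h1l : 0 < 1 - l := by linarith [hl.2]
  have e1 : ∀ a ∈ Icc (0 : ℝ) l, a / l ∈ Icc (0 : ℝ) 1 := fun a ha =>
    ⟨div_nonneg ha.1 hl.1.le, (div_le_one hl.1).2 ha.2⟩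
  have e2 : ∀ a ∈ Icc l 1, (a - l) / (1 - l) ∈ Icc (0 : ℝ) 1 := fun a ha =>
    ⟨div_nonneg (by linarith [ha.1]) h1l.le, (div_le_one h1l).2 (by linarith [ha.2])⟩
  have hint : ∀ x y, IntervalIntegrable (fun a => glueMomentum l V W a x y) volume 0 1 := by
    intro x y
    have := intervalIntegrable_glue hl ((h.integrable x y).const_mul l⁻¹)
      ((h'.integrable x y).const_mul (1 - l)⁻¹)
    convert this using 2 with a
    simp only [glueMomentum, SRF.glue]
    split_ifs <;> rfl
  have heqn : ∀ a ∈ Icc (0 : ℝ) 1, ∀ x, SRF.glue l μ ν a x = μ₀ x -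
      ∫ r in (0 : ℝ)..a, divg (glueMomentum l V W r) x := by
    intro a ha x
    simp only [divg_glueMomentum]
    have hI := intervalIntegrable_glue hl ((h.intervalIntegrable_divg x).const_mul l⁻¹)
      ((h'.intervalIntegrable_divg x).const_mul (1 - l)⁻¹)
    by_cases hal : a ≤ l
    · rw [integral_glue_of_le hl ⟨ha.1, hal⟩, intervalIntegral.integral_const_mul,
        mul_inv_cancel_left₀ hl.1.ne', ← h.eqn' (e1 a ⟨ha.1, hal⟩) x]
      simp [SRF.glue, hal]
    · push Not at hal
      rw [← intervalIntegral.integral_add_adjacent_intervals (b := l)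
          (hI.mono_set (by
            rw [uIcc_of_le hl.1.le, uIcc_of_le zero_le_one]; exact Icc_subset_Icc_right hl.2.le))
          (hI.mono_set (by
            rw [uIcc_of_le hal.le, uIcc_of_le zero_le_one]; exact Icc_subset_Icc hl.1.le ha.2)),
        integral_glue_of_le hl ⟨hl.1.le, le_rfl⟩, integral_glue_of_ge hl ⟨hal.le, ha.2⟩,
        intervalIntegral.integral_const_mul, intervalIntegral.integral_const_mul,
        mul_inv_cancel_left₀ hl.1.ne', mul_inv_cancel_left₀ h1l.ne', div_self hl.1.ne']
      have h3 := h.eqn' (right_mem_Icc.2 zero_le_one) x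
      have h4 := h'.eqn' (e2 a ⟨hal.le, ha.2⟩) x
      rw [h.right] at h3
      simp only [SRF.glue, not_le.2 hal, if_false]
      linarith
  refine ⟨?_, ?_, ?_, ?_, hint, heqn⟩
  · have hc1 : ContinuousOn (fun a => μ (a / l)) (Icc 0 l) :=
      h.continuousOn.comp (by fun_prop) e1
    have hc2 : ContinuousOn (fun a => ν ((a - l) / (1 - l))) (Icc l 1) :=
      h'.continuousOn.comp (by fun_prop) e2
    have hu : Icc (0 : ℝ) 1 = Icc 0 l ∪ Icc l 1 := (Icc_union_Icc_eq_Icc hl.1.le hl.2.le).symm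
    rw [hu]
    refine ContinuousOn.union_of_isClosed (hc1.congr fun a ha => ?_) (hc2.congr fun a ha => ?_)
      isClosed_Icc isClosed_Icc
    · simp [SRF.glue, ha.2]
    · rcases ha.1.eq_or_lt with rfl | hlt
      · simp [SRF.glue, div_self hl.1.ne', h.right, h'.left]
      · simp [SRF.glue, not_le.2 hlt]
  · simp [SRF.glue, hl.1.le, h.left]
  · simp [SRF.glue, not_le.2 hl.2, div_self h1l.ne', h'.right]
  · intro a ha
    by_cases hal : a ≤ l
    · simpa [SRF.glue, hal] using h.mem _ (e1 a ⟨ha.1, hal⟩)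
    · simpa [SRF.glue, hal] using h'.mem _ (e2 a ⟨(not_le.1 hal).le, ha.2⟩)

lemma totalAction_glue_le {Q : X → X → ℝ} {μ ν : ℝ → X → ℝ} {V W : ℝ → X → X → ℝ} {l : ℝ}
    (hl : l ∈ Ioo (0 : ℝ) 1) :
    totalAction Q (glue l μ ν) (glueMomentum l V W) ≤
      ENNReal.ofReal l⁻¹ * totalAction Q μ V + ENNReal.ofReal (1 - l)⁻¹ * totalAction Q ν W := by
  have h1l : 0 < 1 - l := by linarith [hl.2]
  set F := fun a => action Q (glue l μ ν a) (glueMomentum l V W a) with hF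
  have hsplit : totalAction Q (glue l μ ν) (glueMomentum l V W) ≤
      (∫⁻ a in Ioc 0 (0 + l), F a) + ∫⁻ a in Ioc l (l + (1 - l)), F a := by
    rw [totalAction, setLIntegral_congr Ioc_ae_eq_Icc.symm, zero_add, add_sub_cancel,
      ← Ioc_union_Ioc_eq_Ioc hl.1.le hl.2.le]
    exact lintegral_union_le _ _ _
  have hIoc : ∀ (μ : ℝ → X → ℝ) (V : ℝ → X → X → ℝ), totalAction Q μ V =
      ∫⁻ a in Ioc (0 : ℝ) 1, action Q (μ a) (V a) := fun μ V =>
    setLIntegral_congr Ioc_ae_eq_Icc.symm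
  have hscale : ∀ {c : ℝ} (hc : 0 < c) (x : ℝ≥0∞),
      ENNReal.ofReal c * (ENNReal.ofReal (c⁻¹ ^ 2) * x) = ENNReal.ofReal c⁻¹ * x := by
    intro c hc x
    rw [← mul_assoc, ← ENNReal.ofReal_mul hc.le]
    congr 2
    field_simp
  refine hsplit.trans (add_le_add (le_of_eq ?_) (le_of_eq ?_))
  · rw [lintegral_Ioc_affine F hl.1, hIoc μ V, ← hscale hl.1,
      ← lintegral_const_mul' (ENNReal.ofReal (l⁻¹ ^ 2)) _ ENNReal.ofReal_ne_top]
    congr 1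
    refine setLIntegral_congr_fun measurableSet_Ioc fun a ha => ?_
    have h1 : l * a ≤ l := by nlinarith [ha.2, hl.1]
    simp only [hF, glueMomentum, glue, zero_add, h1, if_true, mul_div_cancel_left₀ a hl.1.ne']
    exact action_smul (inv_pos.2 hl.1)
  · rw [lintegral_Ioc_affine F h1l, hIoc ν W, ← hscale h1l,
      ← lintegral_const_mul' (ENNReal.ofReal ((1 - l)⁻¹ ^ 2)) _ ENNReal.ofReal_ne_top]
    congr 1
    refine setLIntegral_congr_fun measurableSet_Ioc fun a ha => ?_
    have h1 : ¬ (l + (1 - l) * a ≤ l) := by nlinarith [ha.1]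
    simp only [hF, glueMomentum, glue, h1, if_false, add_sub_cancel_left,
      mul_div_cancel_left₀ a h1l.ne']
    exact action_smul (inv_pos.2 h1l)

lemma transportDist_triangle (Q : X → X → ℝ) (μ₀ μ₁ μ₂ : X → ℝ) :
    transportDist Q μ₀ μ₂ ≤ transportDist Q μ₀ μ₁ + transportDist Q μ₁ μ₂ := by
  by_cases hA : transportDist Q μ₀ μ₁ = ⊤
  · simp [hA]
  by_cases hB : transportDist Q μ₁ μ₂ = ⊤
  · simp [hB]
  set A := (transportDist Q μ₀ μ₁).toReal with hAdef
  set B := (transportDist Q μ₁ μ₂).toReal with hBdef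
  have hA0 : 0 ≤ A := ENNReal.toReal_nonneg
  have hB0 : 0 ≤ B := ENNReal.toReal_nonneg
  have eA : transportDist Q μ₀ μ₁ = ENNReal.ofReal A := (ENNReal.ofReal_toReal hA).symm
  have eB : transportDist Q μ₁ μ₂ = ENNReal.ofReal B := (ENNReal.ofReal_toReal hB).symm
  rw [eA, eB, ← ENNReal.ofReal_add hA0 hB0]
  refine ENNReal.le_of_forall_pos_le_add fun ε hε _ => ?_
  have hε' : (0 : ℝ) < ε := hε
  set a := A + ε / 2
  set b := B + ε / 2
  have ha : 0 < a := by positivity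
  have hb : 0 < b := by positivity
  have h1 : transportDist Q μ₀ μ₁ ^ 2 < ENNReal.ofReal (a ^ 2) := by
    rw [eA, ← ENNReal.ofReal_pow hA0]
    exact (ENNReal.ofReal_lt_ofReal_iff (by positivity)).2
      (pow_lt_pow_left₀ (by simp only [a]; linarith) hA0 two_ne_zero)
  have h2 : transportDist Q μ₁ μ₂ ^ 2 < ENNReal.ofReal (b ^ 2) := by
    rw [eB, ← ENNReal.ofReal_pow hB0]
    exact (ENNReal.ofReal_lt_ofReal_iff (by positivity)).2
      (pow_lt_pow_left₀ (by simp only [b]; linarith) hB0 two_ne_zero)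
  obtain ⟨μ, V, hμ, hμA⟩ := exists_curve_of_lt h1
  obtain ⟨ν, W, hν, hνA⟩ := exists_curve_of_lt h2
  have hl : a / (a + b) ∈ Ioo (0 : ℝ) 1 :=
    ⟨by positivity, (div_lt_one (by positivity)).2 (by linarith)⟩
  have hsum : ENNReal.ofReal (A + B) + ε = ENNReal.ofReal (a + b) := by
    rw [← ENNReal.ofReal_coe_nnreal, ← ENNReal.ofReal_add (by positivity) hε'.le]
    congr 1
    simp only [a, b]; ring
  rw [hsum]
  refine le_of_sq_le_sq_ennreal ((transportDist_sq_le (hμ.glue hν hl)).trans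
    ((totalAction_glue_le hl).trans ?_))
  refine (add_le_add (mul_le_mul_right hμA.le _) (mul_le_mul_right hνA.le _)).trans ?_
  rw [← ENNReal.ofReal_mul (by positivity), ← ENNReal.ofReal_mul (inv_nonneg.2 (by linarith [hl.2])),
    ← ENNReal.ofReal_add (by positivity)
      (mul_nonneg (inv_nonneg.2 (by linarith [hl.2])) (sq_nonneg b)),
    ← ENNReal.ofReal_pow (by positivity)]
  refine ENNReal.ofReal_le_ofReal (le_of_eq ?_)
  have : 1 - a / (a + b) = b / (a + b) := by field_simp; ring
  rw [this]
  field_simp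

/-! ### Upper bounds for the transport distance -/

section Bounds

variable {Q : X → X → ℝ} {π : X → ℝ}

open Classical in
lemma IsMarkovTriple.exists_path_flow (h : IsMarkovTriple Q π) (o z : X) :
    ∃ F : X → X → ℝ, (∀ x y, F x y ≠ 0 → x ≠ y ∧ 0 < Q x y) ∧
      ∀ x, divg F x = (if x = z then 1 else 0) - (if x = o then 1 else 0) := by
  induction h.irreducible o z with
  | refl => exact ⟨fun _ _ => 0, fun x y hxy => absurd rfl hxy, fun x => by simp [divg]⟩
  | @tail b c _ hbc ih =>
    obtain ⟨F, hF, hdiv⟩ := ih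
    by_cases hne : b = c
    · subst hne
      exact ⟨F, hF, hdiv⟩
    refine ⟨fun x y => F x y + 2 * ((if x = c then 1 else 0) * (if y = b then 1 else 0)),
      fun x y hxy => ?_, fun x => ?_⟩
    · by_cases h1 : x = c ∧ y = b
      · rw [h1.1, h1.2]
        exact ⟨Ne.symm hne, h.rate_pos_symm hbc⟩
      · refine hF x y fun h0 => hxy ?_
        beta_reduce
        rw [h0]
        by_cases hx : x = c
        · rw [if_neg fun hy => h1 ⟨hx, hy⟩]; simp
        · simp [hx]
    · have h2 := hdiv x
      simp only [divg, Finset.sum_sub_distrib, Finset.sum_add_distrib, ← Finset.mul_sum,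
        ← Finset.sum_mul] at h2 ⊢
      simp only [Finset.sum_ite_eq', Finset.mem_univ, if_true] at h2 ⊢
      linarith

lemma IsMarkovTriple.exists_flow (h : IsMarkovTriple Q π) :
    ∃ C, 0 ≤ C ∧ ∀ w : X → ℝ, ∑ x, w x = 0 → ∃ V : X → X → ℝ,
      (∀ x y, V x y ≠ 0 → x ≠ y ∧ 0 < Q x y) ∧ (∀ x, divg V x = w x) ∧
      ∀ x y, |V x y| ≤ C * ‖w‖ := by
  classical
  rcases isEmpty_or_nonempty X with hX | ⟨⟨o⟩⟩
  · exact ⟨0, le_rfl, fun w _ => ⟨fun _ _ => 0, fun x => (hX.false x).elim,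
      fun x => (hX.false x).elim, fun x => (hX.false x).elim⟩⟩
  choose F hF hdiv using fun z => h.exists_path_flow o z
  refine ⟨∑ z, coeffSum (F z), Finset.sum_nonneg fun z _ => coeffSum_nonneg _, fun w hw =>
    ⟨fun x y => ∑ z, w z * F z x y, fun x y hxy => ?_, fun x => ?_, fun x y => ?_⟩⟩
  · obtain ⟨z, _, hz⟩ := Finset.exists_ne_zero_of_sum_ne_zero hxy
    exact hF z x y (right_ne_zero_of_mul hz)
  · have h1 : divg (fun x y => ∑ z, w z * F z x y) x = ∑ z, w z * divg (F z) x := by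
      simp only [divg, ← Finset.sum_sub_distrib, ← mul_sub]
      rw [Finset.sum_comm, Finset.mul_sum]
      refine Finset.sum_congr rfl fun z _ => ?_
      rw [← Finset.mul_sum]; ring
    rw [h1]
    simp only [hdiv, mul_sub, Finset.sum_sub_distrib, ← Finset.sum_mul, hw]
    simp
  · refine (Finset.abs_sum_le_sum_abs _ _).trans ?_
    rw [Finset.sum_mul]
    refine Finset.sum_le_sum fun z _ => ?_
    rw [abs_mul, mul_comm]
    exact mul_le_mul (abs_le_coeffSum (F z) x y) (norm_le_pi_norm w z) (abs_nonneg _)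
      (coeffSum_nonneg _)

lemma exists_rate_lower_bound (Q : X → X → ℝ) : ∃ q, 0 < q ∧ ∀ x y, 0 < Q x y → q ≤ Q x y := by
  have hK : 0 < 1 + coeffSum fun x y => (Q x y)⁻¹ :=
    add_pos_of_pos_of_nonneg one_pos (coeffSum_nonneg _)
  refine ⟨(1 + coeffSum fun x y => (Q x y)⁻¹)⁻¹, inv_pos.2 hK, fun x y hxy => ?_⟩
  refine inv_le_of_inv_le₀ hxy ?_
  have := (le_abs_self _).trans (abs_le_coeffSum (fun x y => (Q x y)⁻¹) x y)
  beta_reduce at this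
  linarith

lemma convexComb_mem_stdSimplex {μ ν : X → ℝ} (hμ : μ ∈ stdSimplex ℝ X) (hν : ν ∈ stdSimplex ℝ X)
    {f : ℝ} (hf : f ∈ Icc (0 : ℝ) 1) : (fun x => (1 - f) * μ x + f * ν x) ∈ stdSimplex ℝ X :=
  convex_stdSimplex ℝ X hμ hν (by linarith [hf.2]) hf.1 (by ring)

/-- The distance along the segment between two measures, in terms of a lower bound for the
densities along the way. -/
lemma IsMarkovTriple.exists_transportDist_segment_le (h : IsMarkovTriple Q π) :
    ∃ C, 0 ≤ C ∧ ∀ μ ∈ stdSimplex ℝ X, ∀ ν ∈ stdSimplex ℝ X, ∀ (f f' m : ℝ → ℝ) (c : ℝ),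
      Continuous f' → (∀ a, HasDerivAt f (f' a) a) → (∀ a ∈ Icc (0 : ℝ) 1, f a ∈ Icc (0 : ℝ) 1) →
      0 ≤ c → (∀ a ∈ Icc (0 : ℝ) 1, 0 ≤ m a ∧ (f' a) ^ 2 ≤ c * m a ∧
        ∀ x, m a ≤ (1 - f a) * μ x + f a * ν x) →
      transportDist Q (fun x => (1 - f 0) * μ x + f 0 * ν x)
        (fun x => (1 - f 1) * μ x + f 1 * ν x) ≤ ENNReal.ofReal (C * ‖μ - ν‖ * √c) := by
  obtain ⟨C, hC, hflow⟩ := h.exists_flow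
  obtain ⟨q, hq, hqle⟩ := exists_rate_lower_bound Q
  refine ⟨√(1 / 2 * (Fintype.card X * (Fintype.card X * (C ^ 2 / q)))), Real.sqrt_nonneg _, ?_⟩
  intro μ hμ ν hν f f' m c hf'c hf' hf hc hm
  obtain ⟨V, hV, hdiv, hVle⟩ := hflow (μ - ν) (by simp [hμ.2, hν.2])
  have hcurve := ContinuityEq.of_hasDerivAt (μ := fun a x => (1 - f a) * μ x + f a * ν x)
    (V := fun a x y => f' a * V x y)
    (fun a ha => convexComb_mem_stdSimplex hμ hν (hf a ha))
    (fun x y => hf'c.mul continuous_const)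
    (fun a x => by
      rw [divg_smul, hdiv]
      refine (((hf' a).const_sub 1 |>.mul_const (μ x)).add
        ((hf' a).mul_const (ν x))).congr_deriv ?_
      simp only [Pi.sub_apply]; ring)
  refine transportDist_le_of_action_le hcurve (by positivity) fun a ha => ?_
  obtain ⟨hm0, hm1, hm2⟩ := hm a ha
  refine (action_le h.nonnegRates (convexComb_mem_stdSimplex hμ hν (hf a ha)).1
    (c := fun _ _ => C ^ 2 * ‖μ - ν‖ ^ 2 * c / q) (fun _ _ => by positivity)
    fun x y hxy => ?_).trans (ENNReal.ofReal_le_ofReal (le_of_eq ?_))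
  · by_cases h0 : V x y = 0
    · rw [h0, mul_zero]
      have := mobility_nonneg h.nonnegRates (convexComb_mem_stdSimplex hμ hν (hf a ha)).1 hxy
      simp only [ne_eq, OfNat.ofNat_ne_zero, not_false_eq_true, zero_pow]
      positivity
    · have hQ := (hV x y h0).2
      have hmob : m a * q ≤ mobility Q (fun x => (1 - f a) * μ x + f a * ν x) x y :=
        le_logMean (mul_nonneg hm0 hq.le) (mul_le_mul (hm2 x) (hqle x y hQ) hq.le
          (hm0.trans (hm2 x))) (mul_le_mul (hm2 y) (hqle y x (h.rate_pos_symm hQ)) hq.le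
          (hm0.trans (hm2 y)))
      have hV2 : V x y ^ 2 ≤ C ^ 2 * ‖μ - ν‖ ^ 2 := by
        rw [← sq_abs, ← mul_pow]
        exact pow_le_pow_left₀ (abs_nonneg _) (hVle x y) 2
      calc (f' a * V x y) ^ 2 = (f' a) ^ 2 * V x y ^ 2 := by ring
        _ ≤ (c * m a) * (C ^ 2 * ‖μ - ν‖ ^ 2) := mul_le_mul hm1 hV2 (sq_nonneg _)
            (mul_nonneg hc hm0)
        _ = C ^ 2 * ‖μ - ν‖ ^ 2 * c / q * (m a * q) := by field_simp
        _ ≤ _ := mul_le_mul_of_nonneg_left hmob (by positivity)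
  · simp only [Finset.sum_const, Finset.card_univ, nsmul_eq_mul]
    rw [mul_pow, mul_pow, Real.sq_sqrt (by positivity), Real.sq_sqrt hc]
    ring

lemma norm_sub_le_one {μ ν : X → ℝ} (hμ : μ ∈ stdSimplex ℝ X) (hν : ν ∈ stdSimplex ℝ X) :
    ‖μ - ν‖ ≤ 1 := by
  refine (pi_norm_le_iff_of_nonneg zero_le_one).2 fun x => ?_
  have h1 := mem_Icc_of_mem_stdSimplex hμ x
  have h2 := mem_Icc_of_mem_stdSimplex hν x
  rw [Pi.sub_apply, Real.norm_eq_abs, abs_le]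
  constructor <;> linarith [h1.1, h1.2, h2.1, h2.2]

lemma IsMarkovTriple.mem_stdSimplex (h : IsMarkovTriple Q π) : π ∈ stdSimplex ℝ X :=
  ⟨fun x => (h.pos x).le, h.sum_eq_one⟩

lemma IsMarkovTriple.exists_pos_le (h : IsMarkovTriple Q π) : ∃ κ, 0 < κ ∧ ∀ x, κ ≤ π x := by
  obtain ⟨q, hq, hle⟩ := exists_rate_lower_bound fun x (_ : X) => π x
  exact ⟨q, hq, fun x => hle x x (h.pos x)⟩

/-- Between measures bounded below by `κ`, the transport distance is at most a constant times
`‖μ - ν‖ / √κ`. -/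
lemma IsMarkovTriple.exists_transportDist_le_of_lower_bound (h : IsMarkovTriple Q π) :
    ∃ C, 0 ≤ C ∧ ∀ μ ∈ stdSimplex ℝ X, ∀ ν ∈ stdSimplex ℝ X, ∀ κ, 0 < κ → (∀ x, κ ≤ μ x) →
      (∀ x, κ ≤ ν x) → transportDist Q μ ν ≤ ENNReal.ofReal (C * ‖μ - ν‖ / √κ) := by
  obtain ⟨C, hC, hseg⟩ := h.exists_transportDist_segment_le
  refine ⟨C, hC, fun μ hμ ν hν κ hκ hμκ hνκ => ?_⟩
  have := hseg μ hμ ν hν (fun a => a) (fun _ => 1) (fun _ => κ) κ⁻¹ continuous_const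
    (fun a => hasDerivAt_id a) (fun a ha => ha) (inv_nonneg.2 hκ.le) fun a ha =>
      ⟨hκ.le, by rw [inv_mul_cancel₀ hκ.ne', one_pow], fun x => by
        nlinarith [hμκ x, hνκ x, ha.1, ha.2, mul_nonneg ha.1 (sub_nonneg.2 (hνκ x)),
          mul_nonneg (sub_nonneg.2 ha.2) (sub_nonneg.2 (hμκ x))]⟩
  simpa [Real.sqrt_inv, div_eq_mul_inv] using this

/-- The transport distance is controlled by the square root of the Euclidean distance. -/
lemma IsMarkovTriple.exists_transportDist_le_sqrt (h : IsMarkovTriple Q π) :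
    ∃ C, 0 ≤ C ∧ ∀ μ ∈ stdSimplex ℝ X, ∀ ν ∈ stdSimplex ℝ X,
      transportDist Q μ ν ≤ ENNReal.ofReal (C * √‖μ - ν‖) := by
  obtain ⟨C, hC, hseg⟩ := h.exists_transportDist_segment_le
  obtain ⟨C', hC', hlow⟩ := h.exists_transportDist_le_of_lower_bound
  obtain ⟨κ, hκ, hκπ⟩ := h.exists_pos_le
  have hπ := h.mem_stdSimplex
  have hstart : ∀ μ ∈ stdSimplex ℝ X, ∀ ε ∈ Icc (0 : ℝ) 1,
      transportDist Q μ (fun x => (1 - ε) * μ x + ε * π x) ≤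
        ENNReal.ofReal (C * √(4 * ε / κ)) := by
    intro μ hμ ε hε
    have := hseg μ hμ π hπ (fun a => ε * a ^ 2) (fun a => ε * (2 * a))
      (fun a => ε * a ^ 2 * κ) (4 * ε / κ) (by fun_prop)
      (fun a => by simpa using (hasDerivAt_pow 2 a).const_mul ε)
      (fun a ha => ⟨mul_nonneg hε.1 (sq_nonneg a), mul_le_one₀ hε.2 (sq_nonneg a)
        (pow_le_one₀ ha.1 ha.2)⟩)
      (div_nonneg (mul_nonneg zero_le_four hε.1) hκ.le) fun a ha => ?_
    · simp only [ne_eq, OfNat.ofNat_ne_zero, not_false_eq_true, zero_pow, mul_zero, sub_zero,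
        one_mul, zero_mul, add_zero, one_pow, mul_one] at this
      refine this.trans (ENNReal.ofReal_le_ofReal ?_)
      have h1 := norm_sub_le_one hμ hπ
      gcongr
      nlinarith
    · have hεa : 0 ≤ ε * a ^ 2 := mul_nonneg hε.1 (sq_nonneg a)
      have hεa1 : ε * a ^ 2 ≤ 1 := mul_le_one₀ hε.2 (sq_nonneg a) (pow_le_one₀ ha.1 ha.2)
      refine ⟨mul_nonneg hεa hκ.le, le_of_eq ?_, fun x => ?_⟩
      · field_simp; ring
      · have h1 := mul_le_mul_of_nonneg_left (hκπ x) hεa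
        have h2 := mul_nonneg (sub_nonneg.2 hεa1) (hμ.1 x)
        linarith
  have hend : ∀ μ ∈ stdSimplex ℝ X, ∀ ε ∈ Icc (0 : ℝ) 1,
      transportDist Q (fun x => (1 - ε) * μ x + ε * π x) μ ≤
        ENNReal.ofReal (C * √(4 * ε / κ)) := by
    intro μ hμ ε hε
    have hb : ∀ a ∈ Icc (0 : ℝ) 1, 0 ≤ ε * (1 - a) ^ 2 ∧ ε * (1 - a) ^ 2 ≤ 1 := fun a ha =>
      ⟨mul_nonneg hε.1 (sq_nonneg _), mul_le_one₀ hε.2 (sq_nonneg _)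
        (pow_le_one₀ (by linarith [ha.2]) (by linarith [ha.1]))⟩
    have := hseg μ hμ π hπ (fun a => ε * (1 - a) ^ 2) (fun a => ε * (-(2 * (1 - a))))
      (fun a => ε * (1 - a) ^ 2 * κ) (4 * ε / κ) (by fun_prop)
      (fun a => by
        simpa using (((hasDerivAt_id a).const_sub 1).fun_pow 2).const_mul ε)
      hb (div_nonneg (mul_nonneg zero_le_four hε.1) hκ.le) fun a ha => ?_
    · simp only [ne_eq, OfNat.ofNat_ne_zero, not_false_eq_true, zero_pow, mul_zero, sub_zero,
        one_mul, zero_mul, add_zero, one_pow, mul_one, sub_self] at this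
      refine this.trans (ENNReal.ofReal_le_ofReal ?_)
      have h1 := norm_sub_le_one hμ hπ
      gcongr
      nlinarith
    · obtain ⟨hεa, hεa1⟩ := hb a ha
      refine ⟨mul_nonneg hεa hκ.le, le_of_eq ?_, fun x => ?_⟩
      · field_simp; ring
      · have h1 := mul_le_mul_of_nonneg_left (hκπ x) hεa
        have h2 := mul_nonneg (sub_nonneg.2 hεa1) (hμ.1 x)
        linarith
  refine ⟨2 * (C * √(4 / κ)) + C' / √κ, by positivity, fun μ hμ ν hν => ?_⟩
  set ε := ‖μ - ν‖ with hεdef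
  have hε : ε ∈ Icc (0 : ℝ) 1 := ⟨norm_nonneg _, norm_sub_le_one hμ hν⟩
  rcases hε.1.eq_or_lt with h0 | hpos
  · have hμν : μ = ν := by
      rw [← sub_eq_zero, ← norm_eq_zero, ← hεdef, ← h0]
    subst hμν
    have := hstart μ hμ 0 ⟨le_rfl, zero_le_one⟩
    simpa [← h0] using this
  · set μ' := fun x => (1 - ε) * μ x + ε * π x with hμ'
    set ν' := fun x => (1 - ε) * ν x + ε * π x with hν'
    have hmid : transportDist Q μ' ν' ≤ ENNReal.ofReal (C' * ‖μ' - ν'‖ / √(ε * κ)) := by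
      refine hlow μ' (convexComb_mem_stdSimplex hμ hπ hε) ν' (convexComb_mem_stdSimplex hν hπ hε)
        (ε * κ) (mul_pos hpos hκ) (fun x => ?_) (fun x => ?_)
      · have h1 := mul_nonneg (sub_nonneg.2 hε.2) (hμ.1 x)
        have h2 := mul_le_mul_of_nonneg_left (hκπ x) hε.1
        simp only [hμ']; linarith
      · have h1 := mul_nonneg (sub_nonneg.2 hε.2) (hν.1 x)
        have h2 := mul_le_mul_of_nonneg_left (hκπ x) hε.1
        simp only [hν']; linarith
    have hnorm : ‖μ' - ν'‖ ≤ ε := by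
      have : μ' - ν' = (1 - ε) • (μ - ν) := by
        ext x
        simp only [hμ', hν', Pi.sub_apply, Pi.smul_apply, smul_eq_mul]; ring
      rw [this, norm_smul, Real.norm_of_nonneg (by linarith [hε.2]), ← hεdef]
      nlinarith [hε.1]
    have htri : transportDist Q μ ν ≤
        transportDist Q μ μ' + (transportDist Q μ' ν' + transportDist Q ν' ν) :=
      (transportDist_triangle Q μ μ' ν).trans
        (add_le_add le_rfl (transportDist_triangle Q μ' ν' ν))
    refine (htri.trans (add_le_add (hstart μ hμ ε hε) (add_le_add hmid (hend ν hν ε hε)))).trans ?_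
    rw [← ENNReal.ofReal_add (by positivity) (by positivity),
      ← ENNReal.ofReal_add (by positivity) (by positivity)]
    refine ENNReal.ofReal_le_ofReal ?_
    have e1 : √(4 * ε / κ) = √(4 / κ) * √ε := by
      rw [← Real.sqrt_mul (by positivity)]
      congr 1
      ring
    have e2 : C' * ‖μ' - ν'‖ / √(ε * κ) ≤ C' / √κ * √ε := by
      rw [Real.sqrt_mul hε.1, div_mul_eq_mul_div, div_le_div_iff₀ (by positivity) (by positivity)]
      have : C' * √ε * (√ε * √κ) = C' * ε * √κ := by
        rw [show C' * √ε * (√ε * √κ) = C' * (√ε * √ε) * √κ by ring, Real.mul_self_sqrt hε.1]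
      rw [this]
      gcongr
    rw [e1]
    linarith

lemma IsMarkovTriple.transportDist_ne_top (h : IsMarkovTriple Q π) {μ ν : X → ℝ}
    (hμ : μ ∈ stdSimplex ℝ X) (hν : ν ∈ stdSimplex ℝ X) : transportDist Q μ ν ≠ ⊤ := by
  obtain ⟨C, _, hle⟩ := h.exists_transportDist_le_sqrt
  exact ne_top_of_le_ne_top ENNReal.ofReal_ne_top (hle μ hμ ν hν)

end Bounds

/-! ### Poisson weights -/

/-- The Poisson weights `e^{-u} u^k / k!`. -/
def pois (k : ℕ) (u : ℝ) : ℝ := Real.exp (-u) * (u ^ k / k.factorial)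

/-- The Poisson tail `∑_{k ≥ n} e^{-u} u^k / k!`, written as a finite sum. -/
def poisTail (n : ℕ) (u : ℝ) : ℝ := 1 - ∑ k ∈ Finset.range n, pois k u

lemma pois_nonneg (k : ℕ) {u : ℝ} (hu : 0 ≤ u) : 0 ≤ pois k u := by
  unfold pois; positivity

lemma contDiff_pois (k : ℕ) {n : WithTop ℕ∞} : ContDiff ℝ n (pois k) := by
  unfold pois; fun_prop

lemma contDiff_poisTail (k : ℕ) {n : WithTop ℕ∞} : ContDiff ℝ n (poisTail k) := by
  unfold poisTail
  exact contDiff_const.sub (ContDiff.sum fun i _ => contDiff_pois i)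

lemma poisTail_succ (n : ℕ) (u : ℝ) : poisTail (n + 1) u = poisTail n u - pois n u := by
  simp only [poisTail, Finset.sum_range_succ]; ring

lemma hasDerivAt_pois_zero (u : ℝ) : HasDerivAt (pois 0) (-pois 0 u) u := by
  unfold pois
  simpa using (hasDerivAt_neg u).exp

lemma hasDerivAt_pois_succ (k : ℕ) (u : ℝ) :
    HasDerivAt (pois (k + 1)) (pois k u - pois (k + 1) u) u := by
  unfold pois
  refine ((hasDerivAt_neg u).exp.mul
    ((hasDerivAt_pow (k + 1) u).div_const ((k + 1).factorial : ℝ))).congr_deriv ?_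
  have : ((k + 1).factorial : ℝ) = (k + 1) * k.factorial := by
    rw [Nat.factorial_succ]; push_cast; ring
  have h0 : (k.factorial : ℝ) ≠ 0 := by positivity
  have h1 : (k + 1 : ℝ) ≠ 0 := by positivity
  rw [this]
  simp only [Nat.add_sub_cancel]
  push_cast
  field_simp
  ring

lemma hasDerivAt_poisTail_succ (n : ℕ) (u : ℝ) : HasDerivAt (poisTail (n + 1)) (pois n u) u := by
  induction n with
  | zero =>
    have h : poisTail 1 = fun u => 1 - pois 0 u := by ext u; simp [poisTail]
    rw [h]
    simpa using (hasDerivAt_pois_zero u).const_sub 1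
  | succ n ih =>
    have h : poisTail (n + 1 + 1) = fun u => poisTail (n + 1) u - pois (n + 1) u := by
      ext u; rw [poisTail_succ]
    rw [h]
    exact (ih.sub (hasDerivAt_pois_succ n u)).congr_deriv (by ring)

lemma pois_zero_right (k : ℕ) : pois k 0 = if k = 0 then 1 else 0 := by
  by_cases h : k = 0
  · simp [pois, h]
  · simp [pois, h]

lemma poisTail_succ_zero (n : ℕ) : poisTail (n + 1) 0 = 0 := by
  simp [poisTail, pois_zero_right]

lemma hasSum_pois_mul_pow (u z : ℝ) :
    HasSum (fun k => pois k u * z ^ k) (Real.exp (u * (z - 1))) := by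
  have h := (NormedSpace.expSeries_div_hasSum_exp (𝔸 := ℝ) (u * z)).mul_left (Real.exp (-u))
  rw [← Real.exp_eq_exp_ℝ, ← Real.exp_add] at h
  have e : -u + u * z = u * (z - 1) := by ring
  rw [e] at h
  have e' : (fun k => pois k u * z ^ k) =
      fun k : ℕ => Real.exp (-u) * ((u * z) ^ k / (k.factorial : ℝ)) := by
    ext k
    simp only [pois, mul_pow]
    ring
  rw [e']
  exact h

lemma hasSum_pois (u : ℝ) : HasSum (fun k => pois k u) 1 := by
  simpa using hasSum_pois_mul_pow u 1

lemma poisTail_nonneg (n : ℕ) {u : ℝ} (hu : 0 ≤ u) : 0 ≤ poisTail n u :=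
  sub_nonneg.2 (sum_le_hasSum _ (fun k _ => pois_nonneg k hu) (hasSum_pois u))

lemma poisTail_le_one (n : ℕ) {u : ℝ} (hu : 0 ≤ u) : poisTail n u ≤ 1 :=
  sub_le_self _ (Finset.sum_nonneg fun k _ => pois_nonneg k hu)

lemma poisTail_le_chernoff (n : ℕ) {u z : ℝ} (hu : 0 ≤ u) (hz : 1 ≤ z) :
    poisTail n u ≤ Real.exp (u * (z - 1)) / z ^ n := by
  have hz0 : 0 < z := one_pos.trans_le hz
  rw [le_div_iff₀ (pow_pos hz0 n)]
  have h1 := (hasSum_nat_add_iff' n).2 (hasSum_pois u)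
  have h2 := (hasSum_nat_add_iff' n).2 (hasSum_pois_mul_pow u z)
  have h3 := hasSum_le (fun k => ?_) (h1.mul_right (z ^ n)) h2
  · refine h3.trans (sub_le_self _ (Finset.sum_nonneg fun k _ => ?_))
    exact mul_nonneg (pois_nonneg k hu) (pow_nonneg hz0.le k)
  · exact mul_le_mul_of_nonneg_left (pow_le_pow_right₀ hz (Nat.le_add_left _ _)) (pois_nonneg _ hu)

lemma one_sub_poisTail_le_chernoff (n : ℕ) {u z : ℝ} (hu : 0 ≤ u) (hz0 : 0 < z) (hz : z ≤ 1) :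
    1 - poisTail n u ≤ Real.exp (u * (z - 1)) / z ^ n := by
  rw [le_div_iff₀ (pow_pos hz0 n)]
  simp only [poisTail, sub_sub_cancel, Finset.sum_mul]
  refine (Finset.sum_le_sum fun k hk => ?_).trans (sum_le_hasSum (Finset.range n) (fun k _ => ?_)
    (hasSum_pois_mul_pow u z))
  · exact mul_le_mul_of_nonneg_left (pow_le_pow_of_le_one hz0.le hz
      (Finset.mem_range.1 hk).le) (pois_nonneg _ hu)
  · exact mul_nonneg (pois_nonneg k hu) (pow_nonneg hz0.le k)

/-- The average of `c (min k M)` when `k` is Poisson distributed with parameter `u`. -/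
def poisAvg (M : ℕ) (c : ℕ → ℝ) (u : ℝ) : ℝ :=
  ∑ k ∈ Finset.range M, pois k u * c k + poisTail M u * c M

lemma poisAvg_succ (M : ℕ) (c : ℕ → ℝ) (u : ℝ) :
    poisAvg (M + 1) c u = poisAvg M c u + poisTail (M + 1) u * (c (M + 1) - c M) := by
  simp only [poisAvg, Finset.sum_range_succ, poisTail_succ]; ring

lemma hasDerivAt_poisAvg (M : ℕ) (c : ℕ → ℝ) (u : ℝ) :
    HasDerivAt (poisAvg M c) (∑ k ∈ Finset.range M, pois k u * (c (k + 1) - c k)) u := by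
  induction M with
  | zero =>
    have : poisAvg 0 c = fun _ => c 0 := by ext u; simp [poisAvg, poisTail]
    rw [this]
    simpa using hasDerivAt_const u (c 0)
  | succ M ih =>
    have : poisAvg (M + 1) c =
        fun u => poisAvg M c u + poisTail (M + 1) u * (c (M + 1) - c M) := by
      ext u; rw [poisAvg_succ]
    rw [this, Finset.sum_range_succ]
    exact ih.add ((hasDerivAt_poisTail_succ M u).mul_const _)

lemma contDiff_poisAvg (M : ℕ) (c : ℕ → ℝ) {n : WithTop ℕ∞} : ContDiff ℝ n (poisAvg M c) := by
  unfold poisAvg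
  exact (ContDiff.sum fun i _ => (contDiff_pois i).mul contDiff_const).add
    ((contDiff_poisTail M).mul contDiff_const)

lemma poisAvg_zero {M : ℕ} (hM : 0 < M) (c : ℕ → ℝ) : poisAvg M c 0 = c 0 := by
  obtain ⟨m, rfl⟩ := Nat.exists_eq_succ_of_ne_zero hM.ne'
  simp [poisAvg, poisTail_succ_zero, pois_zero_right]

lemma intervalIntegral_pois {R : ℝ} (hR : 0 < R) (k : ℕ) :
    ∫ a in (0 : ℝ)..1, pois k (R * a) = poisTail (k + 1) R / R := by
  have hd : ∀ a ∈ uIcc (0 : ℝ) 1,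
      HasDerivAt (fun a => poisTail (k + 1) (R * a) / R) (pois k (R * a)) a := by
    intro a _
    have := ((hasDerivAt_poisTail_succ k (R * a)).comp a
      ((hasDerivAt_id a).const_mul R)).div_const R
    refine this.congr_deriv ?_
    field_simp
  rw [intervalIntegral.integral_eq_sub_of_hasDerivAt hd
    (((contDiff_pois k (n := 0)).continuous.comp (by fun_prop)).intervalIntegrable _ _)]
  simp [poisTail_succ_zero]

/-! ### Representation of functionals dominated by a quadratic form -/

lemma exists_representing_vector {V E : Type*} [AddCommGroup V] [Module ℝ V]
    [NormedAddCommGroup E] [InnerProductSpace ℝ E] [FiniteDimensional ℝ E]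
    (T : V →ₗ[ℝ] E) (l : V →ₗ[ℝ] ℝ) {S : ℝ} (h : ∀ v, l v ≤ S + 1 / 2 * ‖T v‖ ^ 2) :
    ∃ u : E, ‖u‖ ^ 2 ≤ 2 * S ∧ ∀ v, l v = inner ℝ u (T v) := by
  have hS : 0 ≤ S := by simpa using h 0
  have hsq : ∀ v, l v ^ 2 ≤ 2 * S * ‖T v‖ ^ 2 := by
    intro v
    have hd := discrim_le_zero (a := 1 / 2 * ‖T v‖ ^ 2) (b := -l v) (c := S) fun c => by
      have := h (c • v)
      rw [map_smul, map_smul, norm_smul, smul_eq_mul, mul_pow, Real.norm_eq_abs, sq_abs] at this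
      nlinarith
    rw [discrim] at hd
    linarith
  obtain ⟨g, hg⟩ := T.rangeRestrict.exists_rightInverse_of_surjective
    (LinearMap.range_rangeRestrict T)
  have hgT : ∀ r : LinearMap.range T, T (g r) = r := fun r => by
    have := LinearMap.congr_fun hg r
    exact congrArg Subtype.val this
  have hfac : ∀ v, l v = l (g (T.rangeRestrict v)) := by
    intro v
    have h0 : T (v - g (T.rangeRestrict v)) = 0 := by
      rw [map_sub, hgT]
      simp
    have h1 := hsq (v - g (T.rangeRestrict v))
    rw [h0, norm_zero] at h1
    have h2 : l (v - g (T.rangeRestrict v)) = 0 := by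
      have h3 : l (v - g (T.rangeRestrict v)) ^ 2 ≤ 0 := by simpa using h1
      exact pow_eq_zero_iff two_ne_zero |>.1 (le_antisymm h3 (sq_nonneg _))
    rw [map_sub] at h2
    linarith
  let f : LinearMap.range T →L[ℝ] ℝ := LinearMap.toContinuousLinearMap (l.comp g)
  let r : LinearMap.range T := (InnerProductSpace.toDual ℝ _).symm f
  have hr : ∀ s, inner ℝ r s = l (g s) := fun s => by
    simp only [r, InnerProductSpace.toDual_symm_apply]
    rfl
  have hrepr : ∀ v, l v = inner ℝ (r : E) (T v) := fun v => by
    rw [hfac, ← hr]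
    rfl
  refine ⟨r, ?_, hrepr⟩
  have h1 := hsq (g r)
  rw [hrepr, hgT, real_inner_self_eq_norm_sq] at h1
  rcases (sq_nonneg ‖(r : E)‖).eq_or_lt with h0 | h0
  · rw [← h0]; linarith
  · nlinarith

/-! ### Discretization of the dual problem -/

section Dual

lemma gam_sum_le {Q : X → X → ℝ} (hQ : NonnegRates Q) {ν : X → ℝ} (hν : ∀ x, 0 ≤ ν x)
    {ι : Type*} (s : Finset ι) (p : ι → ℝ) (hp : ∀ i ∈ s, 0 ≤ p i) (hp1 : ∑ i ∈ s, p i ≤ 1)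
    (φ : ι → X → ℝ) :
    gam Q ν (fun x => ∑ i ∈ s, p i * φ i x) ≤ ∑ i ∈ s, p i * gam Q ν (φ i) := by
  have e : ∑ i ∈ s, p i * gam Q ν (φ i) =
      1 / 2 * ∑ x, ∑ y, (∑ i ∈ s, p i * (φ i y - φ i x) ^ 2) * mobility Q ν x y := by
    simp only [gam, Finset.sum_mul, Finset.mul_sum]
    rw [Finset.sum_comm]
    refine Finset.sum_congr rfl fun x _ => ?_
    rw [Finset.sum_comm]
    exact Finset.sum_congr rfl fun y _ => Finset.sum_congr rfl fun i _ => by ring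
  rw [e, gam]
  refine mul_le_mul_of_nonneg_left (Finset.sum_le_sum fun x _ => Finset.sum_le_sum fun y _ => ?_)
    (by norm_num)
  by_cases hxy : x = y
  · simp [hxy]
  refine mul_le_mul_of_nonneg_right ?_ (mobility_nonneg hQ hν hxy)
  rw [← Finset.sum_sub_distrib]
  simp only [← mul_sub]
  have h1 := Finset.sum_sq_le_sum_mul_sum_of_sq_le_mul s (r := fun i => p i * (φ i y - φ i x))
    (f := p) (g := fun i => p i * (φ i y - φ i x) ^ 2) hp
    (fun i hi => mul_nonneg (hp i hi) (sq_nonneg _)) (fun i _ => le_of_eq (by ring))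
  refine h1.trans (mul_le_of_le_one_left (Finset.sum_nonneg fun i hi => ?_) hp1)
  exact mul_nonneg (hp i hi) (sq_nonneg _)

lemma gam_sub_const (Q : X → X → ℝ) (ν φ : X → ℝ) (c : ℝ) :
    gam Q ν (fun x => φ x - c) = gam Q ν φ := by
  simp [gam]

lemma pairing_sub_left (φ ψ σ : X → ℝ) :
    pairing (fun x => φ x - ψ x) σ = pairing φ σ - pairing ψ σ := by
  simp [pairing, sub_mul, Finset.sum_sub_distrib]

lemma pairing_sub_right (φ σ ν : X → ℝ) :
    pairing φ (fun x => σ x - ν x) = pairing φ σ - pairing φ ν := by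
  simp [pairing, mul_sub, Finset.sum_sub_distrib]

lemma pairing_const_left {σ : X → ℝ} (hσ : σ ∈ stdSimplex ℝ X) (c : ℝ) :
    pairing (fun _ => c) σ = c := by
  rw [pairing, ← Finset.mul_sum, hσ.2, mul_one]

lemma pairing_sum_left {ι : Type*} (s : Finset ι) (p : ι → ℝ) (φ : ι → X → ℝ) (σ : X → ℝ) :
    pairing (fun x => ∑ i ∈ s, p i * φ i x) σ = ∑ i ∈ s, p i * pairing (φ i) σ := by
  simp only [pairing, Finset.sum_mul, Finset.mul_sum]
  rw [Finset.sum_comm]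
  exact Finset.sum_congr rfl fun i _ => Finset.sum_congr rfl fun x _ => by ring

variable {Q : ℝ → X → X → ℝ} {π : X → ℝ} {t N S : ℝ} {μ₀ μ₁ : X → ℝ}

/-- Nodal potentials `φ k`, smoothed in time by Poisson weights, yield Hamilton-Jacobi
subsolutions. -/
lemma poisson_dual_value_le (h : IsMarkovTriple (Q t) π)
    (hμ₁ : μ₁ ∈ stdSimplex ℝ X) (hN : 0 < N)
    (hS : ∀ φ, IsHJSubsolution Q t t φ → pairing (φ 1) μ₁ - pairing (φ 0) μ₀ ≤ S)
    {M : ℕ} (hM : 0 < M) (φ : ℕ → X → ℝ) (hφM : φ M = 0) (m : ℕ → ℝ)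
    (hm : ∀ k < M, ∀ ν ∈ stdSimplex ℝ X,
      N * pairing (fun x => φ k x - φ (k + 1) x) ν + 1 / 2 * gam (Q t) ν (φ k) ≤ m k) :
    pairing (φ 0) μ₁ - ∑ k ∈ Finset.range M, pois k N * pairing (φ k) μ₀ -
      ∑ k ∈ Finset.range M, poisTail (k + 1) N / N * m k ≤ S := by
  set c : ℝ → ℝ := fun a => ∑ k ∈ Finset.range M,
    (poisTail (k + 1) N - poisTail (k + 1) (N * (1 - a))) / N * m k with hc
  set Φ : ℝ → X → ℝ := fun a x => poisAvg M (fun k => φ k x) (N * (1 - a)) - c a with hΦ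
  have hlin : ∀ a : ℝ, HasDerivAt (fun a : ℝ => N * (1 - a)) (-N) a := fun a => by
    simpa using ((hasDerivAt_id a).const_sub 1).const_mul N
  have hcd : ∀ a, HasDerivAt c (∑ k ∈ Finset.range M, pois k (N * (1 - a)) * m k) a := by
    intro a
    refine HasDerivAt.fun_sum fun k _ => ?_
    refine (((((hasDerivAt_poisTail_succ k (N * (1 - a))).comp a (hlin a)).const_sub
      (poisTail (k + 1) N)).div_const N).mul_const (m k)).congr_deriv ?_
    field_simp
  have hΦd : ∀ a, HasDerivAt Φ (fun x => N * ∑ k ∈ Finset.range M, pois k (N * (1 - a)) *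
      (φ k x - φ (k + 1) x) - ∑ k ∈ Finset.range M, pois k (N * (1 - a)) * m k) a := by
    intro a
    refine hasDerivAt_pi.2 fun x => ?_
    refine (((hasDerivAt_poisAvg M (fun k => φ k x) (N * (1 - a))).comp a (hlin a)).sub
      (hcd a)).congr_deriv ?_
    congr 1
    rw [mul_comm, neg_mul, ← mul_neg, ← Finset.sum_neg_distrib]
    congr 1
    exact Finset.sum_congr rfl fun k _ => by ring
  have hsmooth : ContDiff ℝ 1 Φ := by
    refine contDiff_pi.2 fun x => ?_
    refine ((contDiff_poisAvg M _).comp (by fun_prop)).sub (ContDiff.sum fun k _ => ?_)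
    refine ContDiff.mul (ContDiff.div_const (contDiff_const.sub ?_) N) contDiff_const
    exact (contDiff_poisTail (k + 1)).comp (by fun_prop)
  have hval : ∀ a x, Φ a x =
      (∑ k ∈ Finset.range M, pois k (N * (1 - a)) * φ k x) - c a := by
    intro a x
    simp [hΦ, poisAvg, hφM]
  have hsub : IsHJSubsolution Q t t Φ := by
    refine ⟨hsmooth.contDiffOn, fun a ha ν hν => ?_⟩
    have hu : 0 ≤ N * (1 - a) := mul_nonneg hN.le (by linarith [ha.2])
    have hit : interp t t a = t := by simp [interp]
    rw [hit, (hΦd a).deriv]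
    have hg : gam (Q t) ν (Φ a) ≤
        ∑ k ∈ Finset.range M, pois k (N * (1 - a)) * gam (Q t) ν (φ k) := by
      have : Φ a = fun x => (∑ k ∈ Finset.range M, pois k (N * (1 - a)) * φ k x) - c a :=
        funext (hval a)
      rw [this, gam_sub_const]
      refine gam_sum_le h.nonnegRates hν.1 _ _ (fun k _ => pois_nonneg k hu) ?_ φ
      have := poisTail_nonneg M hu
      rw [poisTail] at this
      linarith
    have hp : pairing (fun x => N * ∑ k ∈ Finset.range M, pois k (N * (1 - a)) *
        (φ k x - φ (k + 1) x) - ∑ k ∈ Finset.range M, pois k (N * (1 - a)) * m k) ν =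
        ∑ k ∈ Finset.range M, pois k (N * (1 - a)) *
          (N * pairing (fun x => φ k x - φ (k + 1) x) ν - m k) := by
      rw [pairing_sub_left, pairing_const_left hν]
      have : (fun x => N * ∑ k ∈ Finset.range M, pois k (N * (1 - a)) *
          (φ k x - φ (k + 1) x)) = fun x => ∑ k ∈ Finset.range M, (pois k (N * (1 - a)) * N) *
          (φ k x - φ (k + 1) x) := by
        ext x
        rw [Finset.mul_sum]
        exact Finset.sum_congr rfl fun k _ => by ring
      rw [this, pairing_sum_left _ _ (fun k x => φ k x - φ (k + 1) x), ← Finset.sum_sub_distrib]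
      exact Finset.sum_congr rfl fun k _ => by ring
    rw [hp]
    have hle : ∑ k ∈ Finset.range M, pois k (N * (1 - a)) *
          (N * pairing (fun x => φ k x - φ (k + 1) x) ν - m k) +
          1 / 2 * ∑ k ∈ Finset.range M, pois k (N * (1 - a)) * gam (Q t) ν (φ k) ≤ 0 := by
      rw [Finset.mul_sum, ← Finset.sum_add_distrib]
      refine Finset.sum_nonpos fun k hk => ?_
      have h1 := hm k (Finset.mem_range.1 hk) ν hν
      have h2 := pois_nonneg k hu
      have h3 := mul_le_mul_of_nonneg_left h1 h2
      linarith
    linarith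
  have hfin := hS Φ hsub
  have h1 : Φ 1 = fun x => φ 0 x - c 1 := by
    ext x
    simp only [hΦ, sub_self, mul_zero, poisAvg_zero hM]
  have hc0 : c 0 = 0 := by simp [hc]
  have hc1 : c 1 = ∑ k ∈ Finset.range M, poisTail (k + 1) N / N * m k := by
    simp [hc, poisTail_succ_zero]
  have h0 : Φ 0 = fun x => ∑ k ∈ Finset.range M, pois k N * φ k x := by
    ext x
    rw [hval, hc0]
    simp
  rw [h1, h0, pairing_sub_left, pairing_const_left hμ₁, pairing_sum_left, hc1] at hfin
  linarith

/-- The Lagrangian of the discretized dual problem. -/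
def dualLagrangian (Q : X → X → ℝ) (N : ℝ) (μ₀ μ₁ : X → ℝ) (M : ℕ) (ν φ : ℕ → X → ℝ) : ℝ :=
  pairing (φ 0) μ₁ - ∑ k ∈ Finset.range M, pois k N * pairing (φ k) μ₀ -
    ∑ k ∈ Finset.range M, poisTail (k + 1) N / N *
      (N * pairing (fun x => φ k x - (if k + 1 < M then φ (k + 1) x else 0)) (ν k) +
        1 / 2 * gam Q (ν k) (φ k))

lemma convexOn_neg_gam {Q : X → X → ℝ} (hQ : NonnegRates Q) (ψ : X → ℝ) {c d : ℝ} (hc : 0 ≤ c)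
    (hd : 0 ≤ d) {ν ν' : X → ℝ} (hν : ∀ x, 0 ≤ ν x) (hν' : ∀ x, 0 ≤ ν' x) :
    c * gam Q ν ψ + d * gam Q ν' ψ ≤ gam Q (c • ν + d • ν') ψ := by
  rw [← gam_smul_left hQ hν hc, ← gam_smul_left hQ hν' hd]
  exact gam_superadd hQ (fun x => mul_nonneg hc (hν x)) (fun x => mul_nonneg hd (hν' x)) ψ

lemma gam_convex_right {Q : X → X → ℝ} (hQ : NonnegRates Q) {ν : X → ℝ} (hν : ∀ x, 0 ≤ ν x)
    {c d : ℝ} (hc : 0 ≤ c) (hd : 0 ≤ d) (hcd : c + d = 1) (φ φ' : X → ℝ) :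
    gam Q ν (c • φ + d • φ') ≤ c * gam Q ν φ + d * gam Q ν φ' := by
  have := gam_sum_le hQ hν (Finset.univ : Finset (Fin 2)) ![c, d]
    (fun i _ => by fin_cases i <;> simpa) (by simp [Fin.sum_univ_two, hcd]) ![φ, φ']
  have e : c • φ + d • φ' = fun x => c * φ x + d * φ' x := rfl
  rw [e]
  simpa [Fin.sum_univ_two] using this

lemma pairing_add_smul_left (c d : ℝ) (φ ψ σ : X → ℝ) :
    pairing (c • φ + d • ψ) σ = c * pairing φ σ + d * pairing ψ σ := by
  simp only [pairing, Pi.add_apply, Pi.smul_apply, smul_eq_mul, Finset.mul_sum,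
    ← Finset.sum_add_distrib]
  exact Finset.sum_congr rfl fun x _ => by ring

lemma pairing_add_smul_right (c d : ℝ) (φ σ ν : X → ℝ) :
    pairing φ (c • σ + d • ν) = c * pairing φ σ + d * pairing φ ν := by
  simp only [pairing, Pi.add_apply, Pi.smul_apply, smul_eq_mul, Finset.mul_sum,
    ← Finset.sum_add_distrib]
  exact Finset.sum_congr rfl fun x _ => by ring

lemma dualLagrangian_convex {Q : X → X → ℝ} (hQ : NonnegRates Q) (hN : 0 < N) (M : ℕ)
    (φ : ℕ → X → ℝ) :
    ConvexOn ℝ (Set.pi univ fun _ : ℕ => stdSimplex ℝ X)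
      fun ν => dualLagrangian Q N μ₀ μ₁ M ν φ := by
  refine ⟨convex_pi fun _ _ => convex_stdSimplex ℝ X, fun ν hν ν' hν' c d hc hd hcd => ?_⟩
  have key : ∑ k ∈ Finset.range M, poisTail (k + 1) N / N *
      (c * (N * pairing (fun x => φ k x - (if k + 1 < M then φ (k + 1) x else 0)) (ν k) +
        1 / 2 * gam Q (ν k) (φ k)) +
       d * (N * pairing (fun x => φ k x - (if k + 1 < M then φ (k + 1) x else 0)) (ν' k) +
        1 / 2 * gam Q (ν' k) (φ k))) ≤ ∑ k ∈ Finset.range M, poisTail (k + 1) N / N *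
      (N * pairing (fun x => φ k x - (if k + 1 < M then φ (k + 1) x else 0))
        ((c • ν + d • ν') k) + 1 / 2 * gam Q ((c • ν + d • ν') k) (φ k)) := by
    refine Finset.sum_le_sum fun k _ => ?_
    refine mul_le_mul_of_nonneg_left ?_ (div_nonneg (poisTail_nonneg _ hN.le) hN.le)
    have h1 := convexOn_neg_gam hQ (φ k) hc hd (hν k trivial).1 (hν' k trivial).1
    simp only [Pi.add_apply, Pi.smul_apply, pairing_add_smul_right]
    linarith
  simp only [mul_add (poisTail _ _ / _), Finset.sum_add_distrib, mul_left_comm (_ / _) c,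
    mul_left_comm (_ / _) d, ← Finset.mul_sum] at key
  simp only [dualLagrangian, smul_eq_mul, mul_add (poisTail _ _ / _), Finset.sum_add_distrib]
  have e : d = 1 - c := by linarith
  subst e
  linarith

lemma dualLagrangian_concave {Q : X → X → ℝ} (hQ : NonnegRates Q) (hN : 0 < N) (M : ℕ)
    {ν : ℕ → X → ℝ} (hν : ∀ k x, 0 ≤ ν k x) :
    ConcaveOn ℝ univ fun φ => dualLagrangian Q N μ₀ μ₁ M ν φ := by
  refine ⟨convex_univ, fun φ _ φ' _ c d hc hd hcd => ?_⟩
  have key : ∑ k ∈ Finset.range M, poisTail (k + 1) N / N *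
      (N * pairing (fun x => (c • φ + d • φ') k x -
        (if k + 1 < M then (c • φ + d • φ') (k + 1) x else 0)) (ν k) +
        1 / 2 * gam Q (ν k) ((c • φ + d • φ') k)) ≤
      ∑ k ∈ Finset.range M, poisTail (k + 1) N / N *
      (c * (N * pairing (fun x => φ k x - (if k + 1 < M then φ (k + 1) x else 0)) (ν k) +
        1 / 2 * gam Q (ν k) (φ k)) +
       d * (N * pairing (fun x => φ' k x - (if k + 1 < M then φ' (k + 1) x else 0)) (ν k) +
        1 / 2 * gam Q (ν k) (φ' k))) := by
    refine Finset.sum_le_sum fun k _ => ?_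
    refine mul_le_mul_of_nonneg_left ?_ (div_nonneg (poisTail_nonneg _ hN.le) hN.le)
    have h1 := gam_convex_right hQ (hν k) hc hd hcd (φ k) (φ' k)
    have h2 : (fun x => (c • φ + d • φ') k x -
        (if k + 1 < M then (c • φ + d • φ') (k + 1) x else 0)) =
        c • (fun x => φ k x - (if k + 1 < M then φ (k + 1) x else 0)) +
        d • (fun x => φ' k x - (if k + 1 < M then φ' (k + 1) x else 0)) := by
      ext x
      split_ifs <;> (simp; try ring)
    rw [h2, pairing_add_smul_left]
    simp only [Pi.add_apply, Pi.smul_apply]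
    linarith
  simp only [mul_add (poisTail _ _ / _), Finset.sum_add_distrib, mul_left_comm (_ / _) c,
    mul_left_comm (_ / _) d, ← Finset.mul_sum] at key
  have h3 : ∑ k ∈ Finset.range M, pois k N * pairing ((c • φ + d • φ') k) μ₀ =
      c * ∑ k ∈ Finset.range M, pois k N * pairing (φ k) μ₀ +
      d * ∑ k ∈ Finset.range M, pois k N * pairing (φ' k) μ₀ := by
    simp only [Pi.add_apply, Pi.smul_apply, pairing_add_smul_left, mul_add,
      Finset.sum_add_distrib, mul_left_comm (pois _ _), ← Finset.mul_sum]
  have h4 : pairing ((c • φ + d • φ') 0) μ₁ = c * pairing (φ 0) μ₁ + d * pairing (φ' 0) μ₁ :=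
    pairing_add_smul_left c d (φ 0) (φ' 0) μ₁
  simp only [dualLagrangian, smul_eq_mul, mul_add (poisTail _ _ / _), Finset.sum_add_distrib]
  rw [h3, h4]
  linarith

lemma continuous_pairing_left {Y : Type*} [TopologicalSpace Y] {f : Y → X → ℝ}
    (hf : Continuous f) (σ : X → ℝ) : Continuous fun y => pairing (f y) σ :=
  continuous_finsetSum _ fun x _ => ((continuous_apply x).comp hf).mul continuous_const

lemma continuous_gam_right (Q : X → X → ℝ) (ν : X → ℝ) : Continuous fun ψ => gam Q ν ψ := by
  unfold gam
  refine continuous_const.mul (continuous_finsetSum _ fun x _ => continuous_finsetSum _ fun y _ =>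
    ?_)
  fun_prop

lemma continuous_dualLagrangian_right (Q : X → X → ℝ) (M : ℕ) (ν : ℕ → X → ℝ) :
    Continuous fun φ => dualLagrangian Q N μ₀ μ₁ M ν φ := by
  unfold dualLagrangian
  refine ((continuous_pairing_left (continuous_apply 0) _).sub (continuous_finsetSum _ fun k _ =>
    continuous_const.mul (continuous_pairing_left (continuous_apply k) _))).sub
    (continuous_finsetSum _ fun k _ => continuous_const.mul ((continuous_const.mul
      (continuous_pairing_left ?_ _)).add (continuous_const.mul
      ((continuous_gam_right Q (ν k)).comp (continuous_apply k)))))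
  refine continuous_pi fun x => ?_
  split_ifs <;> fun_prop

lemma continuousOn_dualLagrangian_left {Q : X → X → ℝ} (hQ : NonnegRates Q) (M : ℕ)
    (φ : ℕ → X → ℝ) :
    ContinuousOn (fun ν => dualLagrangian Q N μ₀ μ₁ M ν φ)
      (Set.pi univ fun _ : ℕ => stdSimplex ℝ X) := by
  unfold dualLagrangian
  refine continuousOn_const.sub (continuousOn_finsetSum _ fun k _ => continuousOn_const.mul
    ((continuousOn_const.mul ?_).add (continuousOn_const.mul ?_)))
  · unfold pairing
    exact Continuous.continuousOn (by fun_prop)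
  · exact (continuousOn_gam hQ (φ k)).comp (continuous_apply k).continuousOn
      fun ν hν => (hν k trivial).1

/-- A minimax statement: if every `φ` admits some `ν` in the compact convex set `K` with
`f ν φ ≤ S`, then some `ν` works for all `φ`. -/
lemma exists_forall_le_of_minimax {E F : Type*} [TopologicalSpace E] [AddCommGroup E] [Module ℝ E]
    [IsTopologicalAddGroup E] [ContinuousSMul ℝ E] [TopologicalSpace F] [AddCommGroup F]
    [Module ℝ F] [IsTopologicalAddGroup F] [ContinuousSMul ℝ F] {K : Set E} (hne : K.Nonempty)
    (hK : IsCompact K) (hKc : Convex ℝ K) {f : E → F → ℝ}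
    (hf1 : ∀ y, ContinuousOn (fun x => f x y) K) (hf2 : ∀ y, ConvexOn ℝ K fun x => f x y)
    (hf3 : ∀ x ∈ K, Continuous fun y => f x y) (hf4 : ∀ x ∈ K, ConcaveOn ℝ univ fun y => f x y)
    {S : ℝ} (h : ∀ y, ∃ x ∈ K, f x y ≤ S) : ∃ x ∈ K, ∀ y, f x y ≤ S := by
  by_contra hcon
  push Not at hcon
  have hlsc : ∀ y ∈ (univ : Set F), LowerSemicontinuousOn (fun x => f x y) K := fun y _ =>
    (hf1 y).lowerSemicontinuousOn
  have hfin : ∃ s : Finset (univ : Set F), ∀ x ∈ K, ∃ i ∈ s, S < f x i := by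
    rw [← LowerSemicontinuousOn.inter_biInter_preimage_Iic_eq_empty_iff_exists_finset hK hlsc]
    refine Set.eq_empty_of_forall_notMem ?_
    rintro x ⟨hx, hx'⟩
    simp only [mem_iInter, mem_preimage, mem_Iic] at hx'
    obtain ⟨y, hy⟩ := hcon x hx
    exact absurd (hx' y trivial) (not_le.2 hy)
  obtain ⟨s, hs⟩ := hfin
  obtain ⟨y, _, hy⟩ := Sion.exists_lt_iInf_of_lt_iInf_of_finite (Y := univ) (f := f) hne hK hlsc
    (fun y _ => (hf2 y).quasiconvexOn) convex_univ
    (fun x hx => (hf3 x hx).continuousOn.upperSemicontinuousOn)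
    (fun x hx => (hf4 x hx).quasiconcaveOn) hKc
    (s := Subtype.val '' (s : Set (univ : Set F))) (t := S) (toFinite _) (subset_univ _)
    (fun x hx => by
      obtain ⟨i, hi, hlt⟩ := hs x hx
      exact ⟨i, ⟨i, hi, rfl⟩, hlt⟩)
  obtain ⟨x, hx, hle⟩ := h y
  exact absurd (hy x hx) (not_lt.2 hle)

lemma exists_dualLagrangian_le (h : IsMarkovTriple (Q t) π) (hμ₀ : μ₀ ∈ stdSimplex ℝ X)
    (hμ₁ : μ₁ ∈ stdSimplex ℝ X) (hN : 0 < N)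
    (hS : ∀ φ, IsHJSubsolution Q t t φ → pairing (φ 1) μ₁ - pairing (φ 0) μ₀ ≤ S)
    {M : ℕ} (hM : 0 < M) :
    ∃ ν : ℕ → X → ℝ, (∀ k, ν k ∈ stdSimplex ℝ X) ∧
      ∀ φ, dualLagrangian (Q t) N μ₀ μ₁ M ν φ ≤ S := by
  obtain ⟨ν, hν, hle⟩ := exists_forall_le_of_minimax
    (K := Set.pi univ fun _ : ℕ => stdSimplex ℝ X) (f := dualLagrangian (Q t) N μ₀ μ₁ M) (S := S)
    ⟨fun _ => μ₀, fun _ _ => hμ₀⟩ (isCompact_univ_pi fun _ => isCompact_stdSimplex ℝ X)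
    (convex_pi fun _ _ => convex_stdSimplex ℝ X)
    (continuousOn_dualLagrangian_left h.nonnegRates M)
    (dualLagrangian_convex h.nonnegRates hN M)
    (fun ν _ => continuous_dualLagrangian_right (Q t) M ν)
    (fun ν hν => dualLagrangian_concave h.nonnegRates hN M fun k => (hν k trivial).1)
    (fun φ => by
      set φ' : ℕ → X → ℝ := fun k => if k < M then φ k else 0 with hφ'
      have hmax : ∀ k, ∃ ν ∈ stdSimplex ℝ X, IsMaxOn (fun ν =>
          N * pairing (fun x => φ' k x - φ' (k + 1) x) ν + 1 / 2 * gam (Q t) ν (φ' k))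
          (stdSimplex ℝ X) ν := fun k => by
        refine (isCompact_stdSimplex ℝ X).exists_isMaxOn ⟨μ₀, hμ₀⟩ (ContinuousOn.add ?_ ?_)
        · unfold pairing
          exact Continuous.continuousOn (by fun_prop)
        · exact continuousOn_const.mul ((continuousOn_gam h.nonnegRates _).mono fun ν hν => hν.1)
      choose ν hν hνmax using hmax
      refine ⟨ν, fun k _ => hν k, ?_⟩
      have := poisson_dual_value_le h hμ₁ hN hS hM φ' (by simp [hφ']) _
        (fun k _ ν hν => hνmax k hν)
      refine le_trans (le_of_eq ?_) this
      simp only [dualLagrangian]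
      have e0 : φ' 0 = φ 0 := by simp [hφ', hM]
      rw [e0]
      congr 1
      · congr 1
        refine Finset.sum_congr rfl fun k hk => ?_
        simp [hφ', Finset.mem_range.1 hk]
      · refine Finset.sum_congr rfl fun k hk => ?_
        have e1 : φ' k = φ k := by simp [hφ', Finset.mem_range.1 hk]
        rw [e1]
        congr 4
        ext x
        simp only [hφ']
        split_ifs <;> rfl)
  exact ⟨ν, fun k => hν k trivial, hle⟩

end Dual

/-! ### Recovering curves from the discretized dual problem -/

/-- A chain of measures joined by momenta gives a curve whose action is controlled by the actions
of the links. -/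
lemma transportDist_poisAvg_le {Q : X → X → ℝ} (hQ : NonnegRates Q) {M : ℕ} (hM : 0 < M)
    {ζ : ℕ → X → ℝ} (hζ : ∀ j, ζ j ∈ stdSimplex ℝ X) {W c : ℕ → X → X → ℝ}
    (hc : ∀ j x y, 0 ≤ c j x y)
    (hdiv : ∀ j < M, ∀ x, ζ (j + 1) x - ζ j x = -divg (W j) x)
    (hW : ∀ j < M, ∀ x y, x ≠ y → W j x y ^ 2 ≤ c j x y * mobility Q (ζ j) x y)
    {K : ℝ} (hK : ∑ j ∈ Finset.range M, 1 / 2 * ∑ x, ∑ y, c j x y ≤ K) {R : ℝ} (hR : 0 < R) :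
    transportDist Q (ζ 0) (fun x => poisAvg M (fun j => ζ j x) R) ≤ ENNReal.ofReal √(R * K) := by
  have hK0 : 0 ≤ K := le_trans (Finset.sum_nonneg fun j _ => mul_nonneg (by norm_num)
    (Finset.sum_nonneg fun x _ => Finset.sum_nonneg fun y _ => hc j x y)) hK
  set ν : ℝ → X → ℝ := fun a x => poisAvg M (fun j => ζ j x) (R * a) with hν
  set V : ℝ → X → X → ℝ := fun a x y => R * ∑ j ∈ Finset.range M, pois j (R * a) * W j x y with hV
  have hpc : ∀ j, Continuous fun a : ℝ => pois j (R * a) := fun j =>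
    (contDiff_pois j (n := 0)).continuous.comp (by fun_prop)
  have hmem : ∀ a ∈ Icc (0 : ℝ) 1, ν a ∈ stdSimplex ℝ X := by
    intro a ha
    have hu : 0 ≤ R * a := mul_nonneg hR.le ha.1
    refine ⟨fun x => add_nonneg (Finset.sum_nonneg fun k _ => mul_nonneg (pois_nonneg k hu)
      ((hζ k).1 x)) (mul_nonneg (poisTail_nonneg M hu) ((hζ M).1 x)), ?_⟩
    simp only [hν, poisAvg, Finset.sum_add_distrib]
    rw [Finset.sum_comm]
    simp only [← Finset.mul_sum, (hζ _).2, mul_one]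
    rw [poisTail]; ring
  have hder : ∀ a x, HasDerivAt (fun a => ν a x) (-divg (V a) x) a := by
    intro a x
    refine ((hasDerivAt_poisAvg M (fun j => ζ j x) (R * a)).comp a
      ((hasDerivAt_id a).const_mul R)).congr_deriv ?_
    have h1 : ∀ k ∈ Finset.range M, pois k (R * a) * (ζ (k + 1) x - ζ k x) =
        pois k (R * a) * -divg (W k) x := fun k hk => by
      rw [hdiv k (Finset.mem_range.1 hk)]
    rw [Finset.sum_congr rfl h1, hV, divg_smul R fun x y => ∑ j ∈ Finset.range M,
      pois j (R * a) * W j x y]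
    have h2 : divg (fun x y => ∑ j ∈ Finset.range M, pois j (R * a) * W j x y) x =
        ∑ j ∈ Finset.range M, pois j (R * a) * divg (W j) x := by
      simp only [divg, ← Finset.sum_sub_distrib, ← mul_sub, Finset.mul_sum]
      rw [Finset.sum_comm]
      exact Finset.sum_congr rfl fun k _ => Finset.sum_congr rfl fun y _ => by ring
    rw [h2]
    simp only [mul_neg, Finset.sum_neg_distrib]
    ring
  have hCE := ContinuityEq.of_hasDerivAt hmem (fun x y => by
    simp only [hV]
    exact continuous_const.mul (continuous_finsetSum _ fun j _ => (hpc j).mul continuous_const))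
    hder
  have h0 : ν 0 = ζ 0 := by
    ext x
    simp only [hν, mul_zero, poisAvg_zero hM]
  have h1 : ν 1 = fun x => poisAvg M (fun j => ζ j x) R := by
    simp only [hν, mul_one]
  rw [h0, h1] at hCE
  set g : ℝ → ℝ := fun a => R ^ 2 * ∑ j ∈ Finset.range M,
    pois j (R * a) * (1 / 2 * ∑ x, ∑ y, c j x y) with hg
  have hact : ∀ a ∈ Icc (0 : ℝ) 1, action Q (ν a) (V a) ≤ ENNReal.ofReal (g a) := by
    intro a ha
    have hu : 0 ≤ R * a := mul_nonneg hR.le ha.1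
    have hle := action_le hQ (hmem a ha).1 (V := V a)
      (c := fun x y => R ^ 2 * ∑ j ∈ Finset.range M, pois j (R * a) * c j x y)
      (fun x y => mul_nonneg (sq_nonneg _) (Finset.sum_nonneg fun j _ =>
        mul_nonneg (pois_nonneg j hu) (hc j x y))) fun x y hxy => by
        have hmob : ∑ j ∈ Finset.range M, pois j (R * a) * mobility Q (ζ j) x y ≤
            mobility Q (ν a) x y := by
          refine (mobility_sum hQ _ _ (fun j _ => pois_nonneg j hu) ζ
            (fun j _ => (hζ j).1) hxy).trans (mobility_mono hQ (fun z => ?_) (fun z => ?_) hxy)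
          · exact Finset.sum_nonneg fun j _ => mul_nonneg (pois_nonneg j hu) ((hζ j).1 z)
          · exact le_add_of_nonneg_right (mul_nonneg (poisTail_nonneg M hu) ((hζ M).1 z))
        have hcs := Finset.sum_sq_le_sum_mul_sum_of_sq_le_mul (Finset.range M)
          (r := fun j => pois j (R * a) * W j x y) (f := fun j => pois j (R * a) * c j x y)
          (g := fun j => pois j (R * a) * mobility Q (ζ j) x y)
          (fun j _ => mul_nonneg (pois_nonneg j hu) (hc j x y))
          (fun j _ => mul_nonneg (pois_nonneg j hu) (mobility_nonneg hQ (hζ j).1 hxy))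
          (fun j hj => by
            have := mul_le_mul_of_nonneg_left (hW j (Finset.mem_range.1 hj) x y hxy)
              (sq_nonneg (pois j (R * a)))
            linarith)
        simp only [hV, mul_pow]
        rw [mul_assoc]
        refine mul_le_mul_of_nonneg_left (hcs.trans (mul_le_mul_of_nonneg_left hmob ?_))
          (sq_nonneg _)
        exact Finset.sum_nonneg fun j _ => mul_nonneg (pois_nonneg j hu) (hc j x y)
    refine hle.trans (le_of_eq (congrArg _ ?_))
    simp only [hg, ← Finset.mul_sum]
    rw [mul_left_comm]
    congr 1
    have : ∑ x, ∑ y, ∑ j ∈ Finset.range M, pois j (R * a) * c j x y =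
        ∑ j ∈ Finset.range M, pois j (R * a) * ∑ x, ∑ y, c j x y := by
      simp only [Finset.mul_sum]
      rw [Finset.sum_comm (s := Finset.range M)]
      exact Finset.sum_congr rfl fun x _ => Finset.sum_comm
    rw [this, Finset.mul_sum]
    exact Finset.sum_congr rfl fun j _ => by ring
  have hgc : Continuous g := continuous_const.mul (continuous_finsetSum _ fun j _ =>
    (hpc j).mul continuous_const)
  have hg0 : ∀ a ∈ Icc (0 : ℝ) 1, 0 ≤ g a := fun a ha => mul_nonneg (sq_nonneg _)
    (Finset.sum_nonneg fun j _ => mul_nonneg (pois_nonneg j (mul_nonneg hR.le ha.1))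
      (mul_nonneg (by norm_num)
        (Finset.sum_nonneg fun x _ => Finset.sum_nonneg fun y _ => hc j x y)))
  have hint : ∫ a in (0 : ℝ)..1, g a ≤ R * K := by
    simp only [hg, intervalIntegral.integral_const_mul]
    rw [intervalIntegral.integral_finsetSum fun j _ =>
      ((hpc j).intervalIntegrable 0 1).mul_const (1 / 2 * ∑ x, ∑ y, c j x y)]
    simp only [intervalIntegral.integral_mul_const, intervalIntegral_pois hR]
    have h2 : ∑ j ∈ Finset.range M, poisTail (j + 1) R / R * (1 / 2 * ∑ x, ∑ y, c j x y) ≤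
        ∑ j ∈ Finset.range M, 1 / R * (1 / 2 * ∑ x, ∑ y, c j x y) := by
      refine Finset.sum_le_sum fun j _ => mul_le_mul_of_nonneg_right ?_ (mul_nonneg (by norm_num)
        (Finset.sum_nonneg fun x _ => Finset.sum_nonneg fun y _ => hc j x y))
      exact div_le_div_of_nonneg_right (poisTail_le_one _ hR.le) hR.le
    rw [← Finset.mul_sum] at h2
    refine (mul_le_mul_of_nonneg_left (h2.trans (mul_le_mul_of_nonneg_left hK
      (by positivity))) (sq_nonneg R)).trans (le_of_eq ?_)
    field_simp
  refine le_of_sq_le_sq_ennreal ((transportDist_sq_le hCE).trans ?_)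
  rw [← ENNReal.ofReal_pow (Real.sqrt_nonneg _), Real.sq_sqrt (mul_nonneg hR.le hK0)]
  refine (setLIntegral_mono' measurableSet_Icc hact).trans ?_
  rw [← ofReal_integral_eq_lintegral_ofReal hgc.continuousOn.integrableOn_Icc
    (ae_restrict_of_forall_mem measurableSet_Icc hg0), integral_Icc_eq_integral_Ioc,
    ← intervalIntegral.integral_of_le zero_le_one]
  exact ENNReal.ofReal_le_ofReal hint

/-- A bound for the functional `φ ↦ ∑ ⟨φ_j, ζ_{j+1} - ζ_j⟩` by the quadratic forms `Γ(ζ_j, φ_j)`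
produces momenta along the chain `ζ`. -/
lemma exists_momentum_of_le {Q : X → X → ℝ} (hQ : NonnegRates Q) {M : ℕ}
    {ζ : ℕ → X → ℝ} (hζ : ∀ j, ζ j ∈ stdSimplex ℝ X) {N S : ℝ} (hN : 0 < N)
    (h : ∀ φ : ℕ → X → ℝ, ∑ j ∈ Finset.range M, pairing (φ j) (fun x => ζ (j + 1) x - ζ j x) ≤
      S + 1 / (2 * N) * ∑ j ∈ Finset.range M, gam Q (ζ j) (φ j)) :
    ∃ W c : ℕ → X → X → ℝ, (∀ j x y, 0 ≤ c j x y) ∧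
      (∀ j < M, ∀ x, ζ (j + 1) x - ζ j x = -divg (W j) x) ∧
      (∀ j < M, ∀ x y, x ≠ y → W j x y ^ 2 ≤ c j x y * mobility Q (ζ j) x y) ∧
      ∑ j ∈ Finset.range M, 1 / 2 * ∑ x, ∑ y, c j x y ≤ 2 * S / N := by
  classical
  set b : Fin M → X → X → ℝ := fun k x y => √(mobility Q (ζ k) x y / (2 * N)) with hb
  let T : (ℕ → X → ℝ) →ₗ[ℝ] EuclideanSpace ℝ (Fin M × X × X) :=
    { toFun := fun φ => WithLp.toLp 2 fun i => b i.1 i.2.1 i.2.2 * (φ i.1 i.2.2 - φ i.1 i.2.1)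
      map_add' := fun φ ψ => by
        ext i
        simp only [Pi.add_apply, PiLp.add_apply]
        ring
      map_smul' := fun r φ => by
        ext i
        simp only [Pi.smul_apply, PiLp.smul_apply, smul_eq_mul, RingHom.id_apply]
        ring }
  let l : (ℕ → X → ℝ) →ₗ[ℝ] ℝ :=
    { toFun := fun φ => ∑ j ∈ Finset.range M, pairing (φ j) (fun x => ζ (j + 1) x - ζ j x)
      map_add' := fun φ ψ => by
        simp [pairing, add_mul, Finset.sum_add_distrib]
      map_smul' := fun r φ => by
        simp [pairing, mul_assoc, Finset.mul_sum] }
  have hTapp : ∀ φ i, T φ i = b i.1 i.2.1 i.2.2 * (φ i.1 i.2.2 - φ i.1 i.2.1) := fun _ _ => rfl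
  have hTn : ∀ φ, 1 / 2 * ‖T φ‖ ^ 2 =
      1 / (2 * N) * ∑ j ∈ Finset.range M, gam Q (ζ j) (φ j) := by
    intro φ
    rw [EuclideanSpace.norm_sq_eq, Fintype.sum_prod_type, ← Fin.sum_univ_eq_sum_range
      (fun j => gam Q (ζ j) (φ j)), Finset.mul_sum, Finset.mul_sum]
    refine Finset.sum_congr rfl fun k _ => ?_
    rw [Fintype.sum_prod_type, gam, ← mul_assoc, mul_comm (1 / (2 * N)), mul_assoc]
    congr 1
    rw [Finset.mul_sum]
    refine Finset.sum_congr rfl fun x _ => ?_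
    rw [Finset.mul_sum]
    refine Finset.sum_congr rfl fun y _ => ?_
    rw [hTapp, Real.norm_eq_abs, sq_abs, mul_pow]
    by_cases hxy : x = y
    · simp [hxy]
    simp only [hb]
    rw [Real.sq_sqrt (div_nonneg (mobility_nonneg hQ (hζ k).1 hxy) (by positivity))]
    ring
  obtain ⟨u, hu, hrep⟩ := exists_representing_vector T l (S := S) fun φ => by
    rw [hTn]; exact h φ
  refine ⟨fun j x y => if hj : j < M then 2 * u (⟨j, hj⟩, x, y) * b ⟨j, hj⟩ x y else 0,
    fun j x y => if hj : j < M then 2 / N * u (⟨j, hj⟩, x, y) ^ 2 else 0, ?_, ?_, ?_, ?_⟩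
  · intro j x y
    beta_reduce
    split_ifs <;> positivity
  · intro j hj x
    have := hrep (Pi.single j (Pi.single x 1))
    have e1 : l (Pi.single j (Pi.single x 1)) = ζ (j + 1) x - ζ j x := by
      change ∑ i ∈ Finset.range M, pairing ((Pi.single j (Pi.single x 1) : ℕ → X → ℝ) i)
        (fun x => ζ (i + 1) x - ζ i x) = _
      rw [Finset.sum_eq_single j]
      · simp [pairing, Pi.single_apply]
      · intro i _ hij
        simp [pairing, Pi.single_eq_of_ne hij]
      · intro hn
        exact absurd (Finset.mem_range.2 hj) hn
    rw [← e1, this, PiLp.inner_apply, Fintype.sum_prod_type,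
      Finset.sum_eq_single (⟨j, hj⟩ : Fin M)]
    · rw [Fintype.sum_prod_type]
      simp only [hTapp, Pi.single_eq_same, divg, dif_pos hj, RCLike.inner_apply, conj_trivial]
      simp only [Pi.single_apply, mul_sub, sub_mul, Finset.sum_sub_distrib, mul_ite, ite_mul,
        mul_one, mul_zero, zero_mul, Finset.sum_ite_irrel, Finset.sum_const_zero,
        Finset.sum_ite_eq', Finset.mem_univ, if_true, Finset.mul_sum]
      rw [neg_sub]
      congr 1 <;> exact Finset.sum_congr rfl fun y _ => by ring
    · intro k _ hk
      have hk' : (k : ℕ) ≠ j := fun hkj => hk (Fin.ext hkj)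
      refine Finset.sum_eq_zero fun i _ => ?_
      rw [hTapp]
      simp [Pi.single_eq_of_ne hk']
    · simp
  · intro j hj x y hxy
    simp only [dif_pos hj, mul_pow, hb]
    rw [Real.sq_sqrt (div_nonneg (mobility_nonneg hQ (hζ j).1 hxy) (by positivity))]
    refine le_of_eq ?_
    field_simp
  · rw [← Fin.sum_univ_eq_sum_range]
    rw [EuclideanSpace.norm_sq_eq, Fintype.sum_prod_type] at hu
    simp only [Fintype.sum_prod_type, Real.norm_eq_abs, sq_abs] at hu
    simp only [Fin.is_lt, dif_pos, Fin.eta, ← Finset.mul_sum]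
    rw [← mul_assoc]
    have := mul_le_mul_of_nonneg_left hu (show 0 ≤ 1 / 2 * (2 / N) by positivity)
    refine this.trans (le_of_eq ?_)
    field_simp

lemma sum_pairing_chain (M : ℕ) (q p : ℕ → ℝ) (hp0 : p 0 = 1 - q 0)
    (hp : ∀ k, p (k + 1) = q k - q (k + 1)) (A B c : ℕ → ℝ) (d : ℝ) :
    d + ∑ k ∈ Finset.range M, (q k * B k + (1 - q k) * c (k + 1)) -
      ∑ k ∈ Finset.range (M + 1), (q k * A k + (1 - q k) * c k) =
    d - ∑ k ∈ Finset.range (M + 1), p k * c k -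
      (∑ k ∈ Finset.range (M + 1), q k * A k - ∑ k ∈ Finset.range M, q k * B k) := by
  induction M with
  | zero => simp [hp0]; ring
  | succ M ih =>
    rw [Finset.sum_range_succ _ (M + 1), Finset.sum_range_succ _ (M + 1),
      Finset.sum_range_succ _ (M + 1), Finset.sum_range_succ _ M,
      Finset.sum_range_succ (fun k => q k * B k) M, hp]
    linarith

/-- The chain of measures `μ₁, η 0, η 1, …` extracted from a saddle point. -/
def dualChain (N : ℝ) (μ₀ μ₁ : X → ℝ) (ν : ℕ → X → ℝ) : ℕ → X → ℝ
  | 0 => μ₁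
  | k + 1 => fun x => (1 - poisTail (k + 1) N) * μ₀ x + poisTail (k + 1) N * ν k x

lemma pairing_dualChain_succ (N : ℝ) (μ₀ μ₁ : X → ℝ) (ν : ℕ → X → ℝ) (k : ℕ) (φ : X → ℝ) :
    pairing φ (dualChain N μ₀ μ₁ ν (k + 1)) =
      poisTail (k + 1) N * pairing φ (ν k) + (1 - poisTail (k + 1) N) * pairing φ μ₀ := by
  simp only [pairing, dualChain, Finset.mul_sum, ← Finset.sum_add_distrib]
  exact Finset.sum_congr rfl fun x _ => by ring

lemma dualChain_mem {N : ℝ} (hN : 0 ≤ N) {μ₀ μ₁ : X → ℝ} (hμ₀ : μ₀ ∈ stdSimplex ℝ X)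
    (hμ₁ : μ₁ ∈ stdSimplex ℝ X) {ν : ℕ → X → ℝ} (hν : ∀ k, ν k ∈ stdSimplex ℝ X) (k : ℕ) :
    dualChain N μ₀ μ₁ ν k ∈ stdSimplex ℝ X := by
  cases k with
  | zero => exact hμ₁
  | succ k =>
    exact convexComb_mem_stdSimplex hμ₀ (hν k) ⟨poisTail_nonneg _ hN, poisTail_le_one _ hN⟩

lemma sum_pairing_dualChain_le {Q : X → X → ℝ} (hQ : NonnegRates Q) {N S : ℝ} (hN : 0 < N)
    {μ₀ μ₁ : X → ℝ} (hμ₀ : μ₀ ∈ stdSimplex ℝ X)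
    {ν : ℕ → X → ℝ} (hν : ∀ k, ν k ∈ stdSimplex ℝ X) (m : ℕ)
    (h : ∀ φ, dualLagrangian Q N μ₀ μ₁ (m + 1) ν φ ≤ S) (φ : ℕ → X → ℝ) :
    ∑ k ∈ Finset.range (m + 1),
        pairing (φ k) (fun x => dualChain N μ₀ μ₁ ν k x - dualChain N μ₀ μ₁ ν (k + 1) x) ≤
      S + 1 / (2 * N) * ∑ k ∈ Finset.range (m + 1),
        gam Q (dualChain N μ₀ μ₁ ν (k + 1)) (φ k) := by
  have h1 : ∑ k ∈ Finset.range (m + 1),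
        pairing (φ k) (fun x => dualChain N μ₀ μ₁ ν k x - dualChain N μ₀ μ₁ ν (k + 1) x) =
      pairing (φ 0) μ₁ - ∑ k ∈ Finset.range (m + 1), pois k N * pairing (φ k) μ₀ -
      (∑ k ∈ Finset.range (m + 1), poisTail (k + 1) N * pairing (φ k) (ν k) -
        ∑ k ∈ Finset.range m, poisTail (k + 1) N * pairing (φ (k + 1)) (ν k)) := by
    rw [← sum_pairing_chain m (fun k => poisTail (k + 1) N) (fun k => pois k N)
      (by simp [poisTail]) (fun k => by rw [poisTail_succ (k + 1)]; ring)]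
    simp only [pairing_sub_right, Finset.sum_sub_distrib, pairing_dualChain_succ]
    rw [Finset.sum_range_succ']
    simp only [pairing_dualChain_succ]
    have e0 : pairing (φ 0) (dualChain N μ₀ μ₁ ν 0) = pairing (φ 0) μ₁ := rfl
    rw [e0]
    ring
  have h2 : ∑ k ∈ Finset.range (m + 1), poisTail (k + 1) N *
      pairing (fun x => if k + 1 < m + 1 then φ (k + 1) x else 0) (ν k) =
      ∑ k ∈ Finset.range m, poisTail (k + 1) N * pairing (φ (k + 1)) (ν k) := by
    rw [Finset.sum_range_succ]
    have : poisTail (m + 1) N *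
        pairing (fun x => if m + 1 < m + 1 then φ (m + 1) x else 0) (ν m) = 0 := by
      simp [pairing]
    rw [this, add_zero]
    refine Finset.sum_congr rfl fun k hk => ?_
    have : k + 1 < m + 1 := by simpa using hk
    simp [this]
  have h3 : dualLagrangian Q N μ₀ μ₁ (m + 1) ν φ =
      pairing (φ 0) μ₁ - ∑ k ∈ Finset.range (m + 1), pois k N * pairing (φ k) μ₀ -
      (∑ k ∈ Finset.range (m + 1), poisTail (k + 1) N * pairing (φ k) (ν k) -
        ∑ k ∈ Finset.range m, poisTail (k + 1) N * pairing (φ (k + 1)) (ν k)) -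
      1 / (2 * N) * ∑ k ∈ Finset.range (m + 1), poisTail (k + 1) N * gam Q (ν k) (φ k) := by
    rw [dualLagrangian, ← h2, ← Finset.sum_sub_distrib, Finset.mul_sum, sub_sub _ (∑ k ∈ _, (_ - _)),
      ← Finset.sum_add_distrib]
    congr 1
    refine Finset.sum_congr rfl fun k _ => ?_
    rw [pairing_sub_left]
    field_simp
  have h4 : ∑ k ∈ Finset.range (m + 1), poisTail (k + 1) N * gam Q (ν k) (φ k) ≤
      ∑ k ∈ Finset.range (m + 1), gam Q (dualChain N μ₀ μ₁ ν (k + 1)) (φ k) := by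
    refine Finset.sum_le_sum fun k _ => ?_
    have hq := poisTail_nonneg (k + 1) hN.le
    rw [← gam_smul_left hQ (hν k).1 hq]
    refine gam_le_of_mobility_le fun x y hxy => mobility_mono hQ
      (fun z => mul_nonneg hq ((hν k).1 z)) (fun z => ?_) hxy
    exact le_add_of_nonneg_left (mul_nonneg (by linarith [poisTail_le_one (k + 1) hN.le])
      (hμ₀.1 z))
  have h5 := h φ
  rw [h3] at h5
  rw [h1]
  have h6 := mul_le_mul_of_nonneg_left h4 (show 0 ≤ 1 / (2 * N) by positivity)
  linarith

lemma norm_poisAvg_sub_le {M : ℕ} {ζ : ℕ → X → ℝ} (hζ : ∀ j, ζ j ∈ stdSimplex ℝ X) {R : ℝ}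
    (hR : 0 ≤ R) : ‖(fun x => poisAvg M (fun j => ζ j x) R) - ζ M‖ ≤ 1 - poisTail M R := by
  refine (pi_norm_le_iff_of_nonneg (by linarith [poisTail_le_one M hR])).2 fun x => ?_
  have e : poisAvg M (fun j => ζ j x) R - ζ M x =
      ∑ k ∈ Finset.range M, pois k R * (ζ k x - ζ M x) := by
    simp only [poisAvg, mul_sub, Finset.sum_sub_distrib, ← Finset.sum_mul, poisTail]
    ring
  rw [Pi.sub_apply, e]
  refine (norm_sum_le _ _).trans ?_
  rw [poisTail, sub_sub_cancel]
  refine Finset.sum_le_sum fun k _ => ?_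
  rw [norm_mul, Real.norm_of_nonneg (pois_nonneg k hR)]
  exact mul_le_of_le_one_right (pois_nonneg k hR)
    ((norm_le_pi_norm (ζ k - ζ M) x).trans (norm_sub_le_one (hζ k) (hζ M)))

section Duality

variable {Q : ℝ → X → X → ℝ} {π : X → ℝ} {t S : ℝ} {μ₀ μ₁ : X → ℝ}

lemma exists_transportDist_le_of_dual (h : IsMarkovTriple (Q t) π) (hμ₀ : μ₀ ∈ stdSimplex ℝ X)
    (hμ₁ : μ₁ ∈ stdSimplex ℝ X)
    (hS : ∀ φ, IsHJSubsolution Q t t φ → pairing (φ 1) μ₁ - pairing (φ 0) μ₀ ≤ S) :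
    ∃ C, 0 ≤ C ∧ ∀ N R : ℝ, 0 < N → 0 < R → ∀ M : ℕ, 0 < M → transportDist (Q t) μ₀ μ₁ ≤
      ENNReal.ofReal (C * √(poisTail M N)) + (ENNReal.ofReal √(R * (2 * S / N)) +
        ENNReal.ofReal (C * √(1 - poisTail M R))) := by
  obtain ⟨C, hC, hdist⟩ := h.exists_transportDist_le_sqrt
  refine ⟨C, hC, fun N R hN hR M hM => ?_⟩
  obtain ⟨m, rfl⟩ := Nat.exists_eq_succ_of_ne_zero hM.ne'
  obtain ⟨ν, hν, hle⟩ := exists_dualLagrangian_le h hμ₀ hμ₁ hN hS hM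
  have hsum := sum_pairing_dualChain_le h.nonnegRates hN hμ₀ hν m hle
  set e := dualChain N μ₀ μ₁ ν with he
  have hemem : ∀ k, e k ∈ stdSimplex ℝ X := dualChain_mem hN.le hμ₀ hμ₁ hν
  set ζ : ℕ → X → ℝ := fun j => e (m + 1 - j) with hζ
  have hζmem : ∀ j, ζ j ∈ stdSimplex ℝ X := fun j => hemem _
  obtain ⟨W, c, hc, hdiv, hW, hcS⟩ := exists_momentum_of_le h.nonnegRates (M := m + 1) hζmem hN
    (S := S) fun φ => by
      have := hsum fun k => φ (m - k)
      rw [← Finset.sum_range_reflect, ← Finset.sum_range_reflect (fun k => gam _ _ _)] at this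
      refine le_trans (le_of_eq ?_) (this.trans (le_of_eq ?_))
      · refine Finset.sum_congr rfl fun j hj => ?_
        have hj' := Finset.mem_range.1 hj
        have e1 : m - (m + 1 - 1 - j) = j := by omega
        have e2 : m + 1 - 1 - j = m + 1 - (j + 1) := by omega
        have e3 : m + 1 - (j + 1) + 1 = m + 1 - j := by omega
        rw [e1, e2, e3]
      · congr 2
        refine Finset.sum_congr rfl fun j hj => ?_
        have hj' := Finset.mem_range.1 hj
        have e1 : m - (m + 1 - 1 - j) = j := by omega
        have e2 : m + 1 - 1 - j + 1 = m + 1 - j := by omega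
        rw [e1, e2]
  have hmid := transportDist_poisAvg_le h.nonnegRates hM hζmem hc hdiv hW hcS hR
  refine (transportDist_triangle _ μ₀ (ζ 0) μ₁).trans (add_le_add ?_
    ((transportDist_triangle _ (ζ 0) (fun x => poisAvg (m + 1) (fun j => ζ j x) R) μ₁).trans
      (add_le_add hmid ?_)))
  · refine (hdist μ₀ hμ₀ (ζ 0) (hζmem 0)).trans (ENNReal.ofReal_le_ofReal
      (mul_le_mul_of_nonneg_left (Real.sqrt_le_sqrt ?_) hC))
    have e0 : μ₀ - ζ 0 = poisTail (m + 1) N • (μ₀ - ν m) := by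
      ext x
      simp only [hζ, he, Nat.sub_zero, dualChain, Pi.sub_apply, Pi.smul_apply, smul_eq_mul]
      ring
    rw [e0, norm_smul, Real.norm_of_nonneg (poisTail_nonneg _ hN.le)]
    exact mul_le_of_le_one_right (poisTail_nonneg _ hN.le) (norm_sub_le_one hμ₀ (hν m))
  · have hlast : ζ (m + 1) = μ₁ := by simp [hζ, he, dualChain]
    have hmem : (fun x => poisAvg (m + 1) (fun j => ζ j x) R) ∈ stdSimplex ℝ X := by
      refine ⟨fun x => add_nonneg (Finset.sum_nonneg fun k _ => mul_nonneg (pois_nonneg k hR.le)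
        ((hζmem k).1 x)) (mul_nonneg (poisTail_nonneg _ hR.le) ((hζmem _).1 x)), ?_⟩
      simp only [poisAvg, Finset.sum_add_distrib]
      rw [Finset.sum_comm]
      simp only [← Finset.mul_sum, (hζmem _).2, mul_one]
      rw [poisTail]; ring
    refine (hdist _ hmem μ₁ hμ₁).trans (ENNReal.ofReal_le_ofReal
      (mul_le_mul_of_nonneg_left (Real.sqrt_le_sqrt ?_) hC))
    rw [← hlast]
    exact norm_poisAvg_sub_le hζmem hR.le

lemma tendsto_poisTail_zero {δ : ℝ} (hδ : 0 < δ) :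
    Tendsto (fun M : ℕ => poisTail M (M / (1 + δ))) atTop (𝓝 0) := by
  have h1 : 0 < 1 + δ := by linarith
  have hr : Real.exp (δ / (1 + δ)) / (1 + δ) < 1 := by
    rw [div_lt_one h1, ← Real.lt_log_iff_exp_lt h1]
    have := Real.log_lt_sub_one_of_pos (inv_pos.2 h1) (by
      intro h
      have := inv_eq_one.1 h
      linarith)
    rw [Real.log_inv] at this
    have e : δ / (1 + δ) = 1 - (1 + δ)⁻¹ := by field_simp; ring
    rw [e]; linarith
  refine squeeze_zero (fun M => poisTail_nonneg M (by positivity)) (fun M => ?_)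
    (tendsto_pow_atTop_nhds_zero_of_lt_one (by positivity) hr)
  refine (poisTail_le_chernoff M (by positivity) (by linarith : 1 ≤ 1 + δ)).trans (le_of_eq ?_)
  rw [div_pow, ← Real.exp_nat_mul]
  congr 2
  field_simp
  ring

lemma tendsto_one_sub_poisTail_zero {δ : ℝ} (hδ : 0 < δ) :
    Tendsto (fun M : ℕ => 1 - poisTail M (M * (1 + δ))) atTop (𝓝 0) := by
  have h1 : 0 < 1 + δ := by linarith
  have hr : Real.exp (-δ) * (1 + δ) < 1 := by
    rw [Real.exp_neg, inv_mul_lt_one₀ (Real.exp_pos δ)]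
    linarith [Real.add_one_lt_exp hδ.ne']
  refine squeeze_zero (fun M => sub_nonneg.2 (poisTail_le_one M (by positivity))) (fun M => ?_)
    (tendsto_pow_atTop_nhds_zero_of_lt_one (by positivity) hr)
  refine (one_sub_poisTail_le_chernoff M (by positivity) (inv_pos.2 h1)
    (inv_le_one_of_one_le₀ (by linarith))).trans (le_of_eq ?_)
  rw [mul_pow, ← Real.exp_nat_mul, inv_pow, div_inv_eq_mul]
  congr 2
  field_simp
  ring

lemma transportDist_le_of_dual (h : IsMarkovTriple (Q t) π) (hμ₀ : μ₀ ∈ stdSimplex ℝ X)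
    (hμ₁ : μ₁ ∈ stdSimplex ℝ X)
    (hS : ∀ φ, IsHJSubsolution Q t t φ → pairing (φ 1) μ₁ - pairing (φ 0) μ₀ ≤ S) :
    transportDist (Q t) μ₀ μ₁ ≤ ENNReal.ofReal √(2 * S) := by
  obtain ⟨C, hC, hle⟩ := exists_transportDist_le_of_dual h hμ₀ hμ₁ hS
  have hδ : ∀ δ : ℝ, 0 < δ → transportDist (Q t) μ₀ μ₁ ≤ ENNReal.ofReal ((1 + δ) * √(2 * S)) := by
    intro δ hδ
    have h1 : 0 < 1 + δ := by linarith
    have hl : Tendsto (fun M : ℕ => ENNReal.ofReal (C * √(poisTail M (M / (1 + δ)))) +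
        (ENNReal.ofReal ((1 + δ) * √(2 * S)) +
          ENNReal.ofReal (C * √(1 - poisTail M (M * (1 + δ)))))) atTop
        (𝓝 (0 + (ENNReal.ofReal ((1 + δ) * √(2 * S)) + 0))) := by
      have ha := ENNReal.tendsto_ofReal ((tendsto_poisTail_zero hδ).sqrt.const_mul C)
      have hb := ENNReal.tendsto_ofReal ((tendsto_one_sub_poisTail_zero hδ).sqrt.const_mul C)
      simp only [Real.sqrt_zero, mul_zero, ENNReal.ofReal_zero] at ha hb
      exact ha.add (tendsto_const_nhds.add hb)
    rw [zero_add, add_zero] at hl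
    refine ge_of_tendsto hl ((eventually_gt_atTop 0).mono fun M hM => ?_)
    have hM' : (0 : ℝ) < M := Nat.cast_pos.2 hM
    have := hle (M / (1 + δ)) (M * (1 + δ)) (by positivity) (by positivity) M hM
    have e : √((M : ℝ) * (1 + δ) * (2 * S / (M / (1 + δ)))) = (1 + δ) * √(2 * S) := by
      have : (M : ℝ) * (1 + δ) * (2 * S / (M / (1 + δ))) = (1 + δ) ^ 2 * (2 * S) := by
        field_simp
      rw [this, Real.sqrt_mul (sq_nonneg _), Real.sqrt_sq h1.le]
    rwa [e] at this
  have hl : Tendsto (fun δ : ℝ => ENNReal.ofReal ((1 + δ) * √(2 * S))) (𝓝[>] 0)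
      (𝓝 (ENNReal.ofReal ((1 + 0) * √(2 * S)))) := by
    refine (ENNReal.tendsto_ofReal ?_).mono_left nhdsWithin_le_nhds
    exact Continuous.tendsto (by fun_prop) (0 : ℝ)
  rw [add_zero, one_mul] at hl
  exact ge_of_tendsto hl (eventually_mem_nhdsWithin.mono fun δ h => hδ δ h)

/-- Half of Kantorovich duality: the transport distance is bounded by the cost given by the dual
problem. -/
lemma transportDist_le_twoTimeCost (h : IsMarkovTriple (Q t) π) (hμ₀ : μ₀ ∈ stdSimplex ℝ X)
    (hμ₁ : μ₁ ∈ stdSimplex ℝ X) :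
    transportDist (Q t) μ₀ μ₁ ≤ twoTimeCost Q t t μ₀ μ₁ := by
  rw [twoTimeCost]
  set A : ℝ≥0∞ := ⨆ (φ : ℝ → X → ℝ) (_ : IsHJSubsolution Q t t φ),
    ENNReal.ofReal (pairing (φ 1) μ₁ - pairing (φ 0) μ₀) with hA
  by_cases hfin : A = ⊤
  · simp [hfin]
  have hle := transportDist_le_of_dual (S := A.toReal) h hμ₀ hμ₁
    fun φ hφ => (ENNReal.ofReal_le_iff_le_toReal hfin).1 (le_iSup₂_of_le φ hφ le_rfl)
  refine hle.trans (le_of_eq ?_)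
  rw [Real.sqrt_eq_rpow, ← ENNReal.ofReal_rpow_of_nonneg (by positivity) (by norm_num),
    ENNReal.ofReal_mul (by norm_num), ENNReal.ofReal_toReal hfin]
  simp

end Duality

/-! ### Absolutely continuous functions -/

lemma absolutelyContinuousOnInterval_lipschitz_comp {f g : ℝ → ℝ} {a b : ℝ} {K : NNReal}
    {S : Set ℝ} (hf : AbsolutelyContinuousOnInterval f a b) (hg : LipschitzOnWith K g S)
    (hS : MapsTo f (uIcc a b) S) : AbsolutelyContinuousOnInterval (fun x => g (f x)) a b := by
  rw [absolutelyContinuousOnInterval_iff] at hf ⊢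
  intro ε hε
  obtain ⟨δ, hδ, h⟩ := hf (ε / (K + 1)) (by positivity)
  refine ⟨δ, hδ, fun E hE hlt => ?_⟩
  have h1 := h E hE hlt
  calc ∑ i ∈ Finset.range E.1, dist (g (f (E.2 i).1)) (g (f (E.2 i).2))
      ≤ ∑ i ∈ Finset.range E.1, K * dist (f (E.2 i).1) (f (E.2 i).2) :=
        Finset.sum_le_sum fun i hi => hg.dist_le_mul _ (hS (hE.1 i hi).1) _ (hS (hE.1 i hi).2)
    _ = K * ∑ i ∈ Finset.range E.1, dist (f (E.2 i).1) (f (E.2 i).2) := by rw [Finset.mul_sum]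
    _ ≤ K * (ε / (K + 1)) := mul_le_mul_of_nonneg_left h1.le K.2
    _ < (K + 1) * (ε / (K + 1)) := by
        have : 0 < ε / ((K : ℝ) + 1) := by positivity
        linarith
    _ = ε := by field_simp

lemma absolutelyContinuousOnInterval_finset_sum {ι : Type*} (s : Finset ι) {f : ι → ℝ → ℝ}
    {a b : ℝ} (hf : ∀ i ∈ s, AbsolutelyContinuousOnInterval (f i) a b) :
    AbsolutelyContinuousOnInterval (fun r => ∑ i ∈ s, f i r) a b := by
  classical
  induction s using Finset.induction_on with
  | empty =>
    simp only [Finset.sum_empty]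
    exact (LipschitzWith.const (0 : ℝ)).lipschitzOnWith.absolutelyContinuousOnInterval
  | insert i s hi ih =>
    simp only [Finset.sum_insert hi]
    exact (hf i (Finset.mem_insert_self i s)).fun_add
      (ih fun j hj => hf j (Finset.mem_insert_of_mem hj))

lemma integral_le_toReal_lintegral {μ : Measure ℝ} {f : ℝ → ℝ} (hf : Integrable f μ) :
    ∫ r, f r ∂μ ≤ (∫⁻ r, ENNReal.ofReal (f r) ∂μ).toReal := by
  have h : ∫ r, f r ∂μ ≤ ∫ r, max (f r) 0 ∂μ :=
    integral_mono hf hf.pos_part fun r => le_max_left _ _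
  refine h.trans (le_of_eq ?_)
  rw [integral_eq_lintegral_of_nonneg_ae (f := fun r => max (f r) 0)
    (Eventually.of_forall fun r => le_max_right _ _) hf.pos_part.aestronglyMeasurable]
  simp only [ENNReal.ofReal_max, ENNReal.ofReal_zero, max_eq_left zero_le]

/-- A continuous function on `[0, 1]`, absolutely continuous in the interior, with derivative at
most `k + B`. -/
lemma sub_le_of_deriv_le {G k : ℝ → ℝ} {B : ℝ → ℝ≥0∞} (hGc : ContinuousOn G (Icc 0 1))
    (hAC : ∀ δ ∈ Ioo (0 : ℝ) (1 / 2), AbsolutelyContinuousOnInterval G δ (1 - δ))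
    (hk : IntervalIntegrable k volume 0 1) (hB : ∫⁻ r in Icc (0 : ℝ) 1, B r ≠ ⊤)
    (hle : ∀ᵐ r : ℝ, r ∈ Ioo (0 : ℝ) 1 → ENNReal.ofReal (deriv G r - k r) ≤ B r) :
    G 1 - G 0 ≤ (∫⁻ r in Icc (0 : ℝ) 1, B r).toReal + ∫ r in (0 : ℝ)..1, k r := by
  have key : ∀ δ ∈ Ioo (0 : ℝ) (1 / 2), G (1 - δ) - G δ ≤
      (∫⁻ r in Icc (0 : ℝ) 1, B r).toReal +
        ((∫ r in (0 : ℝ)..(1 - δ), k r) - ∫ r in (0 : ℝ)..δ, k r) := by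
    intro δ hδ
    have hδ1 : δ ≤ 1 - δ := by linarith [hδ.2]
    have hsub : ∀ a b : ℝ, 0 ≤ a → a ≤ b → b ≤ 1 → IntervalIntegrable k volume a b :=
      fun a b h0 h1 h2 => hk.mono_set (by
        rw [uIcc_of_le h1, uIcc_of_le zero_le_one]
        exact Icc_subset_Icc h0 h2)
    have hkδ := hsub δ (1 - δ) hδ.1.le hδ1 (by linarith [hδ.1])
    rw [← (hAC δ hδ).integral_deriv_eq_sub, intervalIntegral.integral_interval_sub_left
      (hsub 0 _ le_rfl (by linarith [hδ.2]) (by linarith [hδ.1]))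
      (hsub 0 _ le_rfl hδ.1.le (by linarith [hδ.2]))]
    rw [← sub_le_iff_le_add, ← intervalIntegral.integral_sub (hAC δ hδ).intervalIntegrable_deriv
      hkδ, intervalIntegral.integral_of_le hδ1]
    have hint := ((hAC δ hδ).intervalIntegrable_deriv.sub hkδ).1
    refine (integral_le_toReal_lintegral hint).trans (ENNReal.toReal_mono hB ?_)
    calc ∫⁻ r in Ioc δ (1 - δ), ENNReal.ofReal (deriv G r - k r)
        ≤ ∫⁻ r in Ioc δ (1 - δ), B r := by
          refine lintegral_mono_ae ?_
          rw [ae_restrict_iff' measurableSet_Ioc]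
          filter_upwards [hle] with r hr hr'
          exact hr ⟨hδ.1.trans hr'.1, hr'.2.trans_lt (by linarith [hδ.1])⟩
      _ ≤ ∫⁻ r in Icc (0 : ℝ) 1, B r := lintegral_mono_set fun r hr =>
          ⟨hδ.1.le.trans hr.1.le, hr.2.trans (by linarith [hδ.1])⟩
  have hprim : ContinuousOn (fun u => ∫ r in (0 : ℝ)..u, k r) (Icc 0 1) := by
    have := intervalIntegral.continuousOn_primitive_interval (μ := volume) (f := k) (a := 0)
      (b := 1) (by
        rw [uIcc_of_le zero_le_one, integrableOn_Icc_iff_integrableOn_Ioc]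
        exact hk.1)
    rwa [uIcc_of_le zero_le_one] at this
  have hsymm : ∀ {f : ℝ → ℝ}, ContinuousOn f (Icc 0 1) →
      Tendsto (fun δ : ℝ => f (1 - δ)) (𝓝[>] 0) (𝓝 (f 1)) ∧
      Tendsto (fun δ : ℝ => f δ) (𝓝[>] 0) (𝓝 (f 0)) := by
    intro f hf
    constructor
    · refine (hf 1 ⟨zero_le_one, le_rfl⟩).tendsto.comp (tendsto_nhdsWithin_iff.2 ⟨?_, ?_⟩)
      · have : Tendsto (fun δ : ℝ => 1 - δ) (𝓝 0) (𝓝 (1 - 0)) :=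
          Continuous.tendsto (by fun_prop) 0
        rw [sub_zero] at this
        exact this.mono_left nhdsWithin_le_nhds
      · filter_upwards [Ioo_mem_nhdsGT (show (0 : ℝ) < 1 by norm_num)] with δ hδ
        exact ⟨by linarith [hδ.2], by linarith [hδ.1]⟩
    · refine (hf 0 ⟨le_rfl, zero_le_one⟩).tendsto.comp (tendsto_nhdsWithin_iff.2
        ⟨tendsto_id.mono_left nhdsWithin_le_nhds, ?_⟩)
      filter_upwards [Ioo_mem_nhdsGT (show (0 : ℝ) < 1 by norm_num)] with δ hδ
      exact ⟨hδ.1.le, hδ.2.le⟩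
  have hl := (hsymm hGc).1.sub (hsymm hGc).2
  have hr := ((hsymm hprim).1.sub (hsymm hprim).2).const_add
    (∫⁻ r in Icc (0 : ℝ) 1, B r).toReal
  simp only [intervalIntegral.integral_same, sub_zero] at hr
  refine le_of_tendsto_of_tendsto hl hr ?_
  filter_upwards [Ioo_mem_nhdsGT (show (0 : ℝ) < 1 / 2 by norm_num)] with δ hδ
  exact key δ hδ

/-! ### Pointwise estimates -/

lemma pairing_dualLaplacian_eq {Q : X → X → ℝ} {π : X → ℝ} (h : IsMarkovTriple Q π)
    (ψ σ : X → ℝ) : pairing ψ (dualLaplacian Q σ) =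
      1 / 2 * ∑ x, ∑ y, (ψ y - ψ x) * (σ x * Q x y - σ y * Q y x) := by
  have e1 : ∑ x, ∑ y, ψ x * (σ x * Q x y) = 0 := by
    simp only [← Finset.mul_sum, h.row_sum, mul_zero, Finset.sum_const_zero]
  have e2 : ∑ x, ∑ y, ψ y * (σ y * Q y x) = 0 := by rw [Finset.sum_comm, e1]
  have e3 : ∑ x, ∑ y, ψ x * (σ y * Q y x) = pairing ψ (dualLaplacian Q σ) := by
    simp only [pairing, dualLaplacian, Finset.mul_sum]
    exact Finset.sum_congr rfl fun x _ => Finset.sum_congr rfl fun y _ => by ring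
  have e4 : ∑ x, ∑ y, ψ y * (σ x * Q x y) = pairing ψ (dualLaplacian Q σ) := by
    rw [Finset.sum_comm, e3]
  simp only [sub_mul, mul_sub, Finset.sum_sub_distrib, e1, e2, e3, e4]
  ring

/-- The entropy production along the dual heat flow compensates the difference of the carrés du
champ. -/
lemma neg_mul_pairing_dualLaplacian_le {Q : X → X → ℝ} {π : X → ℝ} (h : IsMarkovTriple Q π)
    {σ : X → ℝ} (hσ : ∀ x, 0 < σ x) (φ : X → ℝ) (c : ℝ) :
    -(c * pairing (fun x => φ x - c * (Real.log (σ x) - Real.log (π x))) (dualLaplacian Q σ)) ≤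
      1 / 2 * gam Q σ φ -
        1 / 2 * gam Q σ (fun x => φ x - c * (Real.log (σ x) - Real.log (π x))) := by
  set ψ : X → ℝ := fun x => φ x - c * (Real.log (σ x) - Real.log (π x)) with hψ
  have key : ∀ x y, -(c * ((ψ y - ψ x) * (σ x * Q x y - σ y * Q y x))) ≤
      1 / 2 * ((φ y - φ x) ^ 2 * mobility Q σ x y) -
        1 / 2 * ((ψ y - ψ x) ^ 2 * mobility Q σ x y) := by
    intro x y
    by_cases hxy : x = y
    · subst hxy; simp
    rcases (h.rate_nonneg x y hxy).eq_or_lt with h0 | h0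
    · have h0' := h.rate_zero_symm h0.symm
      simp [mobility, ← h0, h0', logMean_zero_zero]
    · have h0' := h.rate_pos_symm h0
      have hlm := log_sub_log_mul_logMean (mul_pos (hσ x) h0) (mul_pos (hσ y) h0')
      have hrev := congrArg Real.log (h.reversible x y)
      rw [Real.log_mul h0.ne' (h.pos x).ne', Real.log_mul h0'.ne' (h.pos y).ne'] at hrev
      rw [Real.log_mul (hσ x).ne' h0.ne', Real.log_mul (hσ y).ne' h0'.ne'] at hlm
      have hΛ := mobility_nonneg h.nonnegRates (fun z => (hσ z).le) hxy
      change _ * mobility Q σ x y = _ at hlm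
      rw [← hlm]
      have e : (ψ y - ψ x) = (φ y - φ x) + c * (Real.log (σ x) + Real.log (Q x y) -
          (Real.log (σ y) + Real.log (Q y x))) := by
        simp only [hψ]
        linear_combination (-c) * hrev
      set w := Real.log (σ x) + Real.log (Q x y) - (Real.log (σ y) + Real.log (Q y x))
      have h2 : φ y - φ x = (ψ y - ψ x) - c * w := by linarith
      rw [h2]
      nlinarith [mul_nonneg hΛ (sq_nonneg (c * w))]
  rw [pairing_dualLaplacian_eq h]
  have hs := Finset.sum_le_sum fun x (_ : x ∈ Finset.univ) =>
    Finset.sum_le_sum fun y (_ : y ∈ Finset.univ) => key x y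
  simp only [Finset.sum_neg_distrib, Finset.sum_sub_distrib, ← Finset.mul_sum] at hs
  simp only [gam]
  linarith

lemma ofReal_le_edgeCost {s t : ℝ} (hs : 0 ≤ s) (ht : 0 ≤ t) {l : ℝ} (hl : 0 < l) (b v : ℝ) :
    ENNReal.ofReal (b * v - l / 2 * (b ^ 2 * logMean s t)) ≤
      ENNReal.ofReal (1 / (2 * l)) * edgeCost v s t := by
  have hl' : 0 < 1 / (2 * l) := by positivity
  unfold edgeCost
  split_ifs with h0 h1
  · simp [h0, h1]
  · rw [ENNReal.mul_top (ENNReal.ofReal_pos.2 hl').ne']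
    exact le_top
  · have hpos : 0 < logMean s t := lt_of_le_of_ne (logMean_nonneg hs ht) (Ne.symm h0)
    rw [← ENNReal.ofReal_mul hl'.le]
    refine ENNReal.ofReal_le_ofReal ?_
    have : 1 / (2 * l) * (v ^ 2 / logMean s t) - (b * v - l / 2 * (b ^ 2 * logMean s t)) =
        1 / (2 * l * logMean s t) * (v - l * b * logMean s t) ^ 2 := by
      field_simp
      ring
    have h2 : 0 ≤ 1 / (2 * l * logMean s t) * (v - l * b * logMean s t) ^ 2 := by positivity
    linarith

lemma neg_pairing_divg (ψ : X → ℝ) (V : X → X → ℝ) :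
    -pairing ψ (divg V) = 1 / 2 * ∑ x, ∑ y, (ψ y - ψ x) * V x y := by
  have e : ∑ x, ∑ y, ψ y * V x y = ∑ x, ∑ y, ψ x * V y x := Finset.sum_comm
  simp only [sub_mul, Finset.sum_sub_distrib, e]
  simp only [pairing, divg, Finset.mul_sum, ← Finset.sum_sub_distrib, ← Finset.sum_neg_distrib]
  refine Finset.sum_congr rfl fun x _ => Finset.sum_congr rfl fun y _ => by ring

/-- Young's inequality for the pairing of a gradient with a momentum. -/
lemma ofReal_le_action {Q : X → X → ℝ} (hQ : NonnegRates Q) {μ : X → ℝ} (hμ : ∀ x, 0 ≤ μ x)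
    (V : X → X → ℝ) (ψ : X → ℝ) {l : ℝ} (hl : 0 < l) :
    ENNReal.ofReal (-pairing ψ (divg V) - l / 2 * gam Q μ ψ) ≤
      ENNReal.ofReal (1 / (2 * l)) * action Q μ V := by
  classical
  have e : -pairing ψ (divg V) - l / 2 * gam Q μ ψ =
      1 / 2 * ∑ x, ∑ y with y ≠ x, ((ψ y - ψ x) * V x y -
        l / 2 * ((ψ y - ψ x) ^ 2 * mobility Q μ x y)) := by
    rw [neg_pairing_divg, gam]
    have : ∀ x, ∑ y with y ≠ x, ((ψ y - ψ x) * V x y -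
        l / 2 * ((ψ y - ψ x) ^ 2 * mobility Q μ x y)) = ∑ y, ((ψ y - ψ x) * V x y -
        l / 2 * ((ψ y - ψ x) ^ 2 * mobility Q μ x y)) := fun x => by
      refine Finset.sum_filter_of_ne fun y _ hne hyx => hne ?_
      simp [hyx]
    simp only [this, Finset.sum_sub_distrib, ← Finset.mul_sum]
    ring
  have h12 : ENNReal.ofReal (1 / 2) = 1 / 2 := by
    rw [ENNReal.ofReal_div_of_pos two_pos]
    simp
  rw [e, ENNReal.ofReal_mul (by norm_num), h12, action, mul_left_comm]
  refine mul_le_mul_right ?_ _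
  have hsub : ∀ {ι : Type _} (s : Finset ι) (f : ι → ℝ),
      ENNReal.ofReal (∑ i ∈ s, f i) ≤ ∑ i ∈ s, ENNReal.ofReal (f i) := fun s f =>
    Finset.le_sum_of_subadditive ENNReal.ofReal ENNReal.ofReal_zero.le
      (fun _ _ => ENNReal.ofReal_add_le) s f
  refine (hsub _ _).trans ?_
  rw [Finset.mul_sum]
  refine Finset.sum_le_sum fun x _ => (hsub _ _).trans ?_
  rw [Finset.mul_sum]
  refine Finset.sum_le_sum fun y hy => ?_
  have hyx : y ≠ x := (Finset.mem_filter.1 hy).2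
  exact ofReal_le_edgeCost (mul_nonneg (hμ x) (hQ x y hyx.symm)) (mul_nonneg (hμ y) (hQ y x hyx))
    hl _ _

/-! ### Regularity along curves -/

lemma absolutelyContinuousOnInterval_congr {f g : ℝ → ℝ} {a b : ℝ}
    (hf : AbsolutelyContinuousOnInterval f a b) (h : EqOn g f (uIcc a b)) :
    AbsolutelyContinuousOnInterval g a b := by
  rw [absolutelyContinuousOnInterval_iff] at hf ⊢
  intro ε hε
  obtain ⟨δ, hδ, hE⟩ := hf ε hε
  refine ⟨δ, hδ, fun E hE' hlt => lt_of_eq_of_lt ?_ (hE E hE' hlt)⟩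
  refine Finset.sum_congr rfl fun i hi => ?_
  rw [h (hE'.1 i hi).1, h (hE'.1 i hi).2]

section Curve

variable {μ₀ μ₁ : X → ℝ} {μ : ℝ → X → ℝ} {V : ℝ → X → X → ℝ}

lemma ContinuityEq.absolutelyContinuous (h : ContinuityEq μ₀ μ₁ μ V) (x : X) :
    AbsolutelyContinuousOnInterval (fun r => μ r x) 0 1 := by
  have h1 : AbsolutelyContinuousOnInterval (fun r => μ₀ x - ∫ u in (0 : ℝ)..r, divg (V u) x) 0 1 :=
    ((LipschitzWith.const (μ₀ x)).lipschitzOnWith.absolutelyContinuousOnInterval).fun_sub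
      ((h.intervalIntegrable_divg x).absolutelyContinuousOnInterval_intervalIntegral
        (by rw [uIcc_of_le zero_le_one]; exact ⟨le_rfl, zero_le_one⟩))
  refine absolutelyContinuousOnInterval_congr h1 fun r hr => ?_
  rw [uIcc_of_le zero_le_one] at hr
  exact h.eqn' hr x

lemma ContinuityEq.ae_hasDerivAt (h : ContinuityEq μ₀ μ₁ μ V) :
    ∀ᵐ r : ℝ, r ∈ Ioo (0 : ℝ) 1 → ∀ x, HasDerivAt (fun r => μ r x) (-divg (V r) x) r := by
  have h1 : ∀ᵐ r : ℝ, ∀ x, r ∈ uIcc (0 : ℝ) 1 → ∀ c ∈ uIcc (0 : ℝ) 1,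
      HasDerivAt (fun r => ∫ u in c..r, divg (V u) x) (divg (V r) x) r :=
    ae_all_iff.2 fun x => (h.intervalIntegrable_divg x).ae_hasDerivAt_integral
  filter_upwards [h1] with r hr hr' x
  rw [uIcc_of_le zero_le_one] at hr
  have h2 := (hr x (Ioo_subset_Icc_self hr') 0 ⟨le_rfl, zero_le_one⟩).const_sub (μ₀ x)
  refine h2.congr_of_eventuallyEq ?_
  filter_upwards [Ioo_mem_nhds hr'.1 hr'.2] with u hu
  exact h.eqn' (Ioo_subset_Icc_self hu) x

end Curve

section Time

variable {α β : ℝ} {Q : ℝ → X → X → ℝ} {π : ℝ → X → ℝ}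

lemma IsTimeDependentTriple.dual_hasDerivAt (hT : IsTimeDependentTriple α β Q π) {t u : ℝ}
    (ht : t ∈ Ioo α β) (hu : u ∈ Ioo α t) (σ : X → ℝ) (x : X) :
    HasDerivAt (fun u => dualHeatProp α Q t u σ x)
      (-dualLaplacian (Q u) (dualHeatProp α Q t u σ) x) u :=
  hasDerivAt_pi.1 ((hT.dual_spec ht σ).eqn u hu) x

lemma continuousOn_dualLaplacian {S : Set ℝ} {σ : ℝ → X → ℝ}
    (hQ : ∀ x y, ContinuousOn (fun t => Q t x y) S) (hσ : ContinuousOn σ S) (x : X) :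
    ContinuousOn (fun u => dualLaplacian (Q u) (σ u) x) S :=
  continuousOn_finsetSum _ fun y _ => (hQ y x).mul (continuousOn_pi.1 hσ y)

lemma IsTimeDependentTriple.exists_lipschitz_dual (hT : IsTimeDependentTriple α β Q π) {t u v : ℝ}
    (ht : t ∈ Ioo α β) (hu : α < u) (hv : v < t) (σ : X → ℝ) (x : X) :
    ∃ K : NNReal, LipschitzOnWith K (fun u => dualHeatProp α Q t u σ x) (Icc u v) := by
  have hsub : Icc u v ⊆ Ioc α t := fun r hr => ⟨hu.trans_le hr.1, hr.2.trans hv.le⟩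
  obtain ⟨K, hK⟩ := isCompact_Icc.exists_bound_of_continuousOn
    (continuousOn_dualLaplacian (Q := Q) (S := Icc u v)
      (fun x y => (hT.continuousOn_rate x y).mono fun r hr =>
        ⟨hu.trans_le hr.1, (hr.2.trans_lt hv).trans ht.2⟩)
      ((hT.dual_spec ht σ).continuousOn.mono hsub) x)
  refine ⟨K.toNNReal, (convex_Icc u v).lipschitzOnWith_of_nnnorm_hasDerivWithin_le
    (f' := fun r => -dualLaplacian (Q r) (dualHeatProp α Q t r σ) x)
    (fun r hr => (hT.dual_hasDerivAt ht ⟨hu.trans_le hr.1, hr.2.trans_lt hv⟩ σ x).hasDerivWithinAt)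
    fun r hr => ?_⟩
  rw [nnnorm_neg, ← NNReal.coe_le_coe, coe_nnnorm]
  exact (hK r hr).trans (Real.le_coe_toNNReal K)

lemma IsTimeDependentTriple.continuousOn_dual_comp (hT : IsTimeDependentTriple α β Q π) {t : ℝ}
    (ht : t ∈ Ioo α β) {θ : ℝ → ℝ} {ν : ℝ → X → ℝ} {S : Set ℝ} (hθ : ContinuousOn θ S)
    (hmaps : MapsTo θ S (Ioc α t)) (hν : ContinuousOn ν S) :
    ContinuousOn (fun r => dualHeatProp α Q t (θ r) (ν r)) S := by
  classical
  refine continuousOn_pi.2 fun x => ?_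
  have : ContinuousOn (fun r => ∑ y, ν r y * dualHeatProp α Q t (θ r) (Pi.single y 1) x) S :=
    continuousOn_finsetSum _ fun y _ => (continuousOn_pi.1 hν y).mul
      ((continuousOn_pi.1 (hT.dual_spec ht (Pi.single y 1)).continuousOn x).comp hθ hmaps)
  refine this.congr fun r hr => ?_
  rw [hT.dual_eq_sum ht (hmaps hr)]

lemma lipschitzOnWith_log {c : ℝ} (hc : 0 < c) :
    LipschitzOnWith (c⁻¹).toNNReal Real.log (Ici c) := by
  refine (convex_Ici c).lipschitzOnWith_of_nnnorm_hasDerivWithin_le (f' := fun r => r⁻¹)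
    (fun r hr => (Real.hasDerivAt_log (hc.trans_le hr).ne').hasDerivWithinAt) fun r hr => ?_
  have hr0 : 0 < r := hc.trans_le hr
  rw [← NNReal.coe_le_coe, coe_nnnorm, Real.coe_toNNReal _ (inv_nonneg.2 hc.le),
    Real.norm_of_nonneg (inv_nonneg.2 hr0.le)]
  exact inv_anti₀ hc hr

lemma IsTimeDependentTriple.exists_lipschitz_log (hT : IsTimeDependentTriple α β Q π) {u v : ℝ}
    (hu : α < u) (hv : v < β) :
    ∃ L : NNReal, ∀ x, LipschitzOnWith L (fun r => Real.log (π r x)) (Icc u v) := by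
  have hsub : Icc u v ⊆ Ioo α β := fun r hr => ⟨hu.trans_le hr.1, hr.2.trans_lt hv⟩
  have h1 : ∀ x, ∃ L : NNReal, LipschitzOnWith L (fun r => Real.log (π r x)) (Icc u v) := by
    intro x
    obtain ⟨K, hK⟩ := ((hT.measure_lipschitz x).mono hsub).exists_lipschitzOnWith_of_compact
      isCompact_Icc
    rcases (Icc u v).eq_empty_or_nonempty with he | hne
    · exact ⟨0, by simp [he]⟩
    obtain ⟨r₀, hr₀, hmin⟩ := isCompact_Icc.exists_isMinOn hne hK.continuousOn
    exact ⟨_, (lipschitzOnWith_log ((hT.triple r₀ (hsub hr₀)).pos x)).comp hK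
      fun r hr => hmin hr⟩
  choose L hL using h1
  refine ⟨∑ x, L x, fun x => (hL x).weaken ?_⟩
  exact Finset.single_le_sum (f := L) (fun _ _ => zero_le) (Finset.mem_univ x)

lemma IsTimeDependentTriple.exists_deriv_log_bound (hT : IsTimeDependentTriple α β Q π) {s t : ℝ}
    (hs : s ∈ Ioo α β) (ht : t ∈ Ioo α β) :
    ∃ L : ℝ, 0 ≤ L ∧ ∀ r ∈ Icc s t, ∀ x, |deriv (fun r => Real.log (π r x)) r| ≤ L := by
  obtain ⟨u, hu, hus⟩ := exists_between hs.1
  obtain ⟨v, htv, hv⟩ := exists_between ht.2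
  obtain ⟨L, hL⟩ := hT.exists_lipschitz_log hu hv
  exact ⟨L, L.2, fun r hr x => norm_deriv_le_of_lipschitzOn
    (Icc_mem_nhds (hus.trans_le hr.1) (hr.2.trans_lt htv)) (hL x)⟩

lemma abs_pairing_le {L : ℝ} {φ σ : X → ℝ} (hφ : ∀ x, |φ x| ≤ L) (hσ : σ ∈ stdSimplex ℝ X) :
    |pairing φ σ| ≤ L := by
  refine (Finset.abs_sum_le_sum_abs _ _).trans ?_
  calc ∑ x, |φ x * σ x| ≤ ∑ x, L * σ x := Finset.sum_le_sum fun x _ => by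
        rw [abs_mul, abs_of_nonneg (hσ.1 x)]
        exact mul_le_mul_of_nonneg_right (hφ x) (hσ.1 x)
    _ = L := by rw [← Finset.mul_sum, hσ.2, mul_one]

lemma IsTimeDependentTriple.intervalIntegrable_pairing_deriv_log
    (hT : IsTimeDependentTriple α β Q π) {s t : ℝ} (hs : s ∈ Ioo α β) (ht : t ∈ Ioo α β)
    {θ : ℝ → ℝ} (hθ : Continuous θ) (hmaps : MapsTo θ (Icc 0 1) (Icc s t)) {σ : ℝ → X → ℝ}
    (hσ : ContinuousOn σ (Icc 0 1)) :
    IntervalIntegrable (fun r => pairing (fun x => deriv (fun u => Real.log (π u x)) (θ r)) (σ r))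
      volume 0 1 := by
  obtain ⟨L, hL0, hL⟩ := hT.exists_deriv_log_bound hs ht
  unfold pairing
  have := IntervalIntegrable.sum (μ := volume) (a := 0) (b := 1)
    (f := fun x r => deriv (fun u => Real.log (π u x)) (θ r) * σ r x) Finset.univ fun x _ => by
      refine IntervalIntegrable.mul_continuousOn ?_ (by
        rw [uIcc_of_le zero_le_one]
        exact continuousOn_pi.1 hσ x)
      rw [intervalIntegrable_iff, uIoc_of_le zero_le_one]
      refine Measure.integrableOn_of_bounded (M := L) (by simp)
        ((measurable_deriv _).comp hθ.measurable).aestronglyMeasurable ?_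
      rw [ae_restrict_iff' measurableSet_Ioc]
      exact Eventually.of_forall fun r hr => hL _ (hmaps ⟨hr.1.le, hr.2⟩) x
  refine this.congr fun r _ => ?_
  simp

lemma entropy_eq {π μ : X → ℝ} (hπ : ∀ x, 0 < π x) :
    entropy π μ = ∑ x, (μ x * Real.log (μ x) - μ x * Real.log (π x)) := by
  refine Finset.sum_congr rfl fun x _ => ?_
  by_cases h : μ x = 0
  · simp [h]
  · rw [Real.log_div h (hπ x).ne']
    ring

end Time

/-! ### The main inequality -/

section Main

variable {α β : ℝ} {Q : ℝ → X → X → ℝ} {π : ℝ → X → ℝ} {s t : ℝ}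

lemma pairing_neg_right (φ σ : X → ℝ) : pairing φ (fun x => -σ x) = -pairing φ σ := by
  simp [pairing]

lemma hasDerivAt_pairing {φ ν : ℝ → X → ℝ} {φ' ν' : X → ℝ} {r : ℝ}
    (hφ : ∀ x, HasDerivAt (fun r => φ r x) (φ' x) r)
    (hν : ∀ x, HasDerivAt (fun r => ν r x) (ν' x) r) :
    HasDerivAt (fun r => pairing (φ r) (ν r)) (pairing φ' (ν r) + pairing (φ r) ν') r := by
  refine (HasDerivAt.fun_sum fun x _ => (hφ x).fun_mul (hν x)).congr_deriv ?_
  simp only [pairing, Finset.sum_add_distrib]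

lemma IsHJSubsolution.hasDerivAt {φ : ℝ → X → ℝ} (hφ : IsHJSubsolution Q s t φ) {a : ℝ}
    (ha : a ∈ Ioo (0 : ℝ) 1) (x : X) : HasDerivAt (fun a => φ a x) (deriv φ a x) a :=
  hasDerivAt_pi.1 ((hφ.contDiffOn.differentiableOn (by norm_num)).differentiableAt
    (Icc_mem_nhds ha.1 ha.2)).hasDerivAt x

lemma IsHJSubsolution.absolutelyContinuous {φ : ℝ → X → ℝ} (hφ : IsHJSubsolution Q s t φ)
    {f : ℝ → ℝ} (hf : ContDiff ℝ 1 f) {a b : ℝ} (hmaps : MapsTo f (uIcc a b) (Icc 0 1)) (x : X) :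
    AbsolutelyContinuousOnInterval (fun r => φ (f r) x) a b :=
  ContDiffOn.absolutelyContinuousOnInterval
    ((contDiffOn_pi.1 hφ.contDiffOn x).comp hf.contDiffOn hmaps)

/-- Weak duality for the static distance. -/
lemma pairing_sub_le_of_static (h : NonnegRates (Q t)) {γ₀ γ₁ : X → ℝ} {ν : ℝ → X → ℝ}
    {V : ℝ → X → X → ℝ} (hCE : ContinuityEq γ₀ γ₁ ν V) (hfin : totalAction (Q t) ν V ≠ ⊤)
    {φ : ℝ → X → ℝ} (hφ : IsHJSubsolution Q t t φ) :
    pairing (φ 1) γ₁ - pairing (φ 0) γ₀ ≤ 1 / 2 * (totalAction (Q t) ν V).toReal := by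
  have hAC : AbsolutelyContinuousOnInterval (fun r => pairing (φ r) (ν r)) 0 1 :=
    absolutelyContinuousOnInterval_finset_sum _ fun x _ =>
      (hφ.absolutelyContinuous contDiff_id (by rw [uIcc_of_le zero_le_one]; exact mapsTo_id _)
        x).fun_mul (hCE.absolutelyContinuous x)
  have hmain := sub_le_of_deriv_le (G := fun r => pairing (φ r) (ν r)) (k := fun _ => 0)
    (B := fun r => ENNReal.ofReal (1 / 2) * action (Q t) (ν r) (V r))
    (by have := hAC.continuousOn; rwa [uIcc_of_le zero_le_one] at this)
    (fun δ hδ => hAC.mono (by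
      rw [uIcc_of_le zero_le_one, uIcc_of_le (by linarith [hδ.2])]
      exact Icc_subset_Icc hδ.1.le (by linarith [hδ.1])))
    intervalIntegrable_const (by
      rw [lintegral_const_mul' _ _ ENNReal.ofReal_ne_top]
      exact ENNReal.mul_ne_top ENNReal.ofReal_ne_top hfin) (by
      filter_upwards [hCE.ae_hasDerivAt] with r hr hr'
      rw [(hasDerivAt_pairing (hφ.hasDerivAt hr') (hr hr')).deriv]
      have h1 := ofReal_le_action h (hCE.mem r (Ioo_subset_Icc_self hr')).1 (V r) (φ r) one_pos
      rw [mul_one] at h1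
      refine le_trans (ENNReal.ofReal_le_ofReal ?_) h1
      have h2 := hφ.subsolution r hr' (ν r) (hCE.mem r (Ioo_subset_Icc_self hr'))
      have e : interp t t r = t := by simp [interp]
      rw [e] at h2
      rw [pairing_neg_right]
      linarith)
  rw [lintegral_const_mul' _ _ ENNReal.ofReal_ne_top, ENNReal.toReal_mul,
    ENNReal.toReal_ofReal (by norm_num)] at hmain
  simp only [hCE.left, hCE.right, intervalIntegral.integral_zero, add_zero] at hmain
  exact hmain

lemma interp_mem {a : ℝ} (hst : s ≤ t) (ha : a ∈ Icc (0 : ℝ) 1) : interp s t a ∈ Icc s t := by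
  have h : 0 ≤ t - s := sub_nonneg.2 hst
  constructor
  · have := mul_nonneg ha.1 h
    simp only [interp]; linarith
  · have := mul_le_of_le_one_left h ha.2
    simp only [interp]; linarith

lemma interp_lt {a : ℝ} (hst : s < t) (ha : a < 1) : interp s t a < t := by
  have := mul_lt_of_lt_one_left (sub_pos.2 hst) ha
  simp only [interp]; linarith

lemma dual_hasDerivAt_comp (hT : IsTimeDependentTriple α β Q π) (ht : t ∈ Ioo α β) {θ : ℝ → ℝ}
    {ν : ℝ → X → ℝ} {w : X → ℝ} {r c : ℝ} (hθr : ∀ᶠ u in 𝓝 r, θ u ∈ Ioo α t)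
    (hθ : HasDerivAt θ c r) (hν : ∀ x, HasDerivAt (fun r => ν r x) (-w x) r) (x : X) :
    HasDerivAt (fun r => dualHeatProp α Q t (θ r) (ν r) x)
      (-dualHeatProp α Q t (θ r) w x -
        c * dualLaplacian (Q (θ r)) (dualHeatProp α Q t (θ r) (ν r)) x) r := by
  classical
  have hr := hθr.self_of_nhds
  have h1 : HasDerivAt (fun r => ∑ y, ν r y * dualHeatProp α Q t (θ r) (Pi.single y 1) x)
      (∑ y, (-w y * dualHeatProp α Q t (θ r) (Pi.single y 1) x + ν r y *
        (-dualLaplacian (Q (θ r)) (dualHeatProp α Q t (θ r) (Pi.single y 1)) x * c))) r :=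
    HasDerivAt.fun_sum fun y _ => (hν y).fun_mul
      ((hT.dual_hasDerivAt ht hr (Pi.single y 1) x).comp r hθ)
  refine (h1.congr_of_eventuallyEq ?_).congr_deriv ?_
  · filter_upwards [hθr] with u hu
    rw [hT.dual_eq_sum ht (Ioo_subset_Ioc_self hu)]
  · have e1 := hT.dual_eq_sum ht (Ioo_subset_Ioc_self hr) w x
    have e2 : dualLaplacian (Q (θ r)) (dualHeatProp α Q t (θ r) (ν r)) x =
        ∑ y, ν r y * dualLaplacian (Q (θ r)) (dualHeatProp α Q t (θ r) (Pi.single y 1)) x := by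
      simp only [dualLaplacian, hT.dual_eq_sum ht (Ioo_subset_Ioc_self hr) (ν r), Finset.mul_sum]
      rw [Finset.sum_comm]
      refine Finset.sum_congr rfl fun y _ => Finset.sum_congr rfl fun z _ => ?_
      rw [mul_left_comm]
    rw [e1, e2, Finset.sum_add_distrib, Finset.mul_sum, sub_eq_add_neg, ← Finset.sum_neg_distrib,
      ← Finset.sum_neg_distrib]
    congr 1
    · exact Finset.sum_congr rfl fun y _ => by ring
    · exact Finset.sum_congr rfl fun y _ => by ring

/-- The derivative of the dual value minus the entropy along the moving curve
`r ↦ P̂_{t, θ(r)} ν_r` is bounded by the action. -/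
lemma ofReal_le_action_of_gradientEstimate (hT : IsTimeDependentTriple α β Q π)
    (hgrad : GradientEstimate α β Q) (ht : t ∈ Ioo α β) {u : ℝ} (hu : u ∈ Ioo α t)
    {ν : X → ℝ} (hν : ν ∈ stdSimplex ℝ X) (V : X → X → ℝ) (φ φ' : X → ℝ) {l h : ℝ} (hl : 0 < l)
    (hHJ : ∀ σ ∈ stdSimplex ℝ X, pairing φ' σ + 1 / 2 * gam (Q u) σ φ ≤ 0) :
    ENNReal.ofReal (l * pairing φ' (dualHeatProp α Q t u ν) +
      pairing (fun x => φ x - h * (Real.log (dualHeatProp α Q t u ν x) - Real.log (π u x)))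
        (fun x => -dualHeatProp α Q t u (divg V) x -
          (l * h) * dualLaplacian (Q u) (dualHeatProp α Q t u ν) x)) ≤
      ENNReal.ofReal (1 / (2 * l)) * action (Q t) ν V := by
  have hu' : u ∈ Ioo α β := ⟨hu.1, hu.2.trans ht.2⟩
  set σ := dualHeatProp α Q t u ν with hσdef
  have hσ : σ ∈ stdSimplex ℝ X := hT.dual_mem ht (Ioo_subset_Ioc_self hu) hν
  set ψ : X → ℝ := fun x => φ x - h * (Real.log (σ x) - Real.log (π u x)) with hψ
  refine le_trans (ENNReal.ofReal_le_ofReal ?_) (ofReal_le_action (hT.nonnegRates ht) hν.1 V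
    (heatProp β Q t u ψ) hl)
  have h1 := neg_mul_pairing_dualLaplacian_le (hT.triple u hu') (hT.dual_pos ht hu hν) φ h
  have h2 := hgrad u hu' t ht hu.2.le ν hν ψ
  have h3 := pairing_heatProp hT hu' ht hu.2.le ψ (divg V)
  have h4 := hHJ σ hσ
  have h5 : pairing ψ (fun x => -dualHeatProp α Q t u (divg V) x -
      (l * h) * dualLaplacian (Q u) σ x) = -pairing ψ (dualHeatProp α Q t u (divg V)) -
        (l * h) * pairing ψ (dualLaplacian (Q u) σ) := by
    simp only [pairing, Finset.mul_sum, ← Finset.sum_neg_distrib, ← Finset.sum_sub_distrib]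
    exact Finset.sum_congr rfl fun x _ => by ring
  rw [h5, h3]
  have h1' := mul_le_mul_of_nonneg_left h1 hl.le
  have h2' := mul_le_mul_of_nonneg_left h2 (half_pos hl).le
  have h4' := mul_le_mul_of_nonneg_left h4 hl.le
  linarith

set_option maxHeartbeats 400000 in
lemma pairing_sub_entropy_le (hT : IsTimeDependentTriple α β Q π) (hgrad : GradientEstimate α β Q)
    (hs : s ∈ Ioo α β) (ht : t ∈ Ioo α β) (hst : s < t) {a l : ℝ} (ha : 0 ≤ a) (hl : 0 < l)
    (hal : a + l ≤ 1) {γ₀ γ₁ : X → ℝ} {ν : ℝ → X → ℝ} {V : ℝ → X → X → ℝ}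
    (hCE : ContinuityEq γ₀ γ₁ ν V) (hfin : totalAction (Q t) ν V ≠ ⊤) {φ : ℝ → X → ℝ}
    (hφ : IsHJSubsolution Q s t φ) :
    (pairing (φ (a + l)) (dualHeatProp α Q t (interp s t (a + l)) γ₁) -
        (t - s) * entropy (π (interp s t (a + l)))
          (dualHeatProp α Q t (interp s t (a + l)) γ₁)) -
      (pairing (φ a) (dualHeatProp α Q t (interp s t a) γ₀) -
        (t - s) * entropy (π (interp s t a)) (dualHeatProp α Q t (interp s t a) γ₀)) ≤
      1 / (2 * l) * (totalAction (Q t) ν V).toReal + l * (t - s) ^ 2 * ∫ r in (0 : ℝ)..1,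
        pairing (fun x => deriv (fun u => Real.log (π u x)) (interp s t (a + r * l)))
          (dualHeatProp α Q t (interp s t (a + r * l)) (ν r)) := by
  set h := t - s with hh
  have hh0 : 0 < h := sub_pos.2 hst
  set θ : ℝ → ℝ := fun r => interp s t (a + r * l) with hθ
  have hθd : ∀ r, HasDerivAt θ (l * h) r := fun r => by
    have : HasDerivAt (fun r => s + (a + r * l) * h) (l * h) r := by
      simpa using ((((hasDerivAt_id r).mul_const l).const_add a).mul_const h).const_add s
    exact this
  have hθc : Continuous θ := continuous_iff_continuousAt.2 fun r => (hθd r).continuousAt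
  have hmem : ∀ r ∈ Icc (0 : ℝ) 1, a + r * l ∈ Icc (0 : ℝ) 1 := fun r hr =>
    ⟨add_nonneg ha (mul_nonneg hr.1 hl.le), by
      have := mul_le_of_le_one_left hl.le hr.2
      linarith⟩
  have hθm : MapsTo θ (Icc 0 1) (Icc s t) := fun r hr => interp_mem hst.le (hmem r hr)
  have hlt : ∀ r ∈ Ioo (0 : ℝ) 1, a + r * l ∈ Ioo (0 : ℝ) 1 := fun r hr =>
    ⟨add_pos_of_nonneg_of_pos ha (mul_pos hr.1 hl), by
      have := mul_lt_of_lt_one_left hl hr.2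
      linarith⟩
  have hθo : ∀ r ∈ Ioo (0 : ℝ) 1, θ r ∈ Ioo α t := fun r hr =>
    ⟨hs.1.trans_le (hθm (Ioo_subset_Icc_self hr)).1, interp_lt hst (hlt r hr).2⟩
  have hθα : MapsTo θ (Icc 0 1) (Ioc α t) := fun r hr => ⟨hs.1.trans_le (hθm hr).1, (hθm hr).2⟩
  have hθβ : ∀ r ∈ Icc (0 : ℝ) 1, θ r ∈ Ioo α β := fun r hr =>
    ⟨(hθα hr).1, (hθα hr).2.trans_lt ht.2⟩
  set σ : ℝ → X → ℝ := fun r => dualHeatProp α Q t (θ r) (ν r) with hσ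
  have hσc : ContinuousOn σ (Icc 0 1) :=
    hT.continuousOn_dual_comp ht hθc.continuousOn hθα hCE.continuousOn
  have hσmem : ∀ r ∈ Icc (0 : ℝ) 1, σ r ∈ stdSimplex ℝ X := fun r hr =>
    hT.dual_mem ht (hθα hr) (hCE.mem r hr)
  have hσpos : ∀ r ∈ Ioo (0 : ℝ) 1, ∀ x, 0 < σ r x := fun r hr =>
    hT.dual_pos ht (hθo r hr) (hCE.mem r (Ioo_subset_Icc_self hr))
  obtain ⟨L, hL⟩ := hT.exists_lipschitz_log hs.1 ht.2
  set p : ℝ → X → ℝ := fun r x => Real.log (π (θ r) x) with hp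
  have hθcd : ContDiff ℝ 1 θ := by
    have : ContDiff ℝ 1 fun r : ℝ => s + (a + r * l) * h := by fun_prop
    exact this
  have hθAC : ∀ b c, AbsolutelyContinuousOnInterval θ b c := fun b c =>
    hθcd.contDiffOn.absolutelyContinuousOnInterval
  have hθu : MapsTo θ (uIcc 0 1) (Icc s t) := by
    rw [uIcc_of_le zero_le_one]
    exact hθm
  have hpAC : ∀ x, AbsolutelyContinuousOnInterval (fun r => p r x) 0 1 := fun x =>
    absolutelyContinuousOnInterval_lipschitz_comp (f := θ) (g := fun u => Real.log (π u x))
      (hθAC 0 1) (hL x) hθu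
  set G : ℝ → ℝ := fun r => pairing (φ (a + r * l)) (σ r) -
    h * ∑ x, (σ r x * Real.log (σ r x) - σ r x * p r x) with hG
  have hGeq : ∀ r ∈ Icc (0 : ℝ) 1, G r = pairing (φ (a + r * l)) (σ r) -
      h * entropy (π (θ r)) (σ r) := fun r hr => by
    rw [entropy_eq (hT.triple _ (hθβ r hr)).pos]
  have hsub : ∀ δ ∈ Ioo (0 : ℝ) (1 / 2), uIcc δ (1 - δ) ⊆ Ioo (0 : ℝ) 1 := fun δ hδ => by
    rw [uIcc_of_le (by linarith [hδ.2])]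
    exact fun r hr => ⟨hδ.1.trans_le hr.1, hr.2.trans_lt (by linarith [hδ.1])⟩
  have hsub' : ∀ δ ∈ Ioo (0 : ℝ) (1 / 2), uIcc δ (1 - δ) ⊆ uIcc (0 : ℝ) 1 := fun δ hδ => by
    rw [uIcc_of_le zero_le_one]
    exact (hsub δ hδ).trans Ioo_subset_Icc_self
  have hcd : ContDiff ℝ 1 fun r : ℝ => a + r * l := by fun_prop
  have hσAC : ∀ δ ∈ Ioo (0 : ℝ) (1 / 2), ∀ x,
      AbsolutelyContinuousOnInterval (fun r => σ r x) δ (1 - δ) := by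
    classical
    intro δ hδ x
    have h1 : AbsolutelyContinuousOnInterval
        (fun r => ∑ y, ν r y * dualHeatProp α Q t (θ r) (Pi.single y 1) x) δ (1 - δ) := by
      refine absolutelyContinuousOnInterval_finset_sum _ fun y _ =>
        ((hCE.absolutelyContinuous y).mono (hsub' δ hδ)).fun_mul ?_
      obtain ⟨K, hK⟩ := hT.exists_lipschitz_dual ht hs.1 (v := θ (1 - δ))
        (hθo (1 - δ) (hsub δ hδ right_mem_uIcc)).2 (Pi.single y 1) x
      refine absolutelyContinuousOnInterval_lipschitz_comp (f := θ)
        (g := fun u => dualHeatProp α Q t u (Pi.single y 1) x) (hθAC δ (1 - δ)) hK fun r hr => ?_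
      refine ⟨(hθm (Ioo_subset_Icc_self (hsub δ hδ hr))).1, ?_⟩
      rw [uIcc_of_le (by linarith [hδ.2])] at hr
      have := mul_le_mul_of_nonneg_right (mul_le_mul_of_nonneg_right hr.2 hl.le) hh0.le
      simp only [hθ, interp, ← hh]
      linarith
    refine absolutelyContinuousOnInterval_congr h1 fun r hr => ?_
    simp only [hσ]
    rw [hT.dual_eq_sum ht (hθα (Ioo_subset_Icc_self (hsub δ hδ hr)))]
  have hAC : ∀ δ ∈ Ioo (0 : ℝ) (1 / 2), AbsolutelyContinuousOnInterval G δ (1 - δ) := by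
    intro δ hδ
    refine AbsolutelyContinuousOnInterval.fun_sub
      (absolutelyContinuousOnInterval_finset_sum _ fun x _ =>
        (hφ.absolutelyContinuous hcd (fun r hr => hmem r
          (Ioo_subset_Icc_self (hsub δ hδ hr))) x).fun_mul (hσAC δ hδ x))
      (AbsolutelyContinuousOnInterval.const_mul h
        (absolutelyContinuousOnInterval_finset_sum _ fun x _ =>
          AbsolutelyContinuousOnInterval.fun_sub ((hσAC δ hδ x).fun_mul ?_)
            ((hσAC δ hδ x).fun_mul ((hpAC x).mono (hsub' δ hδ)))))
    obtain ⟨r₀, hr₀, hmin⟩ := isCompact_uIcc.exists_isMinOn nonempty_uIcc (hσAC δ hδ x).continuousOn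
    exact absolutelyContinuousOnInterval_lipschitz_comp (f := fun r => σ r x) (g := Real.log)
      (hσAC δ hδ x)
      (lipschitzOnWith_log (hσpos r₀ (hsub δ hδ hr₀) x)) fun r hr => hmin hr
  have hGc : ContinuousOn G (Icc 0 1) := by
    refine ContinuousOn.sub (continuousOn_finsetSum _ fun x _ => ContinuousOn.mul ?_
      (continuousOn_pi.1 hσc x)) (continuousOn_const.mul (continuousOn_finsetSum _ fun x _ =>
        ContinuousOn.sub ?_ ((continuousOn_pi.1 hσc x).mul ?_)))
    · exact (continuousOn_pi.1 hφ.contDiffOn.continuousOn x).comp hcd.continuous.continuousOn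
        fun r hr => hmem r hr
    · exact Real.continuous_mul_log.comp_continuousOn (continuousOn_pi.1 hσc x)
    · have := (hpAC x).continuousOn
      rwa [uIcc_of_le zero_le_one] at this
  set k : ℝ → ℝ := fun r => l * h ^ 2 *
    pairing (fun x => deriv (fun u => Real.log (π u x)) (θ r)) (σ r) with hk
  have hkint : IntervalIntegrable k volume 0 1 :=
    (hT.intervalIntegrable_pairing_deriv_log hs ht hθc hθm hσc).const_mul _
  have hpdiff : ∀ᵐ r : ℝ, ∀ x, r ∈ uIcc (0 : ℝ) 1 → DifferentiableAt ℝ (fun r => p r x) r :=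
    ae_all_iff.2 fun x => (hpAC x).ae_differentiableAt
  have hmain := sub_le_of_deriv_le hGc hAC hkint
    (B := fun r => ENNReal.ofReal (1 / (2 * l)) * action (Q t) (ν r) (V r)) (by
      rw [lintegral_const_mul' _ _ ENNReal.ofReal_ne_top]
      exact ENNReal.mul_ne_top ENNReal.ofReal_ne_top hfin) (by
      filter_upwards [hCE.ae_hasDerivAt, hpdiff] with r hr hpr hr'
      have hrI := Ioo_subset_Icc_self hr'
      have hp' : ∀ x, HasDerivAt (fun r => p r x)
          (l * h * deriv (fun u => Real.log (π u x)) (θ r)) r := by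
        intro x
        have h1 := (hpr x (by rwa [uIcc_of_le zero_le_one])).hasDerivAt
        have h2 : DifferentiableAt ℝ (fun u => Real.log (π u x)) (θ r) := by
          have h3 : (fun u => Real.log (π u x)) =
              (fun r => p r x) ∘ fun u => ((u - s) / h - a) / l := by
            ext u
            simp only [hp, hθ, interp, Function.comp, ← hh]
            congr 2
            field_simp
            ring
          have h4 : ((θ r - s) / h - a) / l = r := by
            simp only [hθ, interp, ← hh]
            field_simp
            ring
          rw [h3]
          refine DifferentiableAt.comp _ ?_ (by fun_prop)
          rw [h4]
          exact h1.differentiableAt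
        exact (h2.hasDerivAt.comp r (hθd r)).congr_deriv (by ring)
      set σ' : X → ℝ := fun x => -dualHeatProp α Q t (θ r) (divg (V r)) x -
        (l * h) * dualLaplacian (Q (θ r)) (σ r) x with hσ'
      have hσd : ∀ x, HasDerivAt (fun r => σ r x) (σ' x) r :=
        dual_hasDerivAt_comp hT ht (mem_of_superset (Ioo_mem_nhds hr'.1 hr'.2)
          fun u hu => hθo u hu) (hθd r) (hr hr')
      have hφd : ∀ x, HasDerivAt (fun r => φ (a + r * l) x) (l * deriv φ (a + r * l) x) r := by
        intro x
        have h1 : HasDerivAt (fun r : ℝ => a + r * l) l r := by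
          simpa using ((hasDerivAt_id r).mul_const l).const_add a
        exact ((hφ.hasDerivAt (hlt r hr') x).comp r h1).congr_deriv (mul_comm _ _)
      have hsum0 : ∑ x, σ' x = 0 := by
        have h1 : HasDerivAt (fun r => ∑ x, σ r x) (∑ x, σ' x) r :=
          HasDerivAt.fun_sum fun x _ => hσd x
        refine h1.unique ((hasDerivAt_const r (1 : ℝ)).congr_of_eventuallyEq ?_)
        filter_upwards [Ioo_mem_nhds hr'.1 hr'.2] with u hu
        exact (hσmem u (Ioo_subset_Icc_self hu)).2
      have hGd : HasDerivAt G (pairing (fun x => l * deriv φ (a + r * l) x) (σ r) +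
          pairing (φ (a + r * l)) σ' - h * ∑ x, ((σ' x * Real.log (σ r x) + σ r x *
            (σ' x / σ r x)) - (σ' x * p r x + σ r x *
              (l * h * deriv (fun u => Real.log (π u x)) (θ r))))) r :=
        (hasDerivAt_pairing hφd hσd).fun_sub (HasDerivAt.const_mul h (HasDerivAt.fun_sum fun x _ =>
          ((hσd x).fun_mul ((hσd x).log (hσpos r hr' x).ne')).fun_sub ((hσd x).fun_mul (hp' x))))
      rw [hGd.deriv]
      have hle := ofReal_le_action_of_gradientEstimate hT hgrad ht (hθo r hr') (hCE.mem r hrI)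
        (V r) (φ (a + r * l)) (deriv φ (a + r * l)) (h := h) hl
        (hφ.subsolution _ (hlt r hr'))
      refine le_trans (ENNReal.ofReal_le_ofReal (le_of_eq ?_)) hle
      have e1 : ∑ x, ((σ' x * Real.log (σ r x) + σ r x * (σ' x / σ r x)) - (σ' x * p r x + σ r x *
              (l * h * deriv (fun u => Real.log (π u x)) (θ r)))) =
          ∑ x, (Real.log (σ r x) - p r x) * σ' x + ∑ x, σ' x -
            l * h * pairing (fun x => deriv (fun u => Real.log (π u x)) (θ r)) (σ r) := by
        simp only [pairing, Finset.mul_sum, ← Finset.sum_add_distrib, ← Finset.sum_sub_distrib]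
        refine Finset.sum_congr rfl fun x _ => ?_
        rw [mul_div_cancel₀ _ (hσpos r hr' x).ne']
        ring
      have e2 : pairing (fun x => φ (a + r * l) x - h * (Real.log (σ r x) - p r x)) σ' =
          pairing (φ (a + r * l)) σ' - h * ∑ x, (Real.log (σ r x) - p r x) * σ' x := by
        simp only [pairing, Finset.mul_sum, ← Finset.sum_sub_distrib]
        exact Finset.sum_congr rfl fun x _ => by ring
      have e3 : pairing (fun x => l * deriv φ (a + r * l) x) (σ r) =
          l * pairing (deriv φ (a + r * l)) (σ r) := by
        simp only [pairing, Finset.mul_sum, mul_assoc]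
      change _ = l * pairing (deriv φ (a + r * l)) (σ r) +
        pairing (fun x => φ (a + r * l) x - h * (Real.log (σ r x) - p r x)) σ'
      rw [e1, e2, e3, hsum0]
      simp only [hk]
      ring)
  rw [lintegral_const_mul' _ _ ENNReal.ofReal_ne_top, ENNReal.toReal_mul,
    ENNReal.toReal_ofReal (by positivity), hGeq 1 ⟨zero_le_one, le_rfl⟩,
    hGeq 0 ⟨le_rfl, zero_le_one⟩] at hmain
  simp only [hσ, hθ, hk, hCE.left, hCE.right, one_mul, zero_mul, add_zero,
    intervalIntegral.integral_const_mul] at hmain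
  exact hmain

end Main

/-! ### The Euclidean distance along curves of finite action -/

section Euclid

lemma exists_gam_bound {Q : X → X → ℝ} (hQ : NonnegRates Q) (ψ : X → ℝ) :
    ∃ C, 0 ≤ C ∧ ∀ μ ∈ stdSimplex ℝ X, gam Q μ ψ ≤ C := by
  obtain ⟨C, hC⟩ := (isCompact_stdSimplex ℝ X).exists_bound_of_continuousOn
    ((continuousOn_gam hQ ψ).mono fun μ hμ => hμ.1)
  exact ⟨max C 0, le_max_right _ _, fun μ hμ =>
    (le_abs_self _).trans ((hC μ hμ).trans (le_max_left _ _))⟩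

lemma exists_pairing_sub_le {Q : X → X → ℝ} (hQ : NonnegRates Q) (ψ : X → ℝ) :
    ∃ C, 0 ≤ C ∧ ∀ (μ₀ μ₁ : X → ℝ) (μ : ℝ → X → ℝ) (V : ℝ → X → X → ℝ), ContinuityEq μ₀ μ₁ μ V →
      totalAction Q μ V ≠ ⊤ → ∀ l : ℝ, 0 < l → ∀ r ∈ Icc (0 : ℝ) 1,
      pairing ψ (μ r) - pairing ψ μ₀ ≤ l * C + 1 / (2 * l) * (totalAction Q μ V).toReal := by
  obtain ⟨C, hC, hle⟩ := exists_gam_bound hQ ψ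
  refine ⟨C / 2, by positivity, fun μ₀ μ₁ μ V h hfin l hl r hr => ?_⟩
  have hint : ∀ x, IntervalIntegrable (fun a => divg (V a) x) volume 0 r := fun x =>
    (h.intervalIntegrable_divg x).mono_set (by
      rw [uIcc_of_le zero_le_one, uIcc_of_le hr.1]
      exact Icc_subset_Icc_right hr.2)
  have e : pairing ψ (μ r) - pairing ψ μ₀ = ∫ a in (0 : ℝ)..r, -pairing ψ (divg (V a)) := by
    rw [intervalIntegral.integral_neg]
    simp only [pairing]
    rw [intervalIntegral.integral_finsetSum fun x _ => (hint x).const_mul (ψ x),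
      ← Finset.sum_sub_distrib, ← Finset.sum_neg_distrib]
    refine Finset.sum_congr rfl fun x _ => ?_
    rw [h.eqn' hr x, intervalIntegral.integral_const_mul]
    ring
  have hint' : IntervalIntegrable (fun a => -pairing ψ (divg (V a))) volume 0 r := by
    refine IntervalIntegrable.neg ?_
    have := IntervalIntegrable.sum (f := fun x a => ψ x * divg (V a) x) Finset.univ fun x _ =>
      (hint x).const_mul (ψ x)
    refine this.congr fun a _ => ?_
    simp [pairing]
  have hc : IntervalIntegrable (fun _ : ℝ => l / 2 * C) volume 0 r := intervalIntegrable_const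
  have h1 : ∫ a in (0 : ℝ)..r, (-pairing ψ (divg (V a)) - l / 2 * C) ≤
      1 / (2 * l) * (totalAction Q μ V).toReal := by
    rw [intervalIntegral.integral_of_le hr.1]
    refine (integral_le_toReal_lintegral (hint'.sub hc).1).trans ?_
    have e2 : 1 / (2 * l) * (totalAction Q μ V).toReal =
        (∫⁻ a in Icc (0 : ℝ) 1, ENNReal.ofReal (1 / (2 * l)) * action Q (μ a) (V a)).toReal := by
      rw [lintegral_const_mul' _ _ ENNReal.ofReal_ne_top, ENNReal.toReal_mul,
        ENNReal.toReal_ofReal (by positivity)]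
      rfl
    rw [e2]
    refine ENNReal.toReal_mono ?_ ?_
    · rw [lintegral_const_mul' _ _ ENNReal.ofReal_ne_top]
      exact ENNReal.mul_ne_top ENNReal.ofReal_ne_top hfin
    · refine (setLIntegral_mono' measurableSet_Ioc fun a ha => ?_).trans
        (lintegral_mono_set fun a ha => ⟨ha.1.le, ha.2.trans hr.2⟩)
      have hmem := h.mem a ⟨ha.1.le, ha.2.trans hr.2⟩
      refine le_trans (ENNReal.ofReal_le_ofReal ?_) (ofReal_le_action hQ hmem.1 (V a) ψ hl)
      have := mul_le_mul_of_nonneg_left (hle _ hmem) (half_pos hl).le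
      linarith
  rw [intervalIntegral.integral_sub hint' hc, ← e, intervalIntegral.integral_const,
    smul_eq_mul, sub_zero] at h1
  have h2 : r * (l / 2 * C) ≤ l / 2 * C := mul_le_of_le_one_left (by positivity) hr.2
  linarith

lemma exists_norm_sub_le_of_curve {Q : X → X → ℝ} (hQ : NonnegRates Q) :
    ∃ C, 0 ≤ C ∧ ∀ (μ₀ μ₁ : X → ℝ) (μ : ℝ → X → ℝ) (V : ℝ → X → X → ℝ), ContinuityEq μ₀ μ₁ μ V →
      totalAction Q μ V ≠ ⊤ → ∀ l : ℝ, 0 < l → ∀ r ∈ Icc (0 : ℝ) 1,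
      ‖μ r - μ₀‖ ≤ l * C + 1 / (2 * l) * (totalAction Q μ V).toReal := by
  classical
  have h1 := fun x : X => exists_pairing_sub_le hQ (Pi.single x 1)
  have h2 := fun x : X => exists_pairing_sub_le hQ (Pi.single x (-1))
  choose C hC hle using h1
  choose D hD hle' using h2
  have hpair : ∀ (x : X) (c : ℝ) (σ : X → ℝ), pairing (Pi.single x c) σ = c * σ x := fun x c σ => by
    simp [pairing, Pi.single_apply]
  refine ⟨∑ x, (C x + D x), Finset.sum_nonneg fun x _ => add_nonneg (hC x) (hD x),
    fun μ₀ μ₁ μ V h hfin l hl r hr => ?_⟩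
  have hS : ∀ x, C x + D x ≤ ∑ x, (C x + D x) := fun x =>
    Finset.single_le_sum (f := fun x => C x + D x) (fun x _ => add_nonneg (hC x) (hD x))
      (Finset.mem_univ x)
  have hS0 : 0 ≤ ∑ x, (C x + D x) := Finset.sum_nonneg fun x _ => add_nonneg (hC x) (hD x)
  refine (pi_norm_le_iff_of_nonneg (by positivity)).2 fun x => ?_
  have e1 := hle x μ₀ μ₁ μ V h hfin l hl r hr
  have e2 := hle' x μ₀ μ₁ μ V h hfin l hl r hr
  simp only [hpair] at e1 e2
  have e3 := mul_le_mul_of_nonneg_left ((le_add_of_nonneg_right (hD x)).trans (hS x)) hl.le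
  have e4 := mul_le_mul_of_nonneg_left ((le_add_of_nonneg_left (hC x)).trans (hS x)) hl.le
  rw [Pi.sub_apply, Real.norm_eq_abs, abs_le]
  constructor <;> linarith

end Euclid

section Value

variable {α β : ℝ} {Q : ℝ → X → X → ℝ} {π : ℝ → X → ℝ} {s t : ℝ}

lemma isHJSubsolution_zero (Q : ℝ → X → X → ℝ) (s t : ℝ) :
    IsHJSubsolution Q s t (fun _ _ => 0) where
  contDiffOn := contDiffOn_const
  subsolution a _ μ _ := by
    have : deriv (fun (_ : ℝ) (_ : X) => (0 : ℝ)) a = 0 := deriv_const a _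
    simp [pairing, gam, this]

lemma twoTimeCost_le {μ₀ μ₁ : X → ℝ} {S : ℝ}
    (h : ∀ φ, IsHJSubsolution Q s t φ → pairing (φ 1) μ₁ - pairing (φ 0) μ₀ ≤ S) :
    twoTimeCost Q s t μ₀ μ₁ ≠ ⊤ ∧ 1 / 2 * (twoTimeCost Q s t μ₀ μ₁).toReal ^ 2 ≤ S := by
  have hS : 0 ≤ S := by simpa [pairing] using h _ (isHJSubsolution_zero Q s t)
  have hsup : (⨆ (φ : ℝ → X → ℝ) (_ : IsHJSubsolution Q s t φ),
      ENNReal.ofReal (pairing (φ 1) μ₁ - pairing (φ 0) μ₀)) ≤ ENNReal.ofReal S :=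
    iSup₂_le fun φ hφ => ENNReal.ofReal_le_ofReal (h φ hφ)
  have hle : twoTimeCost Q s t μ₀ μ₁ ≤ ENNReal.ofReal √(2 * S) := by
    rw [Real.sqrt_eq_rpow, ← ENNReal.ofReal_rpow_of_nonneg (by positivity) (by norm_num),
      ENNReal.ofReal_mul (by norm_num), twoTimeCost]
    refine ENNReal.rpow_le_rpow (mul_le_mul' (by simp) hsup) (by norm_num)
  refine ⟨ne_top_of_le_ne_top ENNReal.ofReal_ne_top hle, ?_⟩
  have h2 := ENNReal.toReal_mono ENNReal.ofReal_ne_top hle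
  rw [ENNReal.toReal_ofReal (Real.sqrt_nonneg _)] at h2
  have h3 := pow_le_pow_left₀ ENNReal.toReal_nonneg h2 2
  rw [Real.sq_sqrt (by positivity)] at h3
  linarith

lemma exists_curve_action_le {Q : X → X → ℝ} {μ₀ μ₁ : X → ℝ} {A : ℝ} (hA : 0 ≤ A)
    (h : transportDist Q μ₀ μ₁ ≤ ENNReal.ofReal A) {B : ℝ} (hB : A ^ 2 < B) :
    ∃ (μ : ℝ → X → ℝ) (V : ℝ → X → X → ℝ), ContinuityEq μ₀ μ₁ μ V ∧ totalAction Q μ V ≠ ⊤ ∧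
      (totalAction Q μ V).toReal ≤ B := by
  have hB0 : 0 ≤ B := (sq_nonneg A).trans hB.le
  have h1 : transportDist Q μ₀ μ₁ ^ 2 < ENNReal.ofReal B := by
    refine (pow_le_pow_left' h 2).trans_lt ?_
    rw [← ENNReal.ofReal_pow hA]
    exact (ENNReal.ofReal_lt_ofReal_iff_of_nonneg (sq_nonneg A)).2 hB
  obtain ⟨μ, V, hCE, hlt⟩ := exists_curve_of_lt h1
  exact ⟨μ, V, hCE, hlt.ne_top, ENNReal.toReal_le_of_le_ofReal hB0 hlt.le⟩

lemma interp_zero (s t : ℝ) : interp s t 0 = s := by simp [interp]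

lemma interp_one (s t : ℝ) : interp s t 1 = t := by simp [interp]

lemma continuous_interp (s t : ℝ) : Continuous (interp s t) := by unfold interp; fun_prop

lemma pairing_sub_le_of_static_dist (h : IsMarkovTriple (Q t) (π t)) {μ₀ μ₁ : X → ℝ}
    (hμ₀ : μ₀ ∈ stdSimplex ℝ X) (hμ₁ : μ₁ ∈ stdSimplex ℝ X) {φ : ℝ → X → ℝ}
    (hφ : IsHJSubsolution Q t t φ) : pairing (φ 1) μ₁ - pairing (φ 0) μ₀ ≤
      1 / 2 * (transportDist (Q t) μ₀ μ₁).toReal ^ 2 := by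
  refine le_of_forall_pos_le_add fun ε hε => ?_
  obtain ⟨μ, V, hCE, hfin, hle⟩ := exists_curve_action_le ENNReal.toReal_nonneg
    (ENNReal.ofReal_toReal (h.transportDist_ne_top hμ₀ hμ₁)).symm.le
    (lt_add_of_pos_right _ hε)
  have := pairing_sub_le_of_static h.nonnegRates hCE hfin hφ
  linarith

/-- A bound for the two-time cost without the geodesic correction. -/
lemma pairing_sub_le_of_bound (hT : IsTimeDependentTriple α β Q π)
    (hgrad : GradientEstimate α β Q) (hs : s ∈ Ioo α β) (ht : t ∈ Ioo α β) (hst : s < t) {L : ℝ}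
    (hL : ∀ r ∈ Icc s t, ∀ x, |deriv (fun r => Real.log (π r x)) r| ≤ L) {μ₀ μ₁ : X → ℝ}
    (hμ₀ : μ₀ ∈ stdSimplex ℝ X) (hμ₁ : μ₁ ∈ stdSimplex ℝ X) {φ : ℝ → X → ℝ}
    (hφ : IsHJSubsolution Q s t φ) :
    pairing (φ 1) μ₁ - pairing (φ 0) (dualHeatProp α Q t s μ₀) ≤
      1 / 2 * (transportDist (Q t) μ₀ μ₁).toReal ^ 2 + (t - s) ^ 2 * L +
        (t - s) * (entropy (π t) μ₁ - entropy (π s) (dualHeatProp α Q t s μ₀)) := by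
  refine le_of_forall_pos_le_add fun ε hε => ?_
  obtain ⟨μ, V, hCE, hfin, hle⟩ := exists_curve_action_le ENNReal.toReal_nonneg
    (ENNReal.ofReal_toReal ((hT.triple t ht).transportDist_ne_top hμ₀ hμ₁)).symm.le
    (lt_add_of_pos_right _ hε)
  have h1 := pairing_sub_entropy_le hT hgrad hs ht hst le_rfl one_pos (by norm_num) hCE hfin hφ
  simp only [zero_add, interp_zero, interp_one, hT.dual_self ht, mul_one, one_mul] at h1
  have h2 : ∫ r in (0 : ℝ)..1, pairing (fun x => deriv (fun u => Real.log (π u x))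
      (interp s t r)) (dualHeatProp α Q t (interp s t r) (μ r)) ≤ L := by
    refine (le_abs_self _).trans ?_
    have := intervalIntegral.norm_integral_le_of_norm_le_const (a := (0 : ℝ)) (b := 1) (C := L)
      (f := fun r => pairing (fun x => deriv (fun u => Real.log (π u x))
        (interp s t r)) (dualHeatProp α Q t (interp s t r) (μ r))) fun r hr => by
          rw [uIoc_of_le zero_le_one] at hr
          have hrI : r ∈ Icc (0 : ℝ) 1 := ⟨hr.1.le, hr.2⟩
          have hm := interp_mem hst.le hrI
          exact abs_pairing_le (fun x => hL _ hm x)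
            (hT.dual_mem ht ⟨hs.1.trans_le hm.1, hm.2⟩ (hCE.mem r hrI))
    simpa using this
  have h3 := mul_le_mul_of_nonneg_left h2 (sq_nonneg (t - s))
  linarith

end Value

section Geodesic

variable {α β : ℝ} {Q : ℝ → X → X → ℝ} {π : ℝ → X → ℝ} {s t : ℝ}

lemma sum_abs_dual_le (hT : IsTimeDependentTriple α β Q π) (ht : t ∈ Ioo α β) {u : ℝ}
    (hu : u ∈ Ioc α t) (w : X → ℝ) : ∑ x, |dualHeatProp α Q t u w x| ≤ ∑ y, |w y| := by
  classical
  have hmem : ∀ y : X, dualHeatProp α Q t u (Pi.single y 1) ∈ stdSimplex ℝ X := fun y =>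
    hT.dual_mem ht hu (single_mem_stdSimplex ℝ y)
  calc ∑ x, |dualHeatProp α Q t u w x|
      ≤ ∑ x, ∑ y, |w y| * dualHeatProp α Q t u (Pi.single y 1) x :=
        Finset.sum_le_sum fun x _ => by
          rw [hT.dual_eq_sum ht hu w]
          refine (Finset.abs_sum_le_sum_abs _ _).trans (le_of_eq (Finset.sum_congr rfl fun y _ => ?_))
          rw [abs_mul]
          congr 1
          convert! abs_of_nonneg ((hmem y).1 x)
    _ = ∑ y, |w y| := by
        rw [Finset.sum_comm]
        simp only [← Finset.mul_sum, (hmem _).2, mul_one]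

lemma pairing_dual_sub_le (hT : IsTimeDependentTriple α β Q π) (ht : t ∈ Ioo α β) {u : ℝ}
    (hu : u ∈ Ioc α t) {p : X → ℝ} {L : ℝ} (hp : ∀ x, |p x| ≤ L) (hL : 0 ≤ L) (μ ν : X → ℝ) :
    pairing p (dualHeatProp α Q t u μ) ≤
      pairing p (dualHeatProp α Q t u ν) + L * (Fintype.card X * ‖μ - ν‖) := by
  have h1 : dualHeatProp α Q t u (μ - ν) = dualHeatProp α Q t u μ - dualHeatProp α Q t u ν :=
    (hT.dualLin ht hu).map_sub μ ν
  have h2 : pairing p (dualHeatProp α Q t u μ) - pairing p (dualHeatProp α Q t u ν) =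
      pairing p (dualHeatProp α Q t u (μ - ν)) := by
    rw [h1]
    exact (pairing_sub_right _ _ _).symm
  have h3 : pairing p (dualHeatProp α Q t u (μ - ν)) ≤ L * ∑ y, |(μ - ν) y| := by
    refine le_trans ?_ (mul_le_mul_of_nonneg_left (sum_abs_dual_le hT ht hu (μ - ν)) hL)
    rw [Finset.mul_sum]
    refine Finset.sum_le_sum fun x _ => (le_abs_self _).trans ?_
    rw [abs_mul]
    exact mul_le_mul_of_nonneg_right (hp x) (abs_nonneg _)
  have h4 : ∑ y, |(μ - ν) y| ≤ Fintype.card X * ‖μ - ν‖ := by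
    refine (Finset.sum_le_sum fun y _ => norm_le_pi_norm (μ - ν) y).trans ?_
    simp
  have h5 := mul_le_mul_of_nonneg_left h4 hL
  linarith

variable {μ₀ μ₁ : X → ℝ} {γ : ℝ → X → ℝ}

lemma IsGeodesic.exists_lipschitz {Q : X → X → ℝ} {π : X → ℝ} (h : IsMarkovTriple Q π)
    (hγ : IsGeodesic Q μ₀ μ₁ γ) : ∃ C, 0 ≤ C ∧
      (∀ a ∈ Icc (0 : ℝ) 1, ∀ b ∈ Icc (0 : ℝ) 1, ‖γ b - γ a‖ ≤ C * |b - a|) ∧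
      ∀ l : ℝ, 0 < l → ∀ a ∈ Icc (0 : ℝ) 1, a + l ≤ 1 → ∀ ε : ℝ, 0 < ε → ε ≤ 1 →
        ∃ (ν : ℝ → X → ℝ) (V : ℝ → X → X → ℝ), ContinuityEq (γ a) (γ (a + l)) ν V ∧
          totalAction Q ν V ≠ ⊤ ∧
          (totalAction Q ν V).toReal ≤ l ^ 2 * ((transportDist Q μ₀ μ₁).toReal ^ 2 + ε) ∧
          ∀ r ∈ Icc (0 : ℝ) 1, ‖ν r - γ a‖ ≤ C * l := by
  obtain ⟨C, hC, hle⟩ := exists_norm_sub_le_of_curve h.nonnegRates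
  set d := (transportDist Q μ₀ μ₁).toReal with hd
  have hd0 : 0 ≤ d := ENNReal.toReal_nonneg
  have hfin : transportDist Q μ₀ μ₁ ≠ ⊤ := by
    rw [← hγ.left, ← hγ.right]
    exact h.transportDist_ne_top (hγ.mem 0 ⟨le_rfl, zero_le_one⟩) (hγ.mem 1 ⟨zero_le_one, le_rfl⟩)
  have hsp : ∀ a ∈ Icc (0 : ℝ) 1, ∀ l : ℝ, 0 < l → a + l ≤ 1 →
      transportDist Q (γ a) (γ (a + l)) ≤ ENNReal.ofReal (l * d) := by
    intro a ha l hl hal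
    rw [hγ.speed a ha (a + l) ⟨by linarith [ha.1], hal⟩, sub_add_cancel_left, abs_neg,
      abs_of_pos hl, ENNReal.ofReal_mul hl.le, hd, ENNReal.ofReal_toReal hfin]
  have hcurve : ∀ l : ℝ, 0 < l → ∀ a ∈ Icc (0 : ℝ) 1, a + l ≤ 1 → ∀ ε : ℝ, 0 < ε → ε ≤ 1 →
        ∃ (ν : ℝ → X → ℝ) (V : ℝ → X → X → ℝ), ContinuityEq (γ a) (γ (a + l)) ν V ∧
          totalAction Q ν V ≠ ⊤ ∧ (totalAction Q ν V).toReal ≤ l ^ 2 * (d ^ 2 + ε) ∧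
          ∀ r ∈ Icc (0 : ℝ) 1, ‖ν r - γ a‖ ≤ (C + (d ^ 2 + 1)) * l := by
    intro l hl a ha hal ε hε hε1
    obtain ⟨ν, V, hCE, hf, hA⟩ := exists_curve_action_le (mul_nonneg hl.le hd0) (hsp a ha l hl hal)
      (B := l ^ 2 * (d ^ 2 + ε)) (by rw [mul_pow]; nlinarith [pow_pos hl 2])
    refine ⟨ν, V, hCE, hf, hA, fun r hr => (hle _ _ ν V hCE hf l hl r hr).trans ?_⟩
    have h1 : 1 / (2 * l) * (totalAction Q ν V).toReal ≤ 1 / (2 * l) * (l ^ 2 * (d ^ 2 + ε)) :=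
      mul_le_mul_of_nonneg_left hA (by positivity)
    have h2 : 1 / (2 * l) * (l ^ 2 * (d ^ 2 + ε)) = l * ((d ^ 2 + ε) / 2) := by
      field_simp
    have h3 : l * ((d ^ 2 + ε) / 2) ≤ l * (d ^ 2 + 1) :=
      mul_le_mul_of_nonneg_left (by nlinarith [sq_nonneg d]) hl.le
    linarith
  have hone : ∀ a ∈ Icc (0 : ℝ) 1, ∀ b ∈ Icc (0 : ℝ) 1, a < b →
      ‖γ b - γ a‖ ≤ (C + (d ^ 2 + 1)) * (b - a) := by
    intro a ha b hb hab
    obtain ⟨ν, V, hCE, _, _, hn⟩ := hcurve (b - a) (sub_pos.2 hab) a ha (by linarith [hb.2]) 1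
      one_pos le_rfl
    have := hn 1 ⟨zero_le_one, le_rfl⟩
    rwa [hCE.right, add_sub_cancel] at this
  refine ⟨C + (d ^ 2 + 1), by positivity, fun a ha b hb => ?_, hcurve⟩
  rcases lt_trichotomy a b with hab | rfl | hab
  · rw [abs_of_pos (sub_pos.2 hab)]
    exact hone a ha b hb hab
  · simp
  · rw [abs_sub_comm, abs_of_pos (sub_pos.2 hab), norm_sub_rev]
    exact hone b hb a ha hab

lemma IsGeodesic.continuousOn {Q : X → X → ℝ} {π : X → ℝ} (h : IsMarkovTriple Q π)
    (hγ : IsGeodesic Q μ₀ μ₁ γ) : ContinuousOn γ (Icc 0 1) := by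
  obtain ⟨C, hC, hle, _⟩ := hγ.exists_lipschitz h
  exact (LipschitzOnWith.of_dist_le_mul (K := C.toNNReal) fun b hb a ha => by
    rw [dist_eq_norm, Real.dist_eq, Real.coe_toNNReal _ hC]
    exact hle a ha b hb).continuousOn

lemma pairing_sub_le_of_geodesic (hT : IsTimeDependentTriple α β Q π)
    (hgrad : GradientEstimate α β Q) (hs : s ∈ Ioo α β) (ht : t ∈ Ioo α β) (hst : s < t)
    (hγ : IsGeodesic (Q t) μ₀ μ₁ γ) {φ : ℝ → X → ℝ} (hφ : IsHJSubsolution Q s t φ) :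
    pairing (φ 1) μ₁ - pairing (φ 0) (dualHeatProp α Q t s μ₀) ≤
      1 / 2 * (transportDist (Q t) μ₀ μ₁).toReal ^ 2 +
        (t - s) * (entropy (π t) μ₁ - entropy (π s) (dualHeatProp α Q t s μ₀)) +
        (t - s) ^ 2 * ∫ a in (0 : ℝ)..1, pairing
            (fun x => deriv (fun r => Real.log (π r x)) (interp s t a))
            (dualHeatProp α Q t (interp s t a) (γ a)) := by
  set d := (transportDist (Q t) μ₀ μ₁).toReal with hd
  set k : ℝ → ℝ := fun a => pairing (fun x => deriv (fun r => Real.log (π r x)) (interp s t a))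
    (dualHeatProp α Q t (interp s t a) (γ a)) with hk
  have hγc := hγ.continuousOn (hT.triple t ht)
  obtain ⟨C, hC, hlip, hcurve⟩ := hγ.exists_lipschitz (hT.triple t ht)
  obtain ⟨L, hL0, hL⟩ := hT.exists_deriv_log_bound hs ht
  have hmapsI : ∀ r ∈ Icc (0 : ℝ) 1, interp s t r ∈ Ioc α t := fun r hr =>
    ⟨hs.1.trans_le (interp_mem hst.le hr).1, (interp_mem hst.le hr).2⟩
  have hkint : IntervalIntegrable k volume 0 1 :=
    hT.intervalIntegrable_pairing_deriv_log hs ht (continuous_interp s t)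
      (fun r hr => interp_mem hst.le hr) (hT.continuousOn_dual_comp ht
        (continuous_interp s t).continuousOn hmapsI hγc)
  set F : ℝ → ℝ := fun a => pairing (φ a) (dualHeatProp α Q t (interp s t a) (γ a)) -
    (t - s) * entropy (π (interp s t a)) (dualHeatProp α Q t (interp s t a) (γ a)) with hF
  set K : ℝ := (t - s) ^ 2 * (L * (Fintype.card X * (2 * C))) with hK
  have hstep : ∀ l : ℝ, 0 < l → ∀ a ∈ Icc (0 : ℝ) 1, a + l ≤ 1 → ∀ ε : ℝ, 0 < ε → ε ≤ 1 →
      F (a + l) - F a ≤ l * (1 / 2 * (d ^ 2 + ε)) + (t - s) ^ 2 * (∫ u in a..(a + l), k u) +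
        l * (K * l) := by
    intro l hl a ha hal ε hε hε1
    obtain ⟨ν, V, hCE, hfin, hA, hn⟩ := hcurve l hl a ha hal ε hε hε1
    have h1 := pairing_sub_entropy_le hT hgrad hs ht hst ha.1 hl hal hCE hfin hφ
    have hmem : ∀ r ∈ Icc (0 : ℝ) 1, a + r * l ∈ Icc (0 : ℝ) 1 := fun r hr =>
      ⟨add_nonneg ha.1 (mul_nonneg hr.1 hl.le), by
        have := mul_le_of_le_one_left hl.le hr.2
        linarith⟩
    have hθc : Continuous fun r => interp s t (a + r * l) :=
      (continuous_interp s t).comp (by fun_prop)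
    have hint1 := hT.intervalIntegrable_pairing_deriv_log hs ht hθc
      (fun r hr => interp_mem hst.le (hmem r hr)) (hT.continuousOn_dual_comp ht hθc.continuousOn
        (fun r hr => hmapsI _ (hmem r hr)) hCE.continuousOn)
    have hint2 := hT.intervalIntegrable_pairing_deriv_log hs ht hθc
      (fun r hr => interp_mem hst.le (hmem r hr)) (hT.continuousOn_dual_comp ht hθc.continuousOn
        (fun r hr => hmapsI _ (hmem r hr)) (ν := fun r => γ (a + r * l))
        (hγc.comp (Continuous.continuousOn (by fun_prop)) hmem))
    have h2 := intervalIntegral.integral_mono_on zero_le_one hint1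
      (hint2.add (intervalIntegrable_const (c := L * (Fintype.card X * (2 * C * l))))) fun r hr => by
        refine (pairing_dual_sub_le hT ht (hmapsI _ (hmem r hr))
          (fun x => hL _ (interp_mem hst.le (hmem r hr)) x) hL0 (ν r) (γ (a + r * l))).trans ?_
        refine add_le_add_right (mul_le_mul_of_nonneg_left (mul_le_mul_of_nonneg_left ?_
          (Nat.cast_nonneg _)) hL0) _
        have h3 := hn r hr
        have h4 := hlip a ha (a + r * l) (hmem r hr)
        rw [add_sub_cancel_left, abs_of_nonneg (mul_nonneg hr.1 hl.le)] at h4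
        have h5 : C * (r * l) ≤ C * l :=
          mul_le_mul_of_nonneg_left (mul_le_of_le_one_left hl.le hr.2) hC
        calc ‖ν r - γ (a + r * l)‖ ≤ ‖ν r - γ a‖ + ‖γ a - γ (a + r * l)‖ := norm_sub_le_norm_sub_add_norm_sub _ _ _
          _ ≤ C * l + C * l := by
            rw [norm_sub_rev (γ a)]
            exact add_le_add h3 (h4.trans h5)
          _ = 2 * C * l := by ring
    rw [intervalIntegral.integral_add hint2 intervalIntegrable_const,
      intervalIntegral.integral_const] at h2
    have h6 : l * ∫ r in (0 : ℝ)..1, pairing (fun x => deriv (fun u => Real.log (π u x))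
        (interp s t (a + r * l))) (dualHeatProp α Q t (interp s t (a + r * l)) (γ (a + r * l))) =
        ∫ u in a..(a + l), k u := by
      have := intervalIntegral.mul_integral_comp_add_mul (a := (0 : ℝ)) (b := 1) (f := k) l a
      rw [mul_zero, add_zero, mul_one] at this
      rw [← this]
      simp only [hk, mul_comm l]
    have h7 := mul_le_mul_of_nonneg_left h2 (mul_nonneg hl.le (sq_nonneg (t - s)))
    have h8 : 1 / (2 * l) * (totalAction (Q t) ν V).toReal ≤ l * (1 / 2 * (d ^ 2 + ε)) := by
      refine (mul_le_mul_of_nonneg_left hA (by positivity)).trans (le_of_eq ?_)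
      rw [← hd]
      field_simp
    rw [← h6]
    simp only [hF, hK]
    simp only [sub_zero, one_smul] at h7
    linarith
  have hn : ∀ n : ℕ, 0 < n → ∀ ε : ℝ, 0 < ε → ε ≤ 1 → F 1 - F 0 ≤
      1 / 2 * (d ^ 2 + ε) + (t - s) ^ 2 * (∫ u in (0 : ℝ)..1, k u) + K / n := by
    intro n hn ε hε hε1
    have hn' : (0 : ℝ) < n := Nat.cast_pos.2 hn
    have hadd : ∀ i : ℕ, (i : ℝ) / n + 1 / n = ((i + 1 : ℕ) : ℝ) / n := fun i => by
      push_cast; ring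
    have hin : ∀ i : ℕ, i ≤ n → (i : ℝ) / n ∈ Icc (0 : ℝ) 1 := fun i hi =>
      ⟨by positivity, (div_le_one hn').2 (Nat.cast_le.2 hi)⟩
    have hsum := Finset.sum_le_sum fun i (hi : i ∈ Finset.range n) =>
      hstep (1 / n) (by positivity) (i / n) (hin i (Finset.mem_range.1 hi).le)
        (by rw [hadd]; exact (hin _ (Finset.mem_range.1 hi)).2) ε hε hε1
    simp only [hadd] at hsum
    rw [Finset.sum_range_sub (fun i : ℕ => F (i / n)), Finset.sum_add_distrib,
      Finset.sum_add_distrib, ← Finset.mul_sum _ _ ((t - s) ^ 2),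
      intervalIntegral.sum_integral_adjacent_intervals (a := fun i : ℕ => (i : ℝ) / n)
        fun i hi => hkint.mono_set (by
          rw [uIcc_of_le zero_le_one]
          exact (convex_Icc (0 : ℝ) 1).ordConnected.uIcc_subset (hin i hi.le) (hin (i + 1) hi))] at hsum
    simp only [Finset.sum_const, Finset.card_range, nsmul_eq_mul, Nat.cast_zero, zero_div,
      div_self hn'.ne'] at hsum
    refine hsum.trans (le_of_eq ?_)
    field_simp
  have hlim : ∀ ε : ℝ, 0 < ε → ε ≤ 1 → F 1 - F 0 ≤
      1 / 2 * (d ^ 2 + ε) + (t - s) ^ 2 * (∫ u in (0 : ℝ)..1, k u) := by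
    intro ε hε hε1
    have h1 := (tendsto_const_div_atTop_nhds_zero_nat K).const_add
      (1 / 2 * (d ^ 2 + ε) + (t - s) ^ 2 * (∫ u in (0 : ℝ)..1, k u))
    rw [add_zero] at h1
    exact ge_of_tendsto h1 ((eventually_gt_atTop 0).mono fun n hn0 => hn n hn0 ε hε hε1)
  have hfinal : F 1 - F 0 ≤ 1 / 2 * d ^ 2 + (t - s) ^ 2 * (∫ u in (0 : ℝ)..1, k u) := by
    refine le_of_forall_pos_le_add fun ε hε => ?_
    have := hlim (min ε 1) (lt_min hε one_pos) (min_le_right _ _)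
    have h2 := min_le_left ε 1
    linarith
  simp only [hF, interp_zero, interp_one, hT.dual_self ht, hγ.left, hγ.right] at hfinal
  linarith

end Geodesic

/-! ### The dual heat flow as a curve in the space of measures -/

section Flow

variable {α β : ℝ} {Q : ℝ → X → X → ℝ} {π : ℝ → X → ℝ} {s t τ : ℝ} {μ : X → ℝ}

lemma tendsto_dual_left (hT : IsTimeDependentTriple α β Q π) (hτ : τ ∈ Ioo α β)
    (ht : t ∈ Ioc α τ) (μ : X → ℝ) :
    Tendsto (fun s => dualHeatProp α Q τ s μ) (𝓝[<] t) (𝓝 (dualHeatProp α Q τ t μ)) := by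
  have h := ((hT.dual_spec hτ μ).continuousOn t ht).tendsto
  refine h.mono_left (nhdsWithin_le_iff.2 ?_)
  filter_upwards [Ioo_mem_nhdsLT ht.1] with s hs
  exact ⟨hs.1, hs.2.le.trans ht.2⟩

lemma tendsto_entropy_dual_left (hT : IsTimeDependentTriple α β Q π) (hτ : τ ∈ Ioo α β)
    (ht : t ∈ Ioc α τ) (μ : X → ℝ) :
    Tendsto (fun s => entropy (π s) (dualHeatProp α Q τ s μ)) (𝓝[<] t)
      (𝓝 (entropy (π t) (dualHeatProp α Q τ t μ))) := by
  have htβ : t ∈ Ioo α β := ⟨ht.1, ht.2.trans_lt hτ.2⟩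
  rw [entropy_eq (hT.triple t htβ).pos]
  have hμ := tendsto_pi_nhds.1 (tendsto_dual_left hT hτ ht μ)
  have hπ : ∀ x, Tendsto (fun s => Real.log (π s x)) (𝓝[<] t) (𝓝 (Real.log (π t x))) := fun x =>
    (((hT.measure_lipschitz x).continuousOn.continuousAt
      (Ioo_mem_nhds htβ.1 htβ.2)).tendsto.mono_left nhdsWithin_le_nhds).log
      ((hT.triple t htβ).pos x).ne'
  have hlim : Tendsto (fun s => ∑ x, (dualHeatProp α Q τ s μ x * Real.log (dualHeatProp α Q τ s μ x)
      - dualHeatProp α Q τ s μ x * Real.log (π s x))) (𝓝[<] t) (𝓝 (∑ x, (dualHeatProp α Q τ t μ x *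
        Real.log (dualHeatProp α Q τ t μ x) - dualHeatProp α Q τ t μ x * Real.log (π t x)))) :=
    tendsto_finsetSum _ fun x _ => (((Real.continuous_mul_log.tendsto _).comp (hμ x)).sub
      ((hμ x).mul (hπ x)))
  refine hlim.congr' ?_
  filter_upwards [Ioo_mem_nhdsLT ht.1] with s hs
  rw [entropy_eq (hT.triple s ⟨hs.1, hs.2.trans htβ.2⟩).pos]

lemma exists_continuous_speed (hT : IsTimeDependentTriple α β Q π) (hτ : τ ∈ Ioo α β)
    (hμ : μ ∈ stdSimplex ℝ X) {r : ℝ} (hr : r ∈ Ioo α β) : ∃ m : ℝ → ℝ,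
    ContinuousOn m (Ioo α τ) ∧ (∀ u, 0 ≤ m u) ∧ ∀ u ∈ Ioo α τ, ∀ c : ℝ, m u < c →
      ∀ᶠ z in 𝓝[>] u, transportDist (Q r) (dualHeatProp α Q τ u μ) (dualHeatProp α Q τ z μ) ≤
        ENNReal.ofReal (c * (z - u)) := by
  obtain ⟨C, hC, hdist⟩ := (hT.triple r hr).exists_transportDist_le_of_lower_bound
  set ν : ℝ → X → ℝ := fun u => dualHeatProp α Q τ u μ with hν
  have hνc : ContinuousOn ν (Ioo α τ) :=
    (hT.dual_spec hτ μ).continuousOn.mono Ioo_subset_Ioc_self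
  have hpos : ∀ u ∈ Ioo α τ, ∀ x, 0 < ν u x := fun u hu => hT.dual_pos hτ hu hμ
  have hmem : ∀ u ∈ Ioo α τ, ν u ∈ stdSimplex ℝ X := fun u hu =>
    hT.dual_mem hτ (Ioo_subset_Ioc_self hu) hμ
  refine ⟨fun u => C * ‖dualLaplacian (Q u) (ν u)‖ * ∑ x, (√(ν u x / 2))⁻¹, ?_, fun u => ?_, ?_⟩
  · refine (continuousOn_const.mul (ContinuousOn.norm (continuousOn_pi.2 fun x =>
      continuousOn_dualLaplacian (fun x y => (hT.continuousOn_rate x y).mono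
        (Ioo_subset_Ioo_right hτ.2.le)) hνc x))).mul (continuousOn_finsetSum _ fun x _ => ?_)
    refine ContinuousOn.inv₀ (((continuousOn_pi.1 hνc x).div_const 2).sqrt) fun u hu => ?_
    exact (Real.sqrt_pos.2 (half_pos (hpos u hu x))).ne'
  · exact mul_nonneg (mul_nonneg hC (norm_nonneg _)) (Finset.sum_nonneg fun x _ =>
      inv_nonneg.2 (Real.sqrt_nonneg _))
  · intro u hu c hc
    have hne : Nonempty X := by
      by_contra hX
      rw [not_nonempty_iff] at hX
      simpa using hμ.2
    obtain ⟨x₀, hx₀⟩ := Finite.exists_min (ν u)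
    have hκ : 0 < ν u x₀ / 2 := half_pos (hpos u hu x₀)
    have hS : (√(ν u x₀ / 2))⁻¹ ≤ ∑ x, (√(ν u x / 2))⁻¹ :=
      Finset.single_le_sum (f := fun x => (√(ν u x / 2))⁻¹)
        (fun x _ => inv_nonneg.2 (Real.sqrt_nonneg _)) (Finset.mem_univ x₀)
    have hc' : C * ‖-dualLaplacian (Q u) (ν u)‖ / √(ν u x₀ / 2) < c := by
      rw [norm_neg, div_eq_mul_inv]
      exact (mul_le_mul_of_nonneg_left hS (mul_nonneg hC (norm_nonneg _))).trans_lt hc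
    have hslope : Tendsto (fun z => C * ‖slope ν u z‖ / √(ν u x₀ / 2)) (𝓝[>] u)
        (𝓝 (C * ‖-dualLaplacian (Q u) (ν u)‖ / √(ν u x₀ / 2))) := by
      have h1 := (hasDerivAt_iff_tendsto_slope.1 ((hT.dual_spec hτ μ).eqn u hu)).mono_left
        (nhdsWithin_mono u (s := Ioi u) fun z hz => ne_of_gt hz)
      exact ((h1.norm.const_mul C).div_const _)
    have hcont : ∀ᶠ z in 𝓝[>] u, ∀ x, ν u x₀ / 2 < ν z x := by
      refine eventually_all.2 fun x => ?_
      have h1 : ContinuousAt (fun z => ν z x) u :=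
        (continuousOn_pi.1 hνc x).continuousAt (Ioo_mem_nhds hu.1 hu.2)
      refine (h1.tendsto.mono_left nhdsWithin_le_nhds).eventually_const_lt ?_
      linarith [hx₀ x, hpos u hu x₀]
    filter_upwards [hslope.eventually_lt_const hc', hcont, Ioo_mem_nhdsGT hu.2] with z hz1 hz2 hz3
    have hzu : 0 < z - u := sub_pos.2 hz3.1
    have hz : z ∈ Ioo α τ := ⟨hu.1.trans hz3.1, hz3.2⟩
    refine (hdist (ν u) (hmem u hu) (ν z) (hmem z hz) _ hκ (fun x => ?_)
      fun x => (hz2 x).le).trans (ENNReal.ofReal_le_ofReal ?_)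
    · linarith [hx₀ x, hpos u hu x₀]
    · rw [slope_def_module, norm_smul, norm_inv, Real.norm_of_nonneg hzu.le] at hz1
      have h1 := mul_le_mul_of_nonneg_right hz1.le hzu.le
      refine le_trans (le_of_eq ?_) h1
      rw [norm_sub_rev (ν u)]
      field_simp

lemma transportDist_self {Q : X → X → ℝ} {π : X → ℝ} (h : IsMarkovTriple Q π)
    (hμ : μ ∈ stdSimplex ℝ X) : transportDist Q μ μ = 0 := by
  obtain ⟨C, _, hle⟩ := h.exists_transportDist_le_sqrt
  simpa using hle μ hμ μ hμ

lemma continuousOn_transportDist_toReal {Q : X → X → ℝ} {π : X → ℝ} (h : IsMarkovTriple Q π)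
    (hμ : μ ∈ stdSimplex ℝ X) {ν : ℝ → X → ℝ} {S : Set ℝ} (hν : ContinuousOn ν S)
    (hmem : ∀ u ∈ S, ν u ∈ stdSimplex ℝ X) :
    ContinuousOn (fun u => (transportDist Q μ (ν u)).toReal) S := by
  obtain ⟨C, hC, hle⟩ := h.exists_transportDist_le_sqrt
  have htri : ∀ u ∈ S, ∀ v ∈ S, (transportDist Q μ (ν v)).toReal ≤
      (transportDist Q μ (ν u)).toReal + C * √‖ν u - ν v‖ := by
    intro u hu v hv
    have h1 := (transportDist_triangle Q μ (ν u) (ν v)).trans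
      (add_le_add_right (hle _ (hmem u hu) _ (hmem v hv)) _)
    have hfin := h.transportDist_ne_top hμ (hmem u hu)
    have h2 := ENNReal.toReal_mono (ENNReal.add_ne_top.2 ⟨hfin, ENNReal.ofReal_ne_top⟩) h1
    rwa [ENNReal.toReal_add hfin ENNReal.ofReal_ne_top,
      ENNReal.toReal_ofReal (mul_nonneg hC (Real.sqrt_nonneg _))] at h2
  intro u hu
  have hlim : Tendsto (fun v => C * √‖ν v - ν u‖) (𝓝[S] u) (𝓝 0) := by
    have h1 : Tendsto (fun v => ‖ν v - ν u‖) (𝓝[S] u) (𝓝 0) :=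
      tendsto_iff_norm_sub_tendsto_zero.1 (hν u hu).tendsto
    simpa using h1.sqrt.const_mul C
  refine tendsto_iff_norm_sub_tendsto_zero.2 (squeeze_zero' (Eventually.of_forall fun _ =>
    norm_nonneg _) ?_ hlim)
  filter_upwards [self_mem_nhdsWithin] with v hv
  have h1 := htri u hu v hv
  have h2 := htri v hv u hu
  rw [norm_sub_rev] at h1
  rw [Real.norm_eq_abs, abs_le]
  constructor <;> linarith

lemma exists_locallyIntegrable_speed (hT : IsTimeDependentTriple α β Q π) (hτ : τ ∈ Ioo α β)
    (hμ : μ ∈ stdSimplex ℝ X) {r : ℝ} (hr : r ∈ Ioo α β) :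
    ∃ m : ℝ → ℝ, LocallyIntegrableOn m (Ioo α τ) volume ∧
    ∀ s ∈ Ioo α τ, ∀ t ∈ Ioo α τ, s ≤ t →
      transportDist (Q r) (dualHeatProp α Q τ s μ) (dualHeatProp α Q τ t μ) ≤
        ENNReal.ofReal (∫ u in s..t, m u) := by
  obtain ⟨m, hmc, hm0, hm⟩ := exists_continuous_speed hT hτ hμ hr
  refine ⟨m, hmc.locallyIntegrableOn measurableSet_Ioo, fun s hs t ht hst => ?_⟩
  have hsub : Icc s t ⊆ Ioo α τ := fun u hu => ⟨hs.1.trans_le hu.1, hu.2.trans_lt ht.2⟩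
  have hmem : ∀ u ∈ Icc s t, dualHeatProp α Q τ u μ ∈ stdSimplex ℝ X := fun u hu =>
    hT.dual_mem hτ (Ioo_subset_Ioc_self (hsub hu)) hμ
  have hMr := hT.triple r hr
  have hmem_s := hmem s ⟨le_rfl, hst⟩
  set f : ℝ → ℝ := fun u =>
    (transportDist (Q r) (dualHeatProp α Q τ s μ) (dualHeatProp α Q τ u μ)).toReal with hf
  have hfc : ContinuousOn f (Icc s t) := continuousOn_transportDist_toReal hMr hmem_s
    ((hT.dual_spec hτ μ).continuousOn.mono (hsub.trans Ioo_subset_Ioc_self)) hmem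
  have hint : IntervalIntegrable m volume s t :=
    (hmc.mono (by rwa [uIcc_of_le hst])).intervalIntegrable
  have hle := image_le_of_liminf_slope_right_le_deriv_boundary (f := f)
    (B := fun v => ∫ u in s..v, m u) (B' := m) hfc
    (by simp [hf, transportDist_self hMr hmem_s]) (by
      have := intervalIntegral.continuousOn_primitive_interval (μ := volume) (f := m) (a := s)
        (b := t) (by rw [uIcc_of_le hst]; exact (hmc.mono hsub).integrableOn_Icc)
      rwa [uIcc_of_le hst] at this)
    (fun u hu => by
      have hu' := hsub (Ico_subset_Icc_self hu)
      have hcat := hmc.continuousAt (Ioo_mem_nhds hu'.1 hu'.2)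
      exact (intervalIntegral.integral_hasDerivAt_right
        (hint.mono_set (uIcc_subset_uIcc_left (by rw [uIcc_of_le hst]; exact Ico_subset_Icc_self hu)))
        (hmc.stronglyMeasurableAtFilter isOpen_Ioo u hu') hcat).hasDerivWithinAt)
    (fun u hu c hc => by
      have hu' := hsub (Ico_subset_Icc_self hu)
      obtain ⟨c', hc1, hc2⟩ := exists_between hc
      refine Eventually.frequently ?_
      filter_upwards [hm u hu' c' hc1, Ioo_mem_nhdsGT hu.2] with z hz hz'
      have hzu : 0 < z - u := sub_pos.2 hz'.1
      have h1 := (transportDist_triangle (Q r) (dualHeatProp α Q τ s μ) (dualHeatProp α Q τ u μ)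
        (dualHeatProp α Q τ z μ)).trans (add_le_add_right hz _)
      have hfin := hMr.transportDist_ne_top hmem_s (hmem u (Ico_subset_Icc_self hu))
      have h2 := ENNReal.toReal_mono (ENNReal.add_ne_top.2 ⟨hfin, ENNReal.ofReal_ne_top⟩) h1
      rw [ENNReal.toReal_add hfin ENNReal.ofReal_ne_top, ENNReal.toReal_ofReal
        (mul_nonneg ((hm0 u).trans hc1.le) hzu.le)] at h2
      rw [slope_def_field, div_lt_iff₀ hzu]
      have h3 := mul_lt_mul_of_pos_right hc2 hzu
      simp only [hf]
      linarith) ⟨hst, le_rfl⟩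
  rw [← ENNReal.ofReal_toReal (hMr.transportDist_ne_top hmem_s (hmem t ⟨hst, le_rfl⟩))]
  exact ENNReal.ofReal_le_ofReal hle

lemma tendsto_transportDist_start (hT : IsTimeDependentTriple α β Q π) (hτ : τ ∈ Ioo α β)
    (hμ : μ ∈ stdSimplex ℝ X) {r : ℝ} (hr : r ∈ Ioo α β) :
    Tendsto (fun s => transportDist (Q r) (dualHeatProp α Q τ s μ) (dualHeatProp α Q τ τ μ))
      (𝓝[<] τ) (𝓝 0) := by
  obtain ⟨C, hC, hle⟩ := (hT.triple r hr).exists_transportDist_le_sqrt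
  have h1 := tendsto_iff_norm_sub_tendsto_zero.1
    (tendsto_dual_left hT hτ (right_mem_Ioc.2 hτ.1) μ)
  have h2 : Tendsto (fun s => ENNReal.ofReal
      (C * √‖dualHeatProp α Q τ s μ - dualHeatProp α Q τ τ μ‖)) (𝓝[<] τ) (𝓝 0) := by
    have := ENNReal.tendsto_ofReal (h1.sqrt.const_mul C)
    simpa using this
  refine tendsto_of_tendsto_of_tendsto_of_le_of_le' tendsto_const_nhds h2
    (Eventually.of_forall fun _ => zero_le) ?_
  filter_upwards [Ioo_mem_nhdsLT hτ.1] with s hs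
  exact hle _ (hT.dual_mem hτ (Ioo_subset_Ioc_self hs) hμ) _
    (hT.dual_mem hτ (right_mem_Ioc.2 hτ.1) hμ)

/-- The evolution variational inequality. -/
lemma le_lowerLeftDeriv (hT : IsTimeDependentTriple α β Q π) (hgrad : GradientEstimate α β Q)
    (hτ : τ ∈ Ioo α β) (hμ : μ ∈ stdSimplex ℝ X) (ht : t ∈ Ioc α τ) {σ : X → ℝ}
    (hσ : σ ∈ stdSimplex ℝ X) :
    ((entropy (π t) (dualHeatProp α Q τ t μ) - entropy (π t) σ : ℝ) : EReal) ≤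
      lowerLeftDeriv
        (fun s => 1 / 2 * (twoTimeCost Q s t (dualHeatProp α Q τ s μ) σ).toReal ^ 2) t := by
  have htβ : t ∈ Ioo α β := ⟨ht.1, ht.2.trans_lt hτ.2⟩
  have hμt := hT.dual_mem hτ ht hμ
  obtain ⟨s₀, hs₀, hs₀t⟩ := exists_between ht.1
  obtain ⟨L, hL0, hL⟩ := hT.exists_deriv_log_bound ⟨hs₀, hs₀t.trans htβ.2⟩ htβ
  set d := (transportDist (Q t) (dualHeatProp α Q τ t μ) σ).toReal with hd
  set f : ℝ → ℝ := fun s => 1 / 2 * (twoTimeCost Q s t (dualHeatProp α Q τ s μ) σ).toReal ^ 2 with hf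
  have hfs : ∀ s ∈ Ioo s₀ t, f s ≤ 1 / 2 * d ^ 2 + (t - s) ^ 2 * L +
      (t - s) * (entropy (π t) σ - entropy (π s) (dualHeatProp α Q τ s μ)) := by
    intro s hs
    have hsα : α < s := hs₀.trans hs.1
    have h1 := fun φ (hφ : IsHJSubsolution Q s t φ) =>
      pairing_sub_le_of_bound hT hgrad ⟨hsα, hs.2.trans htβ.2⟩ htβ hs.2
        (fun r hr => hL r ⟨hs.1.le.trans hr.1, hr.2⟩) hμt hσ hφ
    rw [hT.dual_comp hτ ht ⟨hsα, hs.2.le⟩ μ] at h1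
    exact (twoTimeCost_le h1).2
  have hft : 1 / 2 * d ^ 2 ≤ f t := by
    have hfin := (twoTimeCost_le fun φ (hφ : IsHJSubsolution Q t t φ) =>
      pairing_sub_le_of_static_dist (hT.triple t htβ) hμt hσ hφ).1
    have h1 := ENNReal.toReal_mono hfin (transportDist_le_twoTimeCost (hT.triple t htβ) hμt hσ)
    have h2 := pow_le_pow_left₀ ENNReal.toReal_nonneg h1 2
    simp only [hf]
    linarith
  have hlim : Tendsto (fun s => (((entropy (π s) (dualHeatProp α Q τ s μ) - entropy (π t) σ) -
      (t - s) * L : ℝ) : EReal)) (𝓝[<] t)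
      (𝓝 ((entropy (π t) (dualHeatProp α Q τ t μ) - entropy (π t) σ : ℝ) : EReal)) := by
    have h1 : Tendsto (fun s : ℝ => (t - s) * L) (𝓝[<] t) (𝓝 ((t - t) * L)) :=
      (Continuous.tendsto (by fun_prop) t).mono_left nhdsWithin_le_nhds
    have h2 := ((tendsto_entropy_dual_left hT hτ ht μ).sub_const (entropy (π t) σ)).sub h1
    rw [sub_self, zero_mul, sub_zero] at h2
    exact (continuous_coe_real_ereal.tendsto _).comp h2
  rw [lowerLeftDeriv, ← hlim.liminf_eq]
  refine liminf_le_liminf ?_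
  filter_upwards [Ioo_mem_nhdsLT hs₀t] with s hs
  rw [EReal.coe_le_coe_iff]
  have hneg : s - t < 0 := sub_neg.2 hs.2
  rw [le_div_iff_of_neg hneg]
  have h1 := hfs s hs
  nlinarith [h1, hft]

lemma twoTimeCost_dual_ne_top (hT : IsTimeDependentTriple α β Q π)
    (hgrad : GradientEstimate α β Q) (hτ : τ ∈ Ioo α β) (hμ : μ ∈ stdSimplex ℝ X)
    (hs : s ∈ Ioo α β) (ht : t ∈ Ioc α τ) (hst : s ≤ t) {σ : X → ℝ} (hσ : σ ∈ stdSimplex ℝ X) :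
    twoTimeCost Q s t (dualHeatProp α Q τ s μ) σ ≠ ⊤ := by
  have htβ : t ∈ Ioo α β := ⟨ht.1, ht.2.trans_lt hτ.2⟩
  have hμt := hT.dual_mem hτ ht hμ
  rcases hst.eq_or_lt with rfl | hlt
  · exact (twoTimeCost_le fun φ hφ =>
      pairing_sub_le_of_static_dist (hT.triple s htβ) hμt hσ hφ).1
  · obtain ⟨L, _, hL⟩ := hT.exists_deriv_log_bound hs htβ
    rw [← hT.dual_comp hτ ht ⟨hs.1, hst⟩ μ]
    exact (twoTimeCost_le fun φ hφ => pairing_sub_le_of_bound hT hgrad hs htβ hlt hL hμt hσ hφ).1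

end Flow

end SRF

end

theorem proposition4p5 {X : Type*} [Fintype X] {α β : ℝ}
    (Q : ℝ → X → X → ℝ) (π : ℝ → X → ℝ)
    (hT : SRF.IsTimeDependentTriple α β Q π)
    (hgrad : SRF.GradientEstimate α β Q)
    (τ : ℝ) (hτ : τ ∈ Ioo α β) (μ : X → ℝ) (hμ : μ ∈ stdSimplex ℝ X) :
    (∀ s ∈ Ioo α β, ∀ t ∈ Ioo α β, s < t → t ≤ τ → ∀ σ ∈ stdSimplex ℝ X,
      SRF.transportDist (Q t) (SRF.dualHeatProp α Q τ t μ) σ ≠ ⊤ ∧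
      SRF.twoTimeCost Q s t (SRF.dualHeatProp α Q τ s μ) σ ≠ ⊤ ∧
      ∀ γ : ℝ → X → ℝ, SRF.IsGeodesic (Q t) (SRF.dualHeatProp α Q τ t μ) σ γ →
        IntervalIntegrable
          (fun a => SRF.pairing
            (fun x => deriv (fun r => Real.log (π r x)) (SRF.interp s t a))
            (SRF.dualHeatProp α Q t (SRF.interp s t a) (γ a))) volume 0 1 ∧
        SRF.entropy (π s) (SRF.dualHeatProp α Q τ s μ) - SRF.entropy (π t) σ ≤
          1 / (2 * (t - s)) *
            ((SRF.transportDist (Q t) (SRF.dualHeatProp α Q τ t μ) σ).toReal ^ 2 -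
              (SRF.twoTimeCost Q s t (SRF.dualHeatProp α Q τ s μ) σ).toReal ^ 2) +
          (t - s) * ∫ a in (0 : ℝ)..1, SRF.pairing
            (fun x => deriv (fun r => Real.log (π r x)) (SRF.interp s t a))
            (SRF.dualHeatProp α Q t (SRF.interp s t a) (γ a))) ∧
    SRF.IsDynamicUpwardEVI α β τ Q π (fun t => SRF.dualHeatProp α Q τ t μ) := by
  refine ⟨fun s hs t ht hst htτ σ hσ => ?_, ?_⟩
  · have htτ' : t ∈ Ioc α τ := ⟨ht.1, htτ⟩
    have hμt := hT.dual_mem hτ htτ' hμ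
    refine ⟨(hT.triple t ht).transportDist_ne_top hμt hσ,
      SRF.twoTimeCost_dual_ne_top hT hgrad hτ hμ hs htτ' hst.le hσ, fun γ hγ => ⟨?_, ?_⟩⟩
    · exact hT.intervalIntegrable_pairing_deriv_log hs ht (SRF.continuous_interp s t)
        (fun r hr => SRF.interp_mem hst.le hr) (hT.continuousOn_dual_comp ht
          (SRF.continuous_interp s t).continuousOn
          (fun r hr => ⟨hs.1.trans_le (SRF.interp_mem hst.le hr).1, (SRF.interp_mem hst.le hr).2⟩)
          (hγ.continuousOn (hT.triple t ht)))
    · have h1 := fun φ (hφ : SRF.IsHJSubsolution Q s t φ) =>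
        SRF.pairing_sub_le_of_geodesic hT hgrad hs ht hst hγ hφ
      rw [hT.dual_comp hτ htτ' ⟨hs.1, hst.le⟩ μ] at h1
      have h2 := (SRF.twoTimeCost_le h1).2
      have hpos : 0 < t - s := sub_pos.2 hst
      have h3 := mul_le_mul_of_nonneg_left h2 (inv_pos.2 hpos).le
      rw [← sub_nonneg] at h3 ⊢
      refine h3.trans (le_of_eq ?_)
      field_simp
      ring
  · exact
      { mem := fun t ht htτ => hT.dual_mem hτ ⟨ht.1, htτ⟩ hμ
        locally_ac := fun r hr => SRF.exists_locallyIntegrable_speed hT hτ hμ hr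
        continuous_start := fun r hr => SRF.tendsto_transportDist_start hT hτ hμ hr
        cost_finite := fun s hs t ht hst htτ σ hσ =>
          SRF.twoTimeCost_dual_ne_top hT hgrad hτ hμ hs ⟨ht.1, htτ⟩ hst hσ
        evi := fun t ht htτ σ hσ => SRF.le_lowerLeftDeriv hT hgrad hτ hμ ⟨ht.1, htτ⟩ hσ }
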